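/- Fix $0<q<1$. For complex $a,a_1,\dots,a_j$, a base $u\in\{q,q^{-1}\}$ and $k\in\mathbb Z_+=\{0,1,2,\dots\}$ put $(a;u)_k=\prod_{i=0}^{k-1}(1-au^i)$ and $(a_1,\dots,a_j;u)_k=\prod_{i=1}^{j}(a_i;u)_k$, and let $${}_{r+1}\varphi_r\left({a_1,\dots,a_{r+1}\atop b_1,\dots,b_r};q,z\right)=\sum_{k=0}^\infty\frac{(a_1,\dots,a_{r+1};q)_k}{(q,b_1,\dots,b_r;q)_k}z^k .$$ Let $p_n$ denote the Askey-Wilson polynomials, $$p_n(\cos\theta;a,b,c,d\mid q)=a^{-n}(ab,ac,ad;q)_n\;{}_4\varphi_3\left({q^{-n},abcdq^{n-1},ae^{i\theta},ae^{-i\theta}\atop ab,\,ac,\,ad};q,q\right)\qquad(\theta\in\mathbb C),$$ and define the $q$-Jacobi polynomials ($q$-Legendre polynomials if $\alpha=\beta=0$), the $q$-Laguerre polynomials and the big $q$-Jacobi polynomials (big $q$-ultraspherical if $\alpha=\beta$) by $$p_n^{(\alpha,\beta)}(x;s,t\mid q)=p_n(x;q^{1/2+\alpha}s/t,\,q^{1/2}t/s,\,-q^{1/2}/(st),\,-stq^{1/2+\beta}\mid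 q),$$ $$l_n^{(\alpha)}(x;s,t\mid q)=p_n(x;q^{1/2+\alpha}s/t,\,q^{1/2}t/s,\,-q^{1/2}/(st),\,0\mid q),$$ $$P_n^{(\alpha,\beta)}(x;c,d;q)={}_3\varphi_2\left({q^{-n},\,q^{n+\alpha+\beta+1},\,q^{1+\alpha}x/c\atop q^{\alpha+1},\,-q^{1+\alpha}d/c};q,q\right).$$ **Theorem 4.1.** For all $l,m,p\in\mathbb Z_+$, $\sigma,\tau\in\mathbb R$ and $x\in\mathbb C$, $$\begin{aligned} &p^{(0,0)}_l(x;q^\tau,q^\sigma\mid q)\, l_m^{(p)}(x;q^\tau,q^\sigma\mid q)\\ &=\sum_{n=0}^l D^{n,l}(\tau,\sigma)\,P^{(n,n)}_{l-n}(-q^m;q^{2\tau},1;q)\,P^{(n,n)}_{l-n}(-q^{m+p};q^{2\sigma},1;q)\,l_{m+n}^{(p)}(x;q^\tau,q^\sigma\mid q)\\ &\quad+\sum_{n=1}^l D^{n,l}(\tau,\sigma)\,(q^m,q^{m+p},-q^{m+p-2\sigma},-q^{m-2\tau};q^{-1})_n\\ &\qquad\qquad\times P^{(n,n)}_{l-n}(-q^{m-n};q^{2\tau},1;q)\,P^{(n,n)}_{l-n}(-q^{m+p-n};q^{2\sigma},1;q)\,l_{m-n}^{(p)}(x;q^\tau,q^\sigma\mid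 q), \end{aligned}$$ where $$D^{n,l}(\tau,\sigma)=(-q^{2\sigma-l},-q^{2\tau-l};q)_{l-n}\,\frac{(q^{l-n+1};q)_n}{(q;q)_n}\,(q^{n+1};q)_l\;q^{\frac12(l-n)(l-n-2\sigma-2\tau)} .$$ In the second sum the terms with $n>m$ are zero, because their factor $(q^m;q^{-1})_n$ vanishes. -/

import Mathlib

noncomputable section

/-- The `q`-shifted factorial `(a; q)_k = ∏_{i=0}^{k-1} (1 - a q^i)`. -/
def qShifted (a q : ℂ) (k : ℕ) : ℂ :=
  ∏ i ∈ Finset.range k, (1 - a * q ^ i)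

/-- The multiple `q`-shifted factorial `(a_1, …, a_r; q)_k = ∏_i (a_i; q)_k`. -/
def qShiftedList (as : List ℂ) (q : ℂ) (k : ℕ) : ℂ :=
  (as.map fun a => qShifted a q k).prod

/-- The basic hypergeometric series
`_{r+1}φ_r (a_1, …, a_{r+1}; b_1, …, b_r; q, z)
  = ∑_{k ≥ 0} (a_1, …, a_{r+1}; q)_k / (q, b_1, …, b_r; q)_k * z^k`.
It is used below only with a numerator parameter `q^{-n}`, where it terminates. -/
def basicHypergeometric (as bs : List ℂ) (q z : ℂ) : ℂ :=
  ∑' k : ℕ, qShiftedList as q k / qShiftedList (q :: bs) q k * z ^ k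

/-- The Askey-Wilson polynomial at `cos θ`, as a function of the (complex) angle `θ`:
`a^{-n} (ab, ac, ad; q)_n
  * _4φ_3 (q^{-n}, abcd q^{n-1}, a e^{iθ}, a e^{-iθ}; ab, ac, ad; q, q)`. -/
def askeyWilsonAngle (n : ℕ) (θ a b c d q : ℂ) : ℂ :=
  a ^ (-(n : ℤ)) * qShiftedList [a * b, a * c, a * d] q n *
    basicHypergeometric
      [q ^ (-(n : ℤ)), a * b * c * d * q ^ ((n : ℤ) - 1),
        a * Complex.exp (Complex.I * θ), a * Complex.exp (-(Complex.I * θ))]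
      [a * b, a * c, a * d] q q

/-- The Askey-Wilson polynomial `p_n(x; a, b, c, d | q)`, for complex `x`: write `x = cos θ` with a
complex `θ`. The value does not depend on the choice of `θ`, see `askeyWilson_cos`. -/
def askeyWilson (n : ℕ) (x a b c d q : ℂ) : ℂ :=
  askeyWilsonAngle n (Function.surjInv Complex.cos_surjective x) a b c d q

theorem askeyWilson_cos (n : ℕ) (θ a b c d q : ℂ) :
    askeyWilson n (Complex.cos θ) a b c d q = askeyWilsonAngle n θ a b c d q := by
  have h := Function.surjInv_eq Complex.cos_surjective (Complex.cos θ)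
  unfold askeyWilson
  generalize Function.surjInv Complex.cos_surjective (Complex.cos θ) = φ at h
  have key : ∀ k : ℕ, ∀ ψ : ℂ,
      qShifted (a * Complex.exp (Complex.I * ψ)) q k *
        qShifted (a * Complex.exp (-(Complex.I * ψ))) q k =
      ∏ i ∈ Finset.range k, (1 - 2 * a * Complex.cos ψ * q ^ i + (a * q ^ i) ^ 2) := by
    intro k ψ
    unfold qShifted
    rw [← Finset.prod_mul_distrib]
    refine Finset.prod_congr rfl fun i _ => ?_
    have h1 : Complex.exp (Complex.I * ψ) * Complex.exp (-(Complex.I * ψ)) = 1 := by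
      rw [← Complex.exp_add]; simp
    have h2 : 2 * Complex.cos ψ =
        Complex.exp (Complex.I * ψ) + Complex.exp (-(Complex.I * ψ)) := by
      rw [Complex.two_cos, mul_comm ψ, neg_mul, mul_comm ψ]
    linear_combination (a * q ^ i) ^ 2 * h1 + (a * q ^ i) * h2
  unfold askeyWilsonAngle basicHypergeometric
  congr 1
  refine tsum_congr fun k => ?_
  simp only [qShiftedList, List.map_cons, List.map_nil, List.prod_cons, List.prod_nil, mul_one]
  rw [key k φ, key k θ, h]

/-- The `q`-analogue of the Jacobi polynomial
`p_n^{(α,β)}(x; s, t | q)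
  = p_n(x; q^{1/2+α} s/t, q^{1/2} t/s, -q^{1/2}/(st), -s t q^{1/2+β} | q)`;
for `α = β = 0` this is the `q`-Legendre polynomial. -/
def qJacobi (n : ℕ) (α β : ℝ) (x : ℂ) (s t q : ℝ) : ℂ :=
  askeyWilson n x
    ((q ^ (1 / 2 + α) * s / t : ℝ) : ℂ) ((q ^ (1 / 2 : ℝ) * t / s : ℝ) : ℂ)
    ((-(q ^ (1 / 2 : ℝ)) / (s * t) : ℝ) : ℂ) ((-(s * t * q ^ (1 / 2 + β)) : ℝ) : ℂ) (q : ℂ)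

/-- The `q`-Laguerre polynomial
`l_n^{(α)}(x; s, t | q) = p_n(x; q^{1/2+α} s/t, q^{1/2} t/s, -q^{1/2}/(st), 0 | q)`. -/
def qLaguerre (n : ℕ) (α : ℝ) (x : ℂ) (s t q : ℝ) : ℂ :=
  askeyWilson n x
    ((q ^ (1 / 2 + α) * s / t : ℝ) : ℂ) ((q ^ (1 / 2 : ℝ) * t / s : ℝ) : ℂ)
    ((-(q ^ (1 / 2 : ℝ)) / (s * t) : ℝ) : ℂ) 0 (q : ℂ)

/-- The big `q`-Jacobi polynomial
`P_n^{(α,β)}(x; c, d; q)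
  = _3φ_2 (q^{-n}, q^{n+α+β+1}, q^{1+α} x/c; q^{α+1}, -q^{1+α} d/c; q, q)`. -/
def bigQJacobi (n : ℕ) (α β : ℝ) (x : ℂ) (c d q : ℝ) : ℂ :=
  basicHypergeometric
    [(q : ℂ) ^ (-(n : ℤ)), ((q ^ ((n : ℝ) + α + β + 1) : ℝ) : ℂ),
      ((q ^ (1 + α) : ℝ) : ℂ) * x / (c : ℂ)]
    [((q ^ (α + 1) : ℝ) : ℂ), ((-(q ^ (1 + α) * d / c) : ℝ) : ℂ)] (q : ℂ) (q : ℂ)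

/-- The constant
`D^{n,l}(τ,σ) = (-q^{2σ-l}, -q^{2τ-l}; q)_{l-n} * (q^{l-n+1}; q)_n / (q; q)_n
  * (q^{n+1}; q)_l * q^{(l-n)(l-n-2σ-2τ)/2}`, for `0 ≤ n ≤ l`. -/
def additionConst (n l : ℕ) (τ σ q : ℝ) : ℂ :=
  qShiftedList [((-(q ^ (2 * σ - l)) : ℝ) : ℂ), ((-(q ^ (2 * τ - l)) : ℝ) : ℂ)] q (l - n) *
    (qShifted ((q : ℂ) ^ (l - n + 1)) q n / qShifted q q n) *
    qShifted ((q : ℂ) ^ (n + 1)) q l *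
    ((q ^ (1 / 2 * ((l : ℝ) - n) * ((l : ℝ) - n - 2 * σ - 2 * τ)) : ℝ) : ℂ)

end

noncomputable section

/-! Put `X = 2 cos θ`, `q = r²`, `s = q^τ`, `t = q^σ`. The `q`-Legendre polynomials `P l` and the
`q`-Laguerre polynomials `L m` both satisfy three-term recurrences for multiplication by `X`; in the
second one the coefficients depend on `m` only through `u = q^m` and `v = q^(m+p)`. So `P l` acts on
the family `L m` as a polynomial in a tridiagonal operator, and the addition formula lists its
matrix entries.

These entries are found by induction on `l` (`addition_formula_of_recurrences`). The product `X * P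
(l+1) * L m` is computed once with the Legendre recurrence and once by letting `X` act on the
expansion (`tridiagonal_action`). Comparing coefficients of `L (m ± n)` leaves a difference equation
for the proposed coefficients: three neighbouring orders in degree `l+1` on one side, the degrees
`l`, `l+1`, `l+2` in the middle order on the other. It is proved in `additionCoeff_zero_recurrence`,
`additionCoeff_upper_recurrence` and `additionCoeff_lower_recurrence`.

Each coefficient is a scalar times a big `q`-ultraspherical polynomial in `u` times one in `v`.
Contiguous relations express the neighbouring orders, and the three-term recurrence expresses degree
`l`, through the polynomials `f`, `h` of the middle order in degrees `l+1` and `l+2`. The difference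
equation then becomes an identity that is bilinear in `(f, h)` and `(f', h')` with rational
coefficients (`bilinear_upper`, `bilinear_lower`). For `L (m + n)` the arguments stay at `q^m`,
`q^(m+p)`; for `L (m - n)` they move by a factor `q` at each order, so every raising or lowering
relation has a shifted twin. The prefactors in the raising relations multiply to the subdiagonal
Laguerre coefficient; products of these give the extra `q⁻¹`-shifted factor in the second sum. -/

/-! ### Shifted factorials and their reciprocals -/

theorem qShifted_zero (a q : ℂ) : qShifted a q 0 = 1 := by simp [qShifted]

theorem qShifted_succ (a q : ℂ) (k : ℕ) :
    qShifted a q (k + 1) = qShifted a q k * (1 - a * q ^ k) := by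
  simp [qShifted, Finset.prod_range_succ]

theorem qShifted_succ' (a q : ℂ) (k : ℕ) :
    qShifted a q (k + 1) = (1 - a) * qShifted (a * q) q k := by
  simp only [qShifted, Finset.prod_range_succ']
  rw [mul_comm]
  congr 1
  · simp
  · exact Finset.prod_congr rfl fun i _ => by ring

theorem qShifted_ne_zero {a q : ℂ} (h : ∀ k : ℕ, 1 - a * q ^ k ≠ 0) (k : ℕ) :
    qShifted a q k ≠ 0 :=
  Finset.prod_ne_zero_iff.2 fun i _ => h i

/-- The base is nonzero and not a root of unity. -/
structure GenericBase (q : ℂ) : Prop where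
  ne_zero : q ≠ 0
  pow_ne_one : ∀ k : ℕ, q ^ (k + 1) ≠ 1

theorem GenericBase.one_sub_pow_ne {q : ℂ} (hq : GenericBase q) (k : ℕ) :
    1 - q ^ (k + 1) ≠ 0 := sub_ne_zero.2 (hq.pow_ne_one k).symm

theorem GenericBase.one_add_pow_ne {q : ℂ} (hq : GenericBase q) (k : ℕ) :
    1 + q ^ (k + 1) ≠ 0 := by
  intro h
  apply hq.pow_ne_one (2 * k + 1)
  linear_combination (q ^ (k + 1) - 1) * h

theorem GenericBase.qShifted_ne {q : ℂ} (hq : GenericBase q) (k : ℕ) : qShifted q q k ≠ 0 :=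
  qShifted_ne_zero (fun k => by rw [← pow_succ']; exact hq.one_sub_pow_ne k) k

/-- The reciprocal of `(q; q)_j`, extended by zero to negative `j`. -/
def recipQFactorial (q : ℂ) (j : ℤ) : ℂ :=
  if 0 ≤ j then (qShifted q q j.toNat)⁻¹ else 0

theorem recipQFactorial_natCast (q : ℂ) (j : ℕ) :
    recipQFactorial q j = (qShifted q q j)⁻¹ := by simp [recipQFactorial]

theorem recipQFactorial_of_neg (q : ℂ) {j : ℤ} (hj : j < 0) : recipQFactorial q j = 0 := by
  simp [recipQFactorial, hj]

/-- The extension by zero is consistent at `j = -1` because the factor `1 - q^0` vanishes there.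
Ratios of coefficients can thus be manipulated without separating the terms at the end of a
terminating series. -/
theorem recipQFactorial_eq {q : ℂ} (hq : GenericBase q) (j : ℤ) :
    recipQFactorial q j = (1 - q ^ (j + 1)) * recipQFactorial q (j + 1) := by
  rcases lt_trichotomy j (-1) with h | h | h
  · rw [recipQFactorial_of_neg q (by omega), recipQFactorial_of_neg q (by omega), mul_zero]
  · subst h
    rw [recipQFactorial_of_neg q (by omega)]
    simp
  · obtain ⟨i, rfl⟩ := Int.eq_ofNat_of_zero_le (show 0 ≤ j by omega)
    have e : ((i : ℤ) + 1) = ((i + 1 : ℕ) : ℤ) := by push_cast; rfl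
    rw [e, recipQFactorial_natCast, recipQFactorial_natCast, qShifted_succ, zpow_natCast]
    have h1 := hq.qShifted_ne i
    have h2 := hq.one_sub_pow_ne i
    rw [pow_succ'] at h2 ⊢
    field_simp

/-! ### Coefficients of the big q-ultraspherical polynomials -/

/-- The part of the coefficients below that does not change when the degree does. -/
def seriesFactor (q w : ℂ) (n k : ℕ) : ℂ :=
  (-1) ^ k * q ^ ((k + 1).choose 2) / (qShifted q q k * qShifted q q (n + k) * qShifted w q (n + k))

/-- The coefficient of `(w u q^n; q)_k` in `bigQUltra q w n l u`. -/
def bigQUltraCoeff (q w : ℂ) (n l k : ℕ) : ℂ :=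
  seriesFactor q w n k * (q ^ n / q ^ l) ^ k * recipQFactorial q ((l : ℤ) - n - k) *
    qShifted q q (l + n + k)

/-- The big `q`-ultraspherical polynomial of degree `l - n` and order `n` in a normalization in
which it vanishes for `l < n`; here `w = -q d / c`. -/
def bigQUltra (q w : ℂ) (n l : ℕ) (u : ℂ) : ℂ :=
  ∑ k ∈ Finset.range (l + 1), bigQUltraCoeff q w n l k * qShifted (w * u * q ^ n) q k

theorem bigQUltraCoeff_of_lt (q w : ℂ) {n l k : ℕ} (h : l < n + k) :
    bigQUltraCoeff q w n l k = 0 := by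
  rw [bigQUltraCoeff, recipQFactorial_of_neg q (by omega)]
  ring

theorem bigQUltra_eq_sum (q w : ℂ) (n : ℕ) {l N : ℕ} (h : l + 1 ≤ N) (u : ℂ) :
    bigQUltra q w n l u =
      ∑ k ∈ Finset.range N, bigQUltraCoeff q w n l k * qShifted (w * u * q ^ n) q k := by
  refine Finset.sum_subset (Finset.range_mono h) fun k _ hk => ?_
  rw [bigQUltraCoeff_of_lt, zero_mul]
  simp at hk
  omega

theorem bigQUltra_of_lt (q w : ℂ) {n l : ℕ} (h : l < n) (u : ℂ) : bigQUltra q w n l u = 0 :=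
  Finset.sum_eq_zero fun k _ => by rw [bigQUltraCoeff_of_lt q w (by omega), zero_mul]

theorem seriesFactor_succ {q w : ℂ} (hq : GenericBase q) (hw : ∀ k : ℕ, 1 - w * q ^ k ≠ 0)
    (n k : ℕ) :
    seriesFactor q w n (k + 1) = seriesFactor q w n k * (-(q * q ^ k)) /
      ((1 - q * q ^ k) * (1 - q * q ^ n * q ^ k) * (1 - w * q ^ n * q ^ k)) := by
  have h1 := hq.qShifted_ne k
  have h2 := hq.qShifted_ne (n + k)
  have h3 := qShifted_ne_zero hw (n + k)
  have h4 := hq.one_sub_pow_ne k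
  have h5 := hq.one_sub_pow_ne (n + k)
  have h6 := hw (n + k)
  have e : (k + 1 + 1).choose 2 = (k + 1).choose 2 + (k + 1) := by
    rw [Nat.choose_succ_succ' (k + 1) 1]; simp; ring
  unfold seriesFactor
  rw [e, ← add_assoc n k 1, qShifted_succ, qShifted_succ, qShifted_succ]
  rw [pow_succ'] at h4 h5
  rw [pow_add] at h5 h6
  simp only [pow_add, pow_one]
  rw [← mul_assoc] at h5 h6
  simp only [← mul_assoc]
  generalize 1 - w * q ^ n * q ^ k = A at *
  generalize 1 - q * q ^ n * q ^ k = B at *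
  field_simp

theorem seriesFactor_order {q w : ℂ} (hq : GenericBase q) (hw : ∀ k : ℕ, 1 - w * q ^ k ≠ 0)
    (n k : ℕ) :
    seriesFactor q w n k =
      seriesFactor q w (n + 1) k * ((1 - q * q ^ n * q ^ k) * (1 - w * q ^ n * q ^ k)) := by
  have h1 := hq.qShifted_ne k
  have h2 := hq.qShifted_ne (n + k)
  have h3 := qShifted_ne_zero hw (n + k)
  have h5 := hq.one_sub_pow_ne (n + k)
  have h6 := hw (n + k)
  unfold seriesFactor
  rw [show n + 1 + k = (n + k) + 1 by ring, qShifted_succ, qShifted_succ]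
  rw [pow_succ'] at h5
  rw [pow_add] at h5 h6 ⊢
  rw [← mul_assoc] at h5 h6
  simp only [← mul_assoc]
  generalize 1 - w * q ^ n * q ^ k = A at *
  generalize 1 - q * q ^ n * q ^ k = B at *
  field_simp

/-- The common factor of `bigQUltraCoeff` at `(n, l, k)`, `(n, l + 1, k)` and `(n + 1, l, k)`. -/
def coeffCore (q w : ℂ) (n l k : ℕ) : ℂ :=
  seriesFactor q w n k * (q ^ n / q ^ l) ^ k * recipQFactorial q ((l : ℤ) + 1 - n - k) *
    qShifted q q (l + n + k)

theorem coeffCore_of_lt (q w : ℂ) {n l k : ℕ} (h : l + 1 < n + k) : coeffCore q w n l k = 0 := by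
  rw [coeffCore, recipQFactorial_of_neg q (by omega)]
  ring

theorem zpow_degree {q : ℂ} (hq : q ≠ 0) (l n k : ℕ) :
    q ^ ((l : ℤ) - n - k) = q ^ l / (q ^ n * q ^ k) := by
  rw [zpow_sub₀ hq, zpow_sub₀ hq, zpow_natCast, zpow_natCast, zpow_natCast, div_div]

theorem recip_degree {q : ℂ} (hq : GenericBase q) (l n k : ℕ) :
    recipQFactorial q ((l : ℤ) - n - k) =
      (1 - q * q ^ l / (q ^ n * q ^ k)) * recipQFactorial q ((l : ℤ) + 1 - n - k) := by
  rw [recipQFactorial_eq hq, show (l : ℤ) - n - k + 1 = ((l + 1 : ℕ) : ℤ) - n -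
    k by push_cast; ring,
    zpow_degree hq.ne_zero, pow_succ']
  push_cast
  rfl

theorem bigQUltraCoeff_eq_core {q : ℂ} (hq : GenericBase q) (w : ℂ) (n l k : ℕ) :
    bigQUltraCoeff q w n l k = coeffCore q w n l k * (1 - q * q ^ l / (q ^ n * q ^ k)) := by
  rw [bigQUltraCoeff, coeffCore, recip_degree hq]
  ring

theorem bigQUltraCoeff_degree_succ {q : ℂ} (hq : GenericBase q) (w : ℂ) (n l k : ℕ) :
    bigQUltraCoeff q w n (l + 1) k =
      coeffCore q w n l k * ((1 - q * q ^ l * q ^ n * q ^ k) / q ^ k) := by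
  have h := hq.ne_zero
  rw [bigQUltraCoeff, coeffCore, show l + 1 + n + k = l + n + k + 1 by ring, qShifted_succ]
  push_cast
  rw [pow_succ' q l, pow_add, pow_add, ← div_div, div_right_comm, div_pow _ q]
  field_simp

theorem bigQUltraCoeff_order_succ {q w : ℂ} (hq : GenericBase q)
    (hw : ∀ k : ℕ, 1 - w * q ^ k ≠ 0) (n l k : ℕ) :
    bigQUltraCoeff q w (n + 1) l k =
      coeffCore q w n l k * (q ^ k * (1 - q * q ^ l / (q ^ n * q ^ k)) *
        (1 - q ^ l / (q ^ n * q ^ k)) * (1 - q * q ^ l * q ^ n * q ^ k) /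
        ((1 - q * q ^ n * q ^ k) * (1 - w * q ^ n * q ^ k))) := by
  have h := hq.ne_zero
  have h5 := hq.one_sub_pow_ne (n + k)
  have h6 := hw (n + k)
  rw [pow_succ'] at h5
  rw [pow_add] at h5 h6
  rw [← mul_assoc] at h5 h6
  rw [bigQUltraCoeff, coeffCore, seriesFactor_order hq hw n k,
    show l + (n + 1) + k = l + n + k + 1 by ring, qShifted_succ, recip_degree hq,
    show (l : ℤ) + 1 - (n + 1 : ℕ) - k = (l : ℤ) - n - k by push_cast; ring, recip_degree hq]
  rw [pow_succ' q n, pow_add, pow_add, mul_div_assoc, mul_pow]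
  have e : q * q ^ l / (q * q ^ n * q ^ k) = q ^ l / (q ^ n * q ^ k) := by field_simp
  rw [e]
  generalize 1 - w * q ^ n * q ^ k = A at *
  generalize 1 - q * q ^ n * q ^ k = B at *
  field_simp

/-- For the lowering relations, which take order `n + 1` as the reference order; hence the core of
order `n + 1` instead of `n`. -/
theorem bigQUltraCoeff_order_pred {q w : ℂ} (hq : GenericBase q)
    (hw : ∀ k : ℕ, 1 - w * q ^ k ≠ 0) (n l k : ℕ) :
    bigQUltraCoeff q w n l k =
      coeffCore q w (n + 1) l k * ((1 - q ^ (n + 1) * q ^ k) * (1 - w * q ^ n * q ^ k) /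
        (q ^ k * (1 - q ^ l * q ^ (n + 1) * q ^ k))) := by
  have h := hq.ne_zero
  have h5 := hq.one_sub_pow_ne (l + n + k)
  rw [bigQUltraCoeff, coeffCore, seriesFactor_order hq hw n k,
    show l + (n + 1) + k = l + n + k + 1 by ring, qShifted_succ,
    show (l : ℤ) + 1 - (n + 1 : ℕ) - k = (l : ℤ) - n - k by push_cast; ring]
  rw [show q ^ (l + n + k + 1) = q * q ^ l * q ^ n * q ^ k by ring] at h5
  rw [pow_succ' q n, pow_add, pow_add, mul_div_assoc, mul_pow]
  have e : 1 - q * (q ^ l * q ^ n * q ^ k) = 1 - q * q ^ l * q ^ n * q ^ k := by ring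
  have e' : 1 - q ^ l * (q * q ^ n) * q ^ k = 1 - q * q ^ l * q ^ n * q ^ k := by ring
  rw [e, e']
  generalize 1 - q * q ^ l * q ^ n * q ^ k = A at *
  field_simp

/-- The term ratio is rational in `q^k`, so a telescoping certificate reduces to an identity of
rational functions. -/
theorem coeffCore_succ {q w : ℂ} (hq : GenericBase q)
    (hw : ∀ k : ℕ, 1 - w * q ^ k ≠ 0) (n l k : ℕ) :
    coeffCore q w n l (k + 1) = coeffCore q w n l k *
      (-(q * q ^ k * (q ^ n / q ^ l)) * (1 - q * q ^ l / (q ^ n * q ^ k)) *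
        (1 - q * q ^ l * q ^ n * q ^ k) /
        ((1 - q * q ^ k) * (1 - q * q ^ n * q ^ k) * (1 - w * q ^ n * q ^ k))) := by
  rw [coeffCore, coeffCore, seriesFactor_succ hq hw, ← add_assoc, qShifted_succ,
    show (l : ℤ) + 1 - n - (k + 1 : ℕ) = (l : ℤ) - n - k by push_cast; ring, recip_degree hq]
  simp only [pow_add, pow_one]
  ring

theorem coeffCore_degree_succ {q : ℂ} (hq : GenericBase q) (w : ℂ) (n l k : ℕ) :
    coeffCore q w n l k * (1 - q * q ^ l * q ^ n * q ^ k) =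
      coeffCore q w n (l + 1) k * (q ^ k * (1 - q ^ 2 * q ^ l / (q ^ n * q ^ k))) := by
  have h := hq.ne_zero
  have e := bigQUltraCoeff_degree_succ hq w n l k
  rw [bigQUltraCoeff_eq_core hq] at e
  have : coeffCore q w n l k * (1 - q * q ^ l * q ^ n * q ^ k) =
      q ^ k * (coeffCore q w n l k * ((1 - q * q ^ l * q ^ n * q ^ k) / q ^ k)) := by field_simp
  rw [this, ← e]
  ring

/-- Creative telescoping: each relation between terminating series below is proved by exhibiting a
certificate `g`, a rational multiple of the summand. -/
theorem sum_range_eq_zero_of_telescope {N : ℕ} (E g : ℕ → ℂ) (h : ∀ k, E k = g (k + 1) - g k)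
    (h0 : g 0 = 0) (hN : g N = 0) : ∑ k ∈ Finset.range N, E k = 0 := by
  simp only [h, Finset.sum_range_sub, h0, hN, sub_zero]

/-! ### Contiguous relations and the recurrence in the degree -/

/-- The two factors linear in `u` on the left are the contribution of one variable to the
subdiagonal Laguerre coefficient, see `laguerreSub_mul_eq`. -/
theorem bigQUltra_raise {q w : ℂ} (hq : GenericBase q) (hw : ∀ k : ℕ, 1 - w * q ^ k ≠ 0)
    (n l : ℕ) (u : ℂ) :
    q * w * (q ^ n) ^ 3 * (1 + q * q ^ l) * ((1 - q * q ^ n * u) * (1 - w * q ^ n * u)) *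
        bigQUltra q w (n + 1) l u =
      q ^ n * (1 - q * q ^ l * q ^ n) * (q ^ l * (q + w) - w * q ^ n * (1 + q * q ^ l) * u) *
        bigQUltra q w n l u +
      (q ^ n - q * q ^ l) * (1 - w * q ^ l) * bigQUltra q w n (l + 1) u := by
  have ha : q ^ l ≠ 0 := pow_ne_zero _ hq.ne_zero
  have hb : q ^ n ≠ 0 := pow_ne_zero _ hq.ne_zero
  rw [bigQUltra_eq_sum q w (n + 1) (N := l + 2) (by omega),
    bigQUltra_eq_sum q w n (l := l) (N := l + 2) (by omega),
    bigQUltra_eq_sum q w n (N := l + 2) le_rfl, ← sub_eq_zero]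
  simp only [Finset.mul_sum, ← Finset.sum_add_distrib, ← Finset.sum_sub_distrib]
  -- The certificate. The common length `l + 2` accommodates degree `l + 1`, and `coeffCore`
  -- vanishes at `k = l + 2`; at `k = 0` the bracket itself is zero.
  refine sum_range_eq_zero_of_telescope _ (fun k => qShifted (w * u * q ^ n) q k *
    coeffCore q w n l k * (q ^ n * ((1 - q * q ^ l * q ^ n) *
      ((1 - q * q ^ l / (q ^ n * q ^ k)) * (q ^ l * (q + w) - (1 + q * q ^ l) / q ^ k))) +
      (q ^ n - q * q ^ l) * (1 - w * q ^ l) * (1 - q * q ^ l * q ^ n * q ^ k) / q ^ k -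
      q ^ n * (q * q ^ l * q ^ n * (1 + q * q ^ l) * (1 - q ^ k) *
        (1 - q * q ^ l / (q ^ n * q ^ k)) * (1 - w * u * q ^ n * q ^ k) / q ^ k))) ?_ ?_ ?_
  · intro k
    have hK : q ^ k ≠ 0 := pow_ne_zero _ hq.ne_zero
    have h4 := hq.one_sub_pow_ne k
    have h5 := hq.one_sub_pow_ne (n + k)
    have h6 := hw (n + k)
    rw [pow_succ'] at h4 h5
    rw [pow_add, ← mul_assoc] at h5 h6
    -- The factor `1 - w q^n u` brings the basis of order `n + 1` back to that of order `n`.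
    have e : (1 - w * q ^ n * u) * qShifted (w * u * q ^ (n + 1)) q k =
        qShifted (w * u * q ^ n) q k * (1 - w * u * q ^ n * q ^ k) := by
      rw [← qShifted_succ, qShifted_succ']
      ring_nf
    rw [show ∀ x y z c t : ℂ, x * (y * z) * (c * t) = x * y * c * (z * t) by intros; ring, e,
      bigQUltraCoeff_order_succ hq hw, bigQUltraCoeff_eq_core hq, bigQUltraCoeff_degree_succ hq,
      coeffCore_succ hq hw, qShifted_succ, pow_succ' q k]
    generalize coeffCore q w n l k = r
    generalize qShifted (w * u * q ^ n) q k = f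
    generalize q ^ k = K at *
    generalize q ^ n = b at *
    generalize q ^ l = a at *
    have hq0 := hq.ne_zero
    -- The denominators are made atoms while fractions are cleared and are expanded only for the
    -- final polynomial identity; the same device recurs below.
    obtain ⟨A, hA⟩ : ∃ A, A = 1 - q * K := ⟨_, rfl⟩
    obtain ⟨B, hB⟩ : ∃ B, B = 1 - q * b * K := ⟨_, rfl⟩
    obtain ⟨C, hC⟩ : ∃ C, C = 1 - w * b * K := ⟨_, rfl⟩
    rw [← hA] at h4 ⊢
    rw [← hB] at h5 ⊢
    rw [← hC] at h6 ⊢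
    field_simp
    rw [hA, hB, hC]
    ring
  · simp [coeffCore]
    field_simp
    ring_nf
    simp
  · rw [coeffCore_of_lt q w (by omega)]
    ring

/-- Since `w (u/q) q^(n+1) = w u q^n`, both orders are expanded in the same basis. This is the twin
of `bigQUltra_raise` for the terms `L (m - n)`; its prefactor is matched in `laguerreSub_eq`. -/
theorem bigQUltra_raise_shift {q w : ℂ} (hq : GenericBase q) (hw : ∀ k : ℕ, 1 - w * q ^ k ≠ 0)
    (n l : ℕ) (u : ℂ) :
    q * w * (q ^ n) ^ 3 * (1 + q * q ^ l) * ((1 - u) * (1 - w * u / q)) *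
        bigQUltra q w (n + 1) l (u / q) =
      q ^ n * (1 - q * q ^ l * q ^ n) * (q ^ l * (q + w) - w * q ^ l * (1 + q * q ^ l) * u) *
        bigQUltra q w n l u +
      (q ^ n - q * q ^ l) * (1 - w * q ^ l) * bigQUltra q w n (l + 1) u := by
  have hq0 := hq.ne_zero
  have ha : q ^ l ≠ 0 := pow_ne_zero _ hq.ne_zero
  have hb : q ^ n ≠ 0 := pow_ne_zero _ hq.ne_zero
  rw [bigQUltra_eq_sum q w (n + 1) (N := l + 2) (by omega),
    bigQUltra_eq_sum q w n (l := l) (N := l + 2) (by omega),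
    bigQUltra_eq_sum q w n (N := l + 2) le_rfl, ← sub_eq_zero]
  simp only [Finset.mul_sum, ← Finset.sum_add_distrib, ← Finset.sum_sub_distrib]
  refine sum_range_eq_zero_of_telescope _ (fun k => qShifted (w * u * q ^ n) q k *
    coeffCore q w n l k * (q ^ n * ((1 - q * q ^ l * q ^ n) *
      ((1 - q * q ^ l / (q ^ n * q ^ k)) *
        (q ^ l * (q + w) - q ^ l * (1 + q * q ^ l) / (q ^ n * q ^ k)))) +
      (q ^ n - q * q ^ l) * (1 - w * q ^ l) * (1 - q * q ^ l * q ^ n * q ^ k) / q ^ k -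
      q ^ n * (1 + q * q ^ l) * (1 - q * q ^ l / (q ^ n * q ^ k)) * (1 - q ^ l / (q ^ n * q ^ k)) *
        (1 - q * q ^ l * q ^ n * q ^ k) / q ^ k -
      q ^ l * (1 + q * q ^ l) * (1 - q ^ k) *
        (1 - q * q ^ l / (q ^ n * q ^ k)) * (1 - w * u * q ^ n * q ^ k) / (q ^ k) ^ 2)) ?_ ?_ ?_
  · intro k
    have hK : q ^ k ≠ 0 := pow_ne_zero _ hq.ne_zero
    have h4 := hq.one_sub_pow_ne k
    have h5 := hq.one_sub_pow_ne (n + k)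
    have h6 := hw (n + k)
    rw [pow_succ'] at h4 h5
    rw [pow_add, ← mul_assoc] at h5 h6
    have e : w * (u / q) * q ^ (n + 1) = w * u * q ^ n := by field_simp; ring
    rw [e, bigQUltraCoeff_order_succ hq hw, bigQUltraCoeff_eq_core hq,
      bigQUltraCoeff_degree_succ hq, coeffCore_succ hq hw, qShifted_succ, pow_succ' q k]
    clear e
    generalize coeffCore q w n l k = r
    generalize qShifted (w * u * q ^ n) q k = f
    generalize q ^ k = K at *
    generalize q ^ n = b at *
    generalize q ^ l = a at *
    obtain ⟨A, hA⟩ : ∃ A, A = 1 - q * K := ⟨_, rfl⟩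
    obtain ⟨B, hB⟩ : ∃ B, B = 1 - q * b * K := ⟨_, rfl⟩
    obtain ⟨C, hC⟩ : ∃ C, C = 1 - w * b * K := ⟨_, rfl⟩
    rw [← hA] at h4 ⊢
    rw [← hB] at h5 ⊢
    rw [← hC] at h6 ⊢
    field_simp
    rw [hA, hB, hC]
    ring
  · have : (q ^ n * ((1 - q * q ^ l * q ^ n) *
      ((1 - q * q ^ l / (q ^ n * q ^ 0)) *
        (q ^ l * (q + w) - q ^ l * (1 + q * q ^ l) / (q ^ n * q ^ 0)))) +
      (q ^ n - q * q ^ l) * (1 - w * q ^ l) * (1 - q * q ^ l * q ^ n * q ^ 0) / q ^ 0 -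
      q ^ n * (1 + q * q ^ l) * (1 - q * q ^ l / (q ^ n * q ^ 0)) * (1 - q ^ l / (q ^ n * q ^ 0)) *
        (1 - q * q ^ l * q ^ n * q ^ 0) / q ^ 0 -
      q ^ l * (1 + q * q ^ l) * (1 - q ^ 0) *
        (1 - q * q ^ l / (q ^ n * q ^ 0)) * (1 - w * u * q ^ n * q ^ 0) / (q ^ 0) ^ 2) = 0 := by
      rw [pow_zero]
      generalize q ^ n = b at *
      generalize q ^ l = a at *
      field_simp
      ring
    rw [this, mul_zero]
  · rw [coeffCore_of_lt q w (by omega)]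
    ring

/-- The bases of orders `n` and `n + 1` differ by a factor that is cancelled at the end, which is
where `hu` enters. -/
theorem bigQUltra_lower {q w : ℂ} (hq : GenericBase q) (hw : ∀ k : ℕ, 1 - w * q ^ k ≠ 0)
    (n l : ℕ) (u : ℂ) (hu : 1 - w * u * q ^ n ≠ 0) :
    q * q ^ l * (1 - q ^ l * q ^ (n + 1)) * (1 + q * q ^ l) * bigQUltra q w n l u =
      q ^ l * (q ^ (n + 1)) ^ 2 * ((q + w) - w * q ^ (n + 1) * (1 + q * q ^ l) * u) *
        bigQUltra q w (n + 1) l u +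
      q ^ (n + 1) * (1 - w * q ^ l) * bigQUltra q w (n + 1) (l + 1) u := by
  have hq0 := hq.ne_zero
  have ha : q ^ l ≠ 0 := pow_ne_zero _ hq.ne_zero
  have hb : q ^ n ≠ 0 := pow_ne_zero _ hq.ne_zero
  rw [bigQUltra_eq_sum q w n (N := l + 2) (by omega),
    bigQUltra_eq_sum q w (n + 1) (l := l) (N := l + 2) (by omega),
    bigQUltra_eq_sum q w (n + 1) (N := l + 2) le_rfl, ← sub_eq_zero]
  -- Multiplying by `1 - w u q^n` moves every sum into the basis `(w u q^n; q)_k`.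
  refine (mul_eq_zero.1 (?_ : (1 - w * u * q ^ n) * _ = 0)).resolve_left hu
  simp only [Finset.mul_sum, ← Finset.sum_add_distrib, ← Finset.sum_sub_distrib]
  refine sum_range_eq_zero_of_telescope _ (fun k => qShifted (w * u * q ^ n) q k *
    coeffCore q w (n + 1) l k * ((1 - q ^ k) * (1 - q ^ (n + 1) * q ^ k) * (1 - w * q ^ n * q ^ k) *
      (q * q ^ l * (1 + q * q ^ l) * (1 - w * u * q ^ l * q ^ n * q ^ (n + 1) * q ^ k)) /
        ((q ^ k) ^ 2 * (1 - q ^ l * q ^ (n + 1) * q ^ k)))) ?_ ?_ ?_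
  · intro k
    have hK : q ^ k ≠ 0 := pow_ne_zero _ hq.ne_zero
    have h4 := hq.one_sub_pow_ne k
    have h5 := hq.one_sub_pow_ne (n + 1 + k)
    have h6 := hw (n + 1 + k)
    have h7 := hq.one_sub_pow_ne (l + n + k)
    have h8 := hq.one_sub_pow_ne (l + (n + 1) + k)
    rw [pow_succ'] at h4 h5
    rw [show q * q ^ (n + 1 + k) = q * (q * q ^ n) * q ^ k by ring] at h5
    rw [show w * q ^ (n + 1 + k) = w * (q * q ^ n) * q ^ k by ring] at h6
    rw [show q ^ (l + n + k + 1) = q ^ l * (q * q ^ n) * q ^ k by ring] at h7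
    rw [show q ^ (l + (n + 1) + k + 1) = q ^ l * (q * q ^ n) * (q * q ^ k) by ring] at h8
    have e : (1 - w * u * q ^ n) * qShifted (w * u * q ^ (n + 1)) q k =
        qShifted (w * u * q ^ n) q k * (1 - w * u * q ^ n * q ^ k) := by
      rw [← qShifted_succ, qShifted_succ']
      ring_nf
    rw [show ∀ x m c p α d s β j : ℂ, x * (m * (c * p) - (α * (d * s) + β * (j * s))) =
      x * m * c * p - (α * d + β * j) * (x * s) by intros; ring, e,
      bigQUltraCoeff_order_pred hq hw, bigQUltraCoeff_eq_core hq, bigQUltraCoeff_degree_succ hq,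
      coeffCore_succ hq hw, qShifted_succ, pow_succ' q k, pow_succ' q n]
    clear e
    generalize coeffCore q w (n + 1) l k = r
    generalize qShifted (w * u * q ^ n) q k = f
    generalize q ^ k = K at *
    generalize q ^ n = b at *
    generalize q ^ l = a at *
    obtain ⟨A, hA⟩ : ∃ A, A = 1 - q * K := ⟨_, rfl⟩
    obtain ⟨B, hB⟩ : ∃ B, B = 1 - q * (q * b) * K := ⟨_, rfl⟩
    obtain ⟨C, hC⟩ : ∃ C, C = 1 - w * (q * b) * K := ⟨_, rfl⟩
    obtain ⟨D, hD⟩ : ∃ D, D = 1 - a * (q * b) * K := ⟨_, rfl⟩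
    obtain ⟨G, hG⟩ : ∃ G, G = 1 - a * (q * b) * (q * K) := ⟨_, rfl⟩
    rw [← hA] at h4 ⊢
    rw [← hB] at h5 ⊢
    rw [← hC] at h6 ⊢
    rw [← hD] at h7 ⊢
    rw [← hG] at h8 ⊢
    field_simp
    simp only [hB, hC, hD, hG]
    ring
  · simp
  · rw [coeffCore_of_lt q w (by omega)]
    ring

/-- Here `w (u q) q^n = w u q^(n+1)`, so the bases agree and no condition on `u` is needed. -/
theorem bigQUltra_lower_shift {q w : ℂ} (hq : GenericBase q) (hw : ∀ k : ℕ, 1 - w * q ^ k ≠ 0)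
    (n l : ℕ) (u : ℂ) :
    q * q ^ l * (1 - q ^ l * q ^ (n + 1)) * (1 + q * q ^ l) * bigQUltra q w n l (u * q) =
      (q ^ (n + 1)) ^ 2 * (q ^ l * (q + w) - w * (1 + q * q ^ l) * u) *
        bigQUltra q w (n + 1) l u +
      q ^ (n + 1) * (1 - w * q ^ l) * bigQUltra q w (n + 1) (l + 1) u := by
  have hq0 := hq.ne_zero
  have ha : q ^ l ≠ 0 := pow_ne_zero _ hq.ne_zero
  have hb : q ^ n ≠ 0 := pow_ne_zero _ hq.ne_zero
  rw [bigQUltra_eq_sum q w n (N := l + 2) (by omega),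
    bigQUltra_eq_sum q w (n + 1) (l := l) (N := l + 2) (by omega),
    bigQUltra_eq_sum q w (n + 1) (N := l + 2) le_rfl, ← sub_eq_zero]
  simp only [Finset.mul_sum, ← Finset.sum_add_distrib, ← Finset.sum_sub_distrib]
  refine sum_range_eq_zero_of_telescope _ (fun k => qShifted (w * u * q ^ (n + 1)) q k *
    coeffCore q w (n + 1) l k * ((1 - q ^ k) * (1 - q ^ (n + 1) * q ^ k) * (1 - w * q ^ n * q ^ k) *
      (q * q ^ l * (1 + q * q ^ l)) /
        ((q ^ k) ^ 2 * (1 - q ^ l * q ^ (n + 1) * q ^ k)))) ?_ ?_ ?_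
  · intro k
    have hK : q ^ k ≠ 0 := pow_ne_zero _ hq.ne_zero
    have h4 := hq.one_sub_pow_ne k
    have h5 := hq.one_sub_pow_ne (n + 1 + k)
    have h6 := hw (n + 1 + k)
    have h7 := hq.one_sub_pow_ne (l + n + k)
    have h8 := hq.one_sub_pow_ne (l + (n + 1) + k)
    rw [pow_succ'] at h4 h5
    rw [show q * q ^ (n + 1 + k) = q * (q * q ^ n) * q ^ k by ring] at h5
    rw [show w * q ^ (n + 1 + k) = w * (q * q ^ n) * q ^ k by ring] at h6
    rw [show q ^ (l + n + k + 1) = q ^ l * (q * q ^ n) * q ^ k by ring] at h7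
    rw [show q ^ (l + (n + 1) + k + 1) = q ^ l * (q * q ^ n) * (q * q ^ k) by ring] at h8
    have e : w * (u * q) * q ^ n = w * u * q ^ (n + 1) := by ring
    rw [e, bigQUltraCoeff_order_pred hq hw, bigQUltraCoeff_eq_core hq,
      bigQUltraCoeff_degree_succ hq,
      coeffCore_succ hq hw, qShifted_succ, pow_succ' q k]
    clear e
    generalize coeffCore q w (n + 1) l k = r
    generalize qShifted (w * u * q ^ (n + 1)) q k = f
    rw [pow_succ' q n]
    generalize q ^ k = K at *
    generalize q ^ n = b at *
    generalize q ^ l = a at *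
    obtain ⟨A, hA⟩ : ∃ A, A = 1 - q * K := ⟨_, rfl⟩
    obtain ⟨B, hB⟩ : ∃ B, B = 1 - q * (q * b) * K := ⟨_, rfl⟩
    obtain ⟨C, hC⟩ : ∃ C, C = 1 - w * (q * b) * K := ⟨_, rfl⟩
    obtain ⟨D, hD⟩ : ∃ D, D = 1 - a * (q * b) * K := ⟨_, rfl⟩
    obtain ⟨G, hG⟩ : ∃ G, G = 1 - a * (q * b) * (q * K) := ⟨_, rfl⟩
    rw [← hA] at h4 ⊢
    rw [← hB] at h5 ⊢
    rw [← hC] at h6 ⊢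
    rw [← hD] at h7 ⊢
    rw [← hG] at h8 ⊢
    field_simp
    simp only [hB, hC, hD, hG]
    ring
  · simp
  · rw [coeffCore_of_lt q w (by omega)]
    ring

theorem bigQUltra_recurrence {q w : ℂ} (hq : GenericBase q) (hw : ∀ k : ℕ, 1 - w * q ^ k ≠ 0)
    (n l : ℕ) (u : ℂ) :
    (1 + q * q ^ l) * (q ^ n - q ^ 2 * q ^ l) * (1 - q * w * q ^ l) * bigQUltra q w n (l + 2) u =
      q ^ n * (1 - q ^ 3 * (q ^ l) ^ 2) * (-(q * q ^ l * (1 + q ^ n) * (q + w)) +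
        w * q ^ n * (1 + q ^ 2 * q ^ l) * (1 + q * q ^ l) * u) * bigQUltra q w n (l + 1) u -
      q * q ^ l * (q ^ n) ^ 2 * (1 - q * q ^ l * q ^ n) * (q ^ 2 * q ^ l - w) *
        (1 + q ^ 2 * q ^ l) * bigQUltra q w n l u := by
  have hq0 := hq.ne_zero
  have ha : q ^ l ≠ 0 := pow_ne_zero _ hq.ne_zero
  have hb : q ^ n ≠ 0 := pow_ne_zero _ hq.ne_zero
  rw [bigQUltra_eq_sum q w n (N := l + 3) le_rfl,
    bigQUltra_eq_sum q w n (l := l + 1) (N := l + 3) (by omega),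
    bigQUltra_eq_sum q w n (l := l) (N := l + 3) (by omega), ← sub_eq_zero]
  simp only [Finset.mul_sum, ← Finset.sum_sub_distrib]
  refine sum_range_eq_zero_of_telescope _ (fun k => -(qShifted (w * u * q ^ n) q k *
    coeffCore q w n (l + 1) k * ((1 - q ^ 3 * (q ^ l) ^ 2) * (1 + q ^ 2 * q ^ l) *
      (1 + q * q ^ l) * q * q ^ l * (1 - q ^ k) * (1 - q ^ n * q ^ k) * (q - w * q ^ n * q ^ k)) /
        ((q ^ k) ^ 2 * (1 - q * q ^ l * q ^ n * q ^ k)))) ?_ ?_ ?_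
  · intro k
    have hK : q ^ k ≠ 0 := pow_ne_zero _ hq.ne_zero
    have h4 := hq.one_sub_pow_ne k
    have h5 := hq.one_sub_pow_ne (n + k)
    have h6 := hw (n + k)
    have h7 := hq.one_sub_pow_ne (l + n + k)
    have h8 := hq.one_sub_pow_ne (l + (n + 1) + k)
    rw [pow_succ'] at h4 h5
    rw [pow_add, ← mul_assoc] at h5 h6
    rw [show q ^ (l + n + k + 1) = q * q ^ l * q ^ n * q ^ k by ring] at h7
    rw [show q ^ (l + (n + 1) + k + 1) = q * (q * q ^ l) * q ^ n * q ^ k by ring] at h8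
    have e := coeffCore_degree_succ hq w n l k
    rw [← eq_div_iff h7] at e
    rw [bigQUltraCoeff_degree_succ hq, bigQUltraCoeff_eq_core hq, bigQUltraCoeff_eq_core hq, e,
      coeffCore_succ hq hw, qShifted_succ, pow_succ' q k, pow_succ' q l]
    clear e
    generalize coeffCore q w n (l + 1) k = r
    generalize qShifted (w * u * q ^ n) q k = f
    generalize q ^ k = K at *
    generalize q ^ n = b at *
    generalize q ^ l = a at *
    rw [show 1 - q * a * b * (q * K) = 1 - q * (q * a) * b * K by ring]
    obtain ⟨A, hA⟩ : ∃ A, A = 1 - q * K := ⟨_, rfl⟩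
    obtain ⟨B, hB⟩ : ∃ B, B = 1 - q * b * K := ⟨_, rfl⟩
    obtain ⟨C, hC⟩ : ∃ C, C = 1 - w * b * K := ⟨_, rfl⟩
    obtain ⟨D, hD⟩ : ∃ D, D = 1 - q * a * b * K := ⟨_, rfl⟩
    obtain ⟨G, hG⟩ : ∃ G, G = 1 - q * (q * a) * b * K := ⟨_, rfl⟩
    rw [← hA] at h4 ⊢
    rw [← hB] at h5 ⊢
    rw [← hC] at h6 ⊢
    rw [← hD] at h7 ⊢
    rw [← hG] at h8 ⊢
    field_simp
    simp only [hB, hC, hD, hG]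
    ring
  · simp
  · rw [coeffCore_of_lt q w (by omega)]
    ring

/-! ### The q-Legendre series -/

/-- The terminating series of the Askey-Wilson polynomials with `ab = q` and `abcd = q^2`, in terms
of `y = ac`, `z = ad` and of the basis `ψ k = (a e^{iθ}, a e^{-iθ}; q)_k`. -/
def legendreSeries (q y z : ℂ) (ψ : ℕ → ℂ) (l : ℕ) : ℂ :=
  ∑ k ∈ Finset.range (l + 1), bigQUltraCoeff q y 0 l k / qShifted z q k * ψ k

theorem legendreSeries_eq_sum (q y z : ℂ) (ψ : ℕ → ℂ) {l N : ℕ} (h : l + 1 ≤ N) :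
    legendreSeries q y z ψ l =
      ∑ k ∈ Finset.range N, bigQUltraCoeff q y 0 l k / qShifted z q k * ψ k := by
  refine Finset.sum_subset (Finset.range_mono h) fun k _ hk => ?_
  rw [bigQUltraCoeff_of_lt, zero_div, zero_mul]
  simp at hk
  omega

/-- The Askey-Wilson recurrence in differences of neighbouring degrees: at `X = A + A⁻¹` all `ψ k`
with `k ≥ 1` vanish, the series are equal, and both sides are zero. The coefficients are those of
order zero big `q`-ultraspherical polynomials divided by `(z; q)_k`, so `coeffCore` can be reused.
-/
theorem legendreSeries_recurrence {q y z A X : ℂ} (hq : GenericBase q)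
    (hy : ∀ k : ℕ, 1 - y * q ^ k ≠ 0) (hz : ∀ k : ℕ, 1 - z * q ^ k ≠ 0) (hA : A ≠ 0)
    (hyz : y * z = q * A ^ 2) {ψ : ℕ → ℂ}
    (hψ : ∀ k, ψ (k + 1) = ψ k * (1 - X * (A * q ^ k) + (A * q ^ k) ^ 2)) (l : ℕ) :
    (X - A - A⁻¹) * legendreSeries q y z ψ (l + 1) =
      (1 - q ^ 2 * q ^ l) * (1 - y * (q * q ^ l)) * (1 - z * (q * q ^ l)) /
          (A * (1 - q ^ 3 * (q ^ l) ^ 2) * (1 + q ^ 2 * q ^ l)) *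
        (legendreSeries q y z ψ (l + 2) - legendreSeries q y z ψ (l + 1)) +
      A * (1 - q * q ^ l) * (1 - q ^ 2 * q ^ l / z) * (1 - q ^ 2 * q ^ l / y) /
          ((1 + q * q ^ l) * (1 - q ^ 3 * (q ^ l) ^ 2)) *
        (legendreSeries q y z ψ l - legendreSeries q y z ψ (l + 1)) := by
  have hq0 := hq.ne_zero
  have hy0 : y ≠ 0 := by
    rintro rfl
    rw [zero_mul] at hyz
    exact mul_ne_zero hq0 (pow_ne_zero 2 hA) hyz.symm
  -- Eliminating `z` leaves independent variables, so that `ring` can decide the certificate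
  -- identity.
  obtain rfl : z = q * A ^ 2 / y := by rw [eq_div_iff hy0, ← hyz]; ring
  have ha : q ^ l ≠ 0 := pow_ne_zero _ hq.ne_zero
  have h1 := hq.one_sub_pow_ne (2 * l + 2)
  have h2 := hq.one_add_pow_ne (l + 1)
  have h3 := hq.one_add_pow_ne l
  rw [show q ^ (2 * l + 2 + 1) = q ^ 3 * (q ^ l) ^ 2 by ring] at h1
  rw [show q ^ (l + 1 + 1) = q ^ 2 * q ^ l by ring] at h2
  rw [pow_succ'] at h3
  rw [legendreSeries_eq_sum _ _ _ _ (l := l + 2) (N := l + 3) le_rfl,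
    legendreSeries_eq_sum _ _ _ _ (l := l + 1) (N := l + 3) (by omega),
    legendreSeries_eq_sum _ _ _ _ (l := l) (N := l + 3) (by omega), ← sub_eq_zero]
  simp only [Finset.mul_sum, ← Finset.sum_sub_distrib, ← Finset.sum_add_distrib]
  refine sum_range_eq_zero_of_telescope _ (fun k => q ^ l * (1 - q ^ k) ^ 2 * (q - y * q ^ k) *
    (q - q * A ^ 2 / y * q ^ k) / (A * (q ^ k) ^ 2 * (1 - q * q ^ l * q ^ k)) *
    coeffCore q y 0 (l + 1) k / qShifted (q * A ^ 2 / y) q k * ψ k) ?_ ?_ ?_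
  · intro k
    have hK : q ^ k ≠ 0 := pow_ne_zero _ hq.ne_zero
    have h4 := hq.one_sub_pow_ne k
    have h6 := hy k
    have h7 := hq.one_sub_pow_ne (l + k)
    have h8 := hq.one_sub_pow_ne (l + 1 + k)
    have h9 := hz k
    have h10 := qShifted_ne_zero hz k
    rw [pow_succ'] at h4
    rw [show q ^ (l + k + 1) = q * q ^ l * q ^ k by ring] at h7
    rw [show q ^ (l + 1 + k + 1) = q * (q * q ^ l) * q ^ k by ring] at h8
    have e := coeffCore_degree_succ hq y 0 l k
    have h7' : 1 - q * q ^ l * q ^ 0 * q ^ k ≠ 0 := by rwa [pow_zero, mul_one]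
    rw [← eq_div_iff h7'] at e
    rw [bigQUltraCoeff_degree_succ hq _ _ (l + 1), bigQUltraCoeff_eq_core hq _ _ (l + 1),
      bigQUltraCoeff_eq_core hq _ _ l, e,
      coeffCore_succ hq hy, hψ, qShifted_succ, pow_succ' q k, pow_succ' q l]
    simp only [pow_zero, mul_one, one_mul]
    clear e h7' hψ
    generalize coeffCore q y 0 (l + 1) k = r
    generalize ψ k = f
    generalize qShifted _ q k = s at *
    clear hyz hz
    generalize q ^ k = K at *
    generalize q ^ l = a at *
    rw [show 1 - q * a * (q * K) = 1 - q * (q * a) * K by ring]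
    obtain ⟨A₁, hA₁⟩ : ∃ A, A = 1 - q * K := ⟨_, rfl⟩
    obtain ⟨C, hC⟩ : ∃ C, C = 1 - y * K := ⟨_, rfl⟩
    obtain ⟨D, hD⟩ : ∃ D, D = 1 - q * a * K := ⟨_, rfl⟩
    obtain ⟨G, hG⟩ : ∃ G, G = 1 - q * (q * a) * K := ⟨_, rfl⟩
    obtain ⟨B, hB⟩ : ∃ C, C = 1 - q * A ^ 2 / y * K := ⟨_, rfl⟩
    obtain ⟨M, hM⟩ : ∃ C, C = 1 - q ^ 3 * a ^ 2 := ⟨_, rfl⟩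
    obtain ⟨N, hN⟩ : ∃ C, C = 1 + q ^ 2 * a := ⟨_, rfl⟩
    obtain ⟨P, hP⟩ : ∃ C, C = 1 + q * a := ⟨_, rfl⟩
    rw [← hA₁] at h4 ⊢
    rw [← hB] at h9 ⊢
    rw [← hC] at h6 ⊢
    rw [← hD] at h7 ⊢
    rw [← hG] at h8 ⊢
    rw [← hM] at h1 ⊢
    rw [← hN] at h2 ⊢
    rw [← hP] at h3 ⊢
    have hB' : y * B = y - q * A ^ 2 * K := by rw [hB]; field_simp
    obtain rfl : B = (y - q * A ^ 2 * K) / y := by rw [eq_div_iff hy0, mul_comm, hB']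
    have h9' : y - q * A ^ 2 * K ≠ 0 := fun h => h9 (by rw [h, zero_div])
    clear hB hB' h9
    obtain ⟨B, hB⟩ : ∃ C, C = y - q * A ^ 2 * K := ⟨_, rfl⟩
    rw [← hB] at h9' ⊢
    field_simp
    simp only [hB, hC, hD, hG, hM, hN, hP]
    ring
  · simp
  · rw [coeffCore_of_lt q y (by omega)]
    ring

theorem legendreSeries_zero {q : ℂ} (y z : ℂ) {ψ : ℕ → ℂ} (h0 : ψ 0 = 1) :
    legendreSeries q y z ψ 0 = 1 := by
  simp [legendreSeries, bigQUltraCoeff, seriesFactor, qShifted_zero, h0, recipQFactorial]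

theorem legendreSeries_one {q y z : ℂ} (hq : GenericBase q) {ψ : ℕ → ℂ} (h0 : ψ 0 = 1) :
    legendreSeries q y z ψ 1 = 1 - (1 + q) / ((1 - y) * (1 - z)) * ψ 1 := by
  have h1 : 1 - q ≠ 0 := by simpa using hq.one_sub_pow_ne 0
  have hq0 := hq.ne_zero
  simp [legendreSeries, bigQUltraCoeff, seriesFactor, qShifted, h0, recipQFactorial,
    Finset.sum_range_succ, Finset.prod_range_succ]
  rw [inv_mul_cancel₀ h1, div_eq_mul_inv _ (1 - z)]
  have : (1 - q * q) = (1 - q) * (1 + q) := by ring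
  rw [this]
  field_simp
  ring

/-! ### The q-Laguerre series -/

/-- The coefficient of `ψ k` in `laguerreSeries q y z ψ m`. -/
def laguerreCoeff (q y z : ℂ) (m k : ℕ) : ℂ :=
  (-1) ^ k * q ^ ((k + 1).choose 2) / (qShifted q q k * qShifted y q k * qShifted z q k) *
    (1 / q ^ m) ^ k * recipQFactorial q ((m : ℤ) - k)

/-- The terminating series of the Askey-Wilson polynomials with `d = 0`, divided by `(q; q)_m`, in
terms of `y = ab`, `z = ac` and of the basis `ψ k = (a e^{iθ}, a e^{-iθ}; q)_k`. -/
def laguerreSeries (q y z : ℂ) (ψ : ℕ → ℂ) (m : ℕ) : ℂ :=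
  ∑ k ∈ Finset.range (m + 1), laguerreCoeff q y z m k * ψ k

theorem laguerreCoeff_of_lt (q y z : ℂ) {m k : ℕ} (h : m < k) : laguerreCoeff q y z m k = 0 := by
  rw [laguerreCoeff, recipQFactorial_of_neg q (by omega), mul_zero]

theorem laguerreSeries_eq_sum (q y z : ℂ) (ψ : ℕ → ℂ) {m N : ℕ} (h : m + 1 ≤ N) :
    laguerreSeries q y z ψ m =
      ∑ k ∈ Finset.range N, laguerreCoeff q y z m k * ψ k := by
  refine Finset.sum_subset (Finset.range_mono h) fun k _ hk => ?_
  rw [laguerreCoeff_of_lt, zero_mul]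
  simp at hk
  omega

/-- The terms of degree `m + 2`, up to the factor `q ^ k`. -/
def laguerreCore (q y z : ℂ) (m k : ℕ) : ℂ :=
  (-1) ^ k * q ^ ((k + 1).choose 2) / (qShifted q q k * qShifted y q k * qShifted z q k) *
    (1 / q ^ (m + 1)) ^ k * recipQFactorial q ((m : ℤ) + 2 - k)

theorem recip_degree_zero {q : ℂ} (hq : GenericBase q) (m k : ℕ) :
    recipQFactorial q ((m : ℤ) - k) =
      (1 - q * q ^ m / q ^ k) * recipQFactorial q ((m : ℤ) + 1 - k) := by
  simpa using recip_degree hq m 0 k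

theorem laguerreCoeff_eq_core {q : ℂ} (hq : GenericBase q) (y z : ℂ) (m k : ℕ) :
    laguerreCoeff q y z m k = laguerreCore q y z m k *
      (q ^ k * (1 - q ^ 2 * q ^ m / q ^ k) * (1 - q * q ^ m / q ^ k)) := by
  have h := recip_degree_zero hq (m + 1) k
  have hq0 := hq.ne_zero
  rw [pow_succ'] at h
  push_cast at h
  rw [laguerreCoeff, laguerreCore, recip_degree_zero hq, h, add_assoc, one_add_one_eq_two,
    pow_succ' q m, show ∀ x : ℂ, 1 / (q * x) = 1 / x / q by intro x; ring, div_pow _ q]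
  field_simp

theorem laguerreCoeff_one_eq_core {q : ℂ} (hq : GenericBase q) (y z : ℂ) (m k : ℕ) :
    laguerreCoeff q y z (m + 1) k = laguerreCore q y z m k * (1 - q ^ 2 * q ^ m / q ^ k) := by
  have h := recip_degree_zero hq (m + 1) k
  push_cast at h
  rw [laguerreCoeff, laguerreCore]
  push_cast
  rw [h, add_assoc, one_add_one_eq_two]
  ring

theorem laguerreCoeff_two_eq_core {q : ℂ} (hq : GenericBase q) (y z : ℂ) (m k : ℕ) :
    laguerreCoeff q y z (m + 2) k = laguerreCore q y z m k / q ^ k := by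
  have hq0 := hq.ne_zero
  rw [laguerreCoeff, laguerreCore]
  push_cast
  rw [pow_succ' q (m + 1), show ∀ x : ℂ, 1 / (q * x) = 1 / x / q by intro x; ring, div_pow _ q]
  field_simp

theorem laguerreCore_succ {q y z : ℂ} (hq : GenericBase q)
    (hy : ∀ k : ℕ, 1 - y * q ^ k ≠ 0) (hz : ∀ k : ℕ, 1 - z * q ^ k ≠ 0) (m k : ℕ) :
    laguerreCore q y z m (k + 1) = laguerreCore q y z m k *
      (-(q ^ k / q ^ m) * (1 - q ^ 2 * q ^ m / q ^ k) /
        ((1 - q * q ^ k) * (1 - y * q ^ k) * (1 - z * q ^ k))) := by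
  have hq0 := hq.ne_zero
  have h1 := hq.qShifted_ne k
  have h2 := qShifted_ne_zero hy k
  have h3 := qShifted_ne_zero hz k
  have h4 := hq.one_sub_pow_ne k
  have h5 := hy k
  have h6 := hz k
  rw [pow_succ'] at h4
  have e : (k + 1 + 1).choose 2 = (k + 1).choose 2 + (k + 1) := by
    rw [Nat.choose_succ_succ' (k + 1) 1]; simp; ring
  have h := recip_degree_zero hq (m + 1) k
  push_cast at h
  rw [laguerreCore, laguerreCore, e, qShifted_succ, qShifted_succ, qShifted_succ,
    show (m : ℤ) + 2 - (k + 1 : ℕ) = m + 1 - k by push_cast; ring, h, add_assoc (m : ℤ),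
    one_add_one_eq_two, pow_succ (1 / q ^ (m + 1)), pow_add q, pow_succ' q k, pow_succ' q m,
    pow_succ (-1 : ℂ)]
  generalize 1 - q * q ^ k = A₁ at *
  generalize 1 - y * q ^ k = A₂ at *
  generalize 1 - z * q ^ k = A₃ at *
  field_simp

/-- The Askey-Wilson recurrence with `d = 0`. Division of the series by `(q; q)_m` puts a factor `1
- q^(m+2)` in front of the highest degree and removes `1 - q^(m+1)` from the lowest. -/
theorem laguerreSeries_recurrence {q y z A X : ℂ} (hq : GenericBase q)
    (hy : ∀ k : ℕ, 1 - y * q ^ k ≠ 0) (hz : ∀ k : ℕ, 1 - z * q ^ k ≠ 0) (hA : A ≠ 0)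
    {ψ : ℕ → ℂ}
    (hψ : ∀ k, ψ (k + 1) = ψ k * (1 - X * (A * q ^ k) + (A * q ^ k) ^ 2)) (m : ℕ) :
    (X - A - A⁻¹ + (1 - y * (q * q ^ m)) * (1 - z * (q * q ^ m)) / A +
        A * (1 - q * q ^ m) * (1 - y * z / A ^ 2 * q ^ m)) * laguerreSeries q y z ψ (m + 1) =
      (1 - y * (q * q ^ m)) * (1 - z * (q * q ^ m)) / A * (1 - q ^ 2 * q ^ m) *
        laguerreSeries q y z ψ (m + 2) +
      A * (1 - y * z / A ^ 2 * q ^ m) * laguerreSeries q y z ψ m := by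
  have hq0 := hq.ne_zero
  have ha : q ^ m ≠ 0 := pow_ne_zero _ hq.ne_zero
  rw [laguerreSeries_eq_sum _ _ _ _ (m := m + 2) (N := m + 3) le_rfl,
    laguerreSeries_eq_sum _ _ _ _ (m := m + 1) (N := m + 3) (by omega),
    laguerreSeries_eq_sum _ _ _ _ (m := m) (N := m + 3) (by omega), ← sub_eq_zero]
  simp only [Finset.mul_sum, ← Finset.sum_sub_distrib, ← Finset.sum_add_distrib]
  refine sum_range_eq_zero_of_telescope _ (fun k => laguerreCore q y z m k *
    (q ^ m * (1 - q ^ k) * (q - y * q ^ k) * (q - z * q ^ k) / (A * (q ^ k) ^ 2)) * ψ k) ?_ ?_ ?_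
  · intro k
    have hK : q ^ k ≠ 0 := pow_ne_zero _ hq.ne_zero
    have h4 := hq.one_sub_pow_ne k
    have h6 := hy k
    have h9 := hz k
    rw [pow_succ'] at h4
    rw [laguerreCoeff_two_eq_core hq, laguerreCoeff_one_eq_core hq, laguerreCoeff_eq_core hq,
      laguerreCore_succ hq hy hz, hψ, pow_succ' q k]
    generalize laguerreCore q y z m k = r
    generalize ψ k = f at *
    generalize q ^ k = K at *
    generalize q ^ m = a at *
    obtain ⟨A₁, hA₁⟩ : ∃ A, A = 1 - q * K := ⟨_, rfl⟩
    obtain ⟨C, hC⟩ : ∃ C, C = 1 - y * K := ⟨_, rfl⟩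
    obtain ⟨D, hD⟩ : ∃ D, D = 1 - z * K := ⟨_, rfl⟩
    rw [← hA₁] at h4 ⊢
    rw [← hC] at h6 ⊢
    rw [← hD] at h9 ⊢
    field_simp
    simp only [hC, hD]
    ring
  · simp
  · rw [laguerreCore, recipQFactorial_of_neg q (by push_cast; omega)]
    ring

theorem laguerreSeries_zero {q : ℂ} (y z : ℂ) {ψ : ℕ → ℂ} (h0 : ψ 0 = 1) :
    laguerreSeries q y z ψ 0 = 1 := by
  simp [laguerreSeries, laguerreCoeff, qShifted_zero, h0, recipQFactorial]

theorem laguerreSeries_one {q y z : ℂ} (hq : GenericBase q) {ψ : ℕ → ℂ} (h0 : ψ 0 = 1) :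
    (1 - q) * laguerreSeries q y z ψ 1 = 1 - 1 / ((1 - y) * (1 - z)) * ψ 1 := by
  have h1 : 1 - q ≠ 0 := by simpa using hq.one_sub_pow_ne 0
  have hq0 := hq.ne_zero
  simp [laguerreSeries, laguerreCoeff, qShifted, h0, recipQFactorial,
    Finset.sum_range_succ]
  rw [mul_add, mul_inv_cancel₀ h1]
  field_simp
  ring

/-! ### The bilinear identities behind the induction step -/

/-- Here `a = q^(l+1)`, `b = q^n` for the middle order `n`, and `f`, `h` are its polynomials in
degrees `l+1` and `l+2`. On the left stand the order below, the order above and the Laguerre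
diagonal; on the right degree `l+2`, the Legendre diagonal and degree `l`. -/
theorem bilinear_upper {q a b w x u v f h f' h' : ℂ} (hb : b ≠ 0) (h1 : 1 - a * b ≠ 0)
    (h2 : b - a ≠ 0) (h3 : 1 - q * a * b ≠ 0) (h4 : 1 - q * a ^ 2 ≠ 0) (h5 : 1 + a ≠ 0) :
    (b - q * a) * ((a * b * ((q + w) - w * b * (1 + q * a) * u) * f + (1 - w * a) * h) *
        (a * b * ((q + x) - x * b * (1 + q * a) * v) * f' + (1 - x * a) * h')) /
          (b * (1 - a * b)) +
      (b * (1 - q * a * b) * (a * (q + w) - w * b * (1 + q * a) * u) * f +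
          (b - q * a) * (1 - w * a) * h) *
        (b * (1 - q * a * b) * (a * (q + x) - x * b * (1 + q * a) * v) * f' +
          (b - q * a) * (1 - x * a) * h') / (b * (b - a) * (1 - q * a * b)) +
      a * b * (1 + q * a) ^ 2 * (-(b * u * w * (q + x)) - b * v * x * (q + w) +
        (1 + q) * (b * u) * (b * v) * w * x) * (f * f') =
      (1 + q * a) * (1 - w * a) * (1 - x * a) * (1 - q * a) * (b - q * a) * (h * h') /
          (b * (1 - q * a * b) * (1 - q * a ^ 2)) +
      -(2 * a ^ 2 * b * (1 + q * a) * (q + w) * (q + x) / (1 + a)) * (f * f') +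
      (1 - a) * ((b * (1 - q * a ^ 2) * (-(a * (1 + b) * (q + w)) +
            w * b * (1 + q * a) * (1 + a) * u) * f - (1 + a) * (b - q * a) * (1 - w * a) * h) *
          (b * (1 - q * a ^ 2) * (-(a * (1 + b) * (q + x)) +
            x * b * (1 + q * a) * (1 + a) * v) * f' - (1 + a) * (b - q * a) * (1 - x * a) * h')) /
        (b * (b - a) * (1 - a * b) * (1 + a) * (1 - q * a ^ 2)) := by
  -- `h` and `h'` occur only with these factors; absorbing them lowers the degree of the polynomial
  -- identity.
  generalize hH : (1 - w * a) * h = H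
  generalize hH' : (1 - x * a) * h' = H'
  have e : (1 + q * a) * (1 - w * a) * (1 - x * a) * (1 - q * a) * (b - q * a) * (h * h') =
    (1 + q * a) * (1 - q * a) * (b - q * a) * (H * H') := by rw [← hH, ← hH']; ring
  rw [e]
  simp only [mul_assoc _ (1 - w * a) h, mul_assoc _ (1 - x * a) h', hH, hH']
  clear e hH hH'
  obtain ⟨A, hA⟩ : ∃ A, A = 1 - a * b := ⟨_, rfl⟩
  obtain ⟨B, hB⟩ : ∃ A, A = b - a := ⟨_, rfl⟩
  obtain ⟨C, hC⟩ : ∃ A, A = 1 - q * a * b := ⟨_, rfl⟩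
  obtain ⟨D, hD⟩ : ∃ A, A = 1 - q * a ^ 2 := ⟨_, rfl⟩
  obtain ⟨E, hE⟩ : ∃ A, A = 1 + a := ⟨_, rfl⟩
  rw [← hA] at h1 ⊢
  rw [← hB] at h2 ⊢
  rw [← hC] at h3 ⊢
  rw [← hD] at h4 ⊢
  rw [← hE] at h5 ⊢
  field_simp
  simp only [hA, hB, hC, hD, hE]
  ring

/-- The counterpart of `bilinear_upper` for the shifted relations. The right side is the same, since
the degree recurrence keeps the arguments fixed. -/
theorem bilinear_lower {q a b w x u v f h f' h' : ℂ} (hb : b ≠ 0) (h1 : 1 - a * b ≠ 0)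
    (h2 : b - a ≠ 0) (h3 : 1 - q * a * b ≠ 0) (h4 : 1 - q * a ^ 2 ≠ 0) (h5 : 1 + a ≠ 0) :
    (b - q * a) * ((b * (a * (q + w) - w * (1 + q * a) * u) * f + (1 - w * a) * h) *
        (b * (a * (q + x) - x * (1 + q * a) * v) * f' + (1 - x * a) * h')) /
          (b * (1 - a * b)) +
      (b * (1 - q * a * b) * (a * (q + w) - w * a * (1 + q * a) * u) * f +
          (b - q * a) * (1 - w * a) * h) *
        (b * (1 - q * a * b) * (a * (q + x) - x * a * (1 + q * a) * v) * f' +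
          (b - q * a) * (1 - x * a) * h') / (b * (b - a) * (1 - q * a * b)) +
      a * b * (1 + q * a) ^ 2 * (-(u * w * (q + x)) - v * x * (q + w) +
        (1 + q) * u * v * w * x) * (f * f') =
      (1 + q * a) * (1 - w * a) * (1 - x * a) * (1 - q * a) * (b - q * a) * (h * h') /
          (b * (1 - q * a * b) * (1 - q * a ^ 2)) +
      -(2 * a ^ 2 * b * (1 + q * a) * (q + w) * (q + x) / (1 + a)) * (f * f') +
      (1 - a) * ((b * (1 - q * a ^ 2) * (-(a * (1 + b) * (q + w)) +
            w * b * (1 + q * a) * (1 + a) * u) * f - (1 + a) * (b - q * a) * (1 - w * a) * h) *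
          (b * (1 - q * a ^ 2) * (-(a * (1 + b) * (q + x)) +
            x * b * (1 + q * a) * (1 + a) * v) * f' - (1 + a) * (b - q * a) * (1 - x * a) * h')) /
        (b * (b - a) * (1 - a * b) * (1 + a) * (1 - q * a ^ 2)) := by
  generalize hH : (1 - w * a) * h = H
  generalize hH' : (1 - x * a) * h' = H'
  have e : (1 + q * a) * (1 - w * a) * (1 - x * a) * (1 - q * a) * (b - q * a) * (h * h') =
    (1 + q * a) * (1 - q * a) * (b - q * a) * (H * H') := by rw [← hH, ← hH']; ring
  rw [e]
  simp only [mul_assoc _ (1 - w * a) h, mul_assoc _ (1 - x * a) h', hH, hH']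
  clear e hH hH'
  obtain ⟨A, hA⟩ : ∃ A, A = 1 - a * b := ⟨_, rfl⟩
  obtain ⟨B, hB⟩ : ∃ A, A = b - a := ⟨_, rfl⟩
  obtain ⟨C, hC⟩ : ∃ A, A = 1 - q * a * b := ⟨_, rfl⟩
  obtain ⟨D, hD⟩ : ∃ A, A = 1 - q * a ^ 2 := ⟨_, rfl⟩
  obtain ⟨E, hE⟩ : ∃ A, A = 1 + a := ⟨_, rfl⟩
  rw [← hA] at h1 ⊢
  rw [← hB] at h2 ⊢
  rw [← hC] at h3 ⊢
  rw [← hD] at h4 ⊢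
  rw [← hE] at h5 ⊢
  field_simp
  simp only [hA, hB, hC, hD, hE]
  ring

/-- The case `b = a`, in which the term of order one higher and that of degree one lower drop out. -/
theorem bilinear_top_upper {q a w x u v f h f' h' : ℂ} (ha : a ≠ 0) (h1 : 1 - a ^ 2 ≠ 0)
    (h3 : 1 - q ≠ 0) (h4 : 1 - q * a ^ 2 ≠ 0) (h5 : 1 + a ≠ 0)
    (hf : (1 - q * a ^ 2) * (a * (q + w) - w * a * (1 + q * a) * u) * f +
      (1 - q) * (1 - w * a) * h = 0)
    (hf' : (1 - q * a ^ 2) * (a * (q + x) - x * a * (1 + q * a) * v) * f' +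
      (1 - q) * (1 - x * a) * h' = 0) :
    (a - q * a) * ((a * a * ((q + w) - w * a * (1 + q * a) * u) * f + (1 - w * a) * h) *
        (a * a * ((q + x) - x * a * (1 + q * a) * v) * f' + (1 - x * a) * h')) /
          (a * (1 - a * a)) +
      a * a * (1 + q * a) ^ 2 * (-(a * u * w * (q + x)) - a * v * x * (q + w) +
        (1 + q) * (a * u) * (a * v) * w * x) * (f * f') =
      (1 + q * a) * (1 - w * a) * (1 - x * a) * (1 - q * a) * (a - q * a) * (h * h') /
          (a * (1 - q * a * a) * (1 - q * a ^ 2)) +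
      -(2 * a ^ 2 * a * (1 + q * a) * (q + w) * (q + x) / (1 + a)) * (f * f') := by
  obtain ⟨H, hH⟩ : ∃ H, H = (1 - w * a) * h := ⟨_, rfl⟩
  obtain ⟨H', hH'⟩ : ∃ H, H = (1 - x * a) * h' := ⟨_, rfl⟩
  have e : (1 + q * a) * (1 - w * a) * (1 - x * a) * (1 - q * a) * (a - q * a) * (h * h') =
    (1 + q * a) * (1 - q * a) * (a - q * a) * (H * H') := by rw [hH, hH']; ring
  rw [mul_assoc (1 - q), ← hH] at hf
  rw [mul_assoc (1 - q), ← hH'] at hf'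
  rw [e, ← hH, ← hH']
  -- When order equals degree `l + 1`, raising gives zero; the resulting linear relation eliminates
  -- degree `l + 2`.
  obtain rfl : H = -((1 - q * a ^ 2) * (a * (q + w) - w * a * (1 + q * a) * u) * f / (1 - q)) := by
    field_simp; linear_combination hf
  obtain rfl : H' = -((1 - q * a ^ 2) * (a * (q + x) - x * a * (1 + q * a) * v) * f' / (1 -
    q)) := by
    field_simp; linear_combination hf'
  clear e hH hH' hf hf'
  rw [show 1 - a * a = (1 - a) * (1 + a) by ring, show 1 - q * a * a = 1 - q * a ^ 2 by ring]
  have h6 : 1 - a ≠ 0 := fun h => h1 (by linear_combination (1 + a) * h)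
  obtain ⟨A, hA⟩ : ∃ A, A = 1 - a := ⟨_, rfl⟩
  obtain ⟨C, hC⟩ : ∃ A, A = 1 - q := ⟨_, rfl⟩
  obtain ⟨D, hD⟩ : ∃ A, A = 1 - q * a ^ 2 := ⟨_, rfl⟩
  obtain ⟨E, hE⟩ : ∃ A, A = 1 + a := ⟨_, rfl⟩
  rw [show a - q * a = C * a by rw [hC]; ring]
  rw [← hA] at h6 ⊢
  rw [← hC] at h3 ⊢
  rw [← hD] at h4 ⊢
  rw [← hE] at h5 ⊢
  field_simp
  simp only [hA, hC, hD, hE]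
  ring

theorem bilinear_top_lower {q a w x u v f h f' h' : ℂ} (ha : a ≠ 0) (h1 : 1 - a ^ 2 ≠ 0)
    (h3 : 1 - q ≠ 0) (h4 : 1 - q * a ^ 2 ≠ 0) (h5 : 1 + a ≠ 0)
    (hf : (1 - q * a ^ 2) * (a * (q + w) - w * a * (1 + q * a) * u) * f +
      (1 - q) * (1 - w * a) * h = 0)
    (hf' : (1 - q * a ^ 2) * (a * (q + x) - x * a * (1 + q * a) * v) * f' +
      (1 - q) * (1 - x * a) * h' = 0) :
    (a - q * a) * ((a * (a * (q + w) - w * (1 + q * a) * u) * f + (1 - w * a) * h) *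
        (a * (a * (q + x) - x * (1 + q * a) * v) * f' + (1 - x * a) * h')) /
          (a * (1 - a * a)) +
      a * a * (1 + q * a) ^ 2 * (-(u * w * (q + x)) - v * x * (q + w) +
        (1 + q) * u * v * w * x) * (f * f') =
      (1 + q * a) * (1 - w * a) * (1 - x * a) * (1 - q * a) * (a - q * a) * (h * h') /
          (a * (1 - q * a * a) * (1 - q * a ^ 2)) +
      -(2 * a ^ 2 * a * (1 + q * a) * (q + w) * (q + x) / (1 + a)) * (f * f') := by
  obtain ⟨H, hH⟩ : ∃ H, H = (1 - w * a) * h := ⟨_, rfl⟩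
  obtain ⟨H', hH'⟩ : ∃ H, H = (1 - x * a) * h' := ⟨_, rfl⟩
  have e : (1 + q * a) * (1 - w * a) * (1 - x * a) * (1 - q * a) * (a - q * a) * (h * h') =
    (1 + q * a) * (1 - q * a) * (a - q * a) * (H * H') := by rw [hH, hH']; ring
  rw [mul_assoc (1 - q), ← hH] at hf
  rw [mul_assoc (1 - q), ← hH'] at hf'
  rw [e, ← hH, ← hH']
  obtain rfl : H = -((1 - q * a ^ 2) * (a * (q + w) - w * a * (1 + q * a) * u) * f / (1 - q)) := by
    field_simp; linear_combination hf
  obtain rfl : H' = -((1 - q * a ^ 2) * (a * (q + x) - x * a * (1 + q * a) * v) * f' / (1 -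
    q)) := by
    field_simp; linear_combination hf'
  clear e hH hH' hf hf'
  rw [show 1 - a * a = (1 - a) * (1 + a) by ring, show 1 - q * a * a = 1 - q * a ^ 2 by ring]
  have h6 : 1 - a ≠ 0 := fun h => h1 (by linear_combination (1 + a) * h)
  obtain ⟨A, hA⟩ : ∃ A, A = 1 - a := ⟨_, rfl⟩
  obtain ⟨C, hC⟩ : ∃ A, A = 1 - q := ⟨_, rfl⟩
  obtain ⟨D, hD⟩ : ∃ A, A = 1 - q * a ^ 2 := ⟨_, rfl⟩
  obtain ⟨E, hE⟩ : ∃ A, A = 1 + a := ⟨_, rfl⟩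
  rw [show a - q * a = C * a by rw [hC]; ring]
  rw [← hA] at h6 ⊢
  rw [← hC] at h3 ⊢
  rw [← hD] at h4 ⊢
  rw [← hE] at h5 ⊢
  field_simp
  simp only [hA, hC, hD, hE]
  ring

/-! ### Rewriting the terms of the recurrence over a common factor -/

/-- `X` and `Y` stand for the right sides of the lowering relations. The common factor `s t / (r³ (1
+ r² a)² a b)` is the one extracted in all the lemmas of this group. -/
theorem term_order_pred {r s t a b k k₀ F G X Y : ℂ} (hr : r ≠ 0) (ha : a ≠ 0) (hb : b ≠ 0)
    (h1 : 1 - a * b ≠ 0) (h2 : 1 + r ^ 2 * a ≠ 0)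
    (hk : k₀ = k * (s * t * r * a / b ^ 4 * (b - r ^ 2 * a) * (1 - a * b)))
    (hF : r ^ 2 * a * (1 - a * b) * (1 + r ^ 2 * a) * F = b * X)
    (hG : r ^ 2 * a * (1 - a * b) * (1 + r ^ 2 * a) * G = b * Y) :
    k₀ * F * G = k * (s * t / (r ^ 3 * (1 + r ^ 2 * a) ^ 2 * a * b)) *
      ((b - r ^ 2 * a) * (X * Y) / (b * (1 - a * b))) := by
  subst hk
  generalize b - r ^ 2 * a = B
  generalize 1 - a * b = A at *
  generalize 1 + r ^ 2 * a = C at *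
  obtain rfl : F = b * X / (r ^ 2 * a * A * C) := by
    rw [eq_div_iff (by positivity), ← hF]; ring
  obtain rfl : G = b * Y / (r ^ 2 * a * A * C) := by
    rw [eq_div_iff (by positivity), ← hG]; ring
  field_simp

theorem term_order_succ {r s t a b k k₂ F G X Y : ℂ} (hr : r ≠ 0) (hs : s ≠ 0) (ht : t ≠ 0)
    (ha : a ≠ 0) (hb : b ≠ 0)
    (h1 : 1 - r ^ 2 * a * b ≠ 0) (h2 : 1 + r ^ 2 * a ≠ 0) (h3 : b - a ≠ 0)
    (hk : k = k₂ * (s * t * r * a / (r ^ 2 * b) ^ 4 * (r ^ 2 * b - r ^ 2 * a) *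
      (1 - a * (r ^ 2 * b))))
    (hF : r ^ 2 * (-(r ^ 2) / s ^ 2) * b ^ 3 * (1 + r ^ 2 * a) * F = X)
    (hG : r ^ 2 * (-(r ^ 2) / t ^ 2) * b ^ 3 * (1 + r ^ 2 * a) * G = Y) :
    k₂ * F * G = k * (s * t / (r ^ 3 * (1 + r ^ 2 * a) ^ 2 * a * b)) *
      (X * Y / (b * (b - a) * (1 - r ^ 2 * a * b))) := by
  subst hk hF hG
  rw [show 1 - a * (r ^ 2 * b) = 1 - r ^ 2 * a * b by ring,
    show r ^ 2 * b - r ^ 2 * a = r ^ 2 * (b - a) by ring]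
  generalize b - a = B at *
  generalize 1 - r ^ 2 * a * b = A at *
  generalize 1 + r ^ 2 * a = C at *
  field_simp

theorem term_degree_succ {r s t w x a b k k' F G : ℂ} (hr : r ≠ 0)
    (ha : a ≠ 0) (hb : b ≠ 0)
    (h1 : 1 - r ^ 2 * a * b ≠ 0) (h2 : 1 + r ^ 2 * a ≠ 0) (h3 : 1 - r ^ 2 * a ^ 2 ≠ 0)
    (hk : k' = k * (s * t / (a * b ^ 2 * r ^ 3) * (1 - w * a) * (1 - x * a) * (1 - r ^ 2 * a) *
      (b - r ^ 2 * a) / (1 - r ^ 2 * a * b))) :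
    1 / ((1 - r ^ 2 * a ^ 2) * (1 + r ^ 2 * a)) * (k' * F * G) =
      k * (s * t / (r ^ 3 * (1 + r ^ 2 * a) ^ 2 * a * b)) *
      ((1 + r ^ 2 * a) * (1 - w * a) * (1 - x * a) * (1 - r ^ 2 * a) * (b - r ^ 2 * a) * (F * G) /
          (b * (1 - r ^ 2 * a * b) * (1 - r ^ 2 * a ^ 2))) := by
  subst hk
  generalize 1 - r ^ 2 * a * b = A at *
  generalize 1 + r ^ 2 * a = C at *
  generalize 1 - r ^ 2 * a ^ 2 = D at *
  field_simp

/-- Unlike in the preceding lemmas `a` is `q^l`, so `q^(l+1)` appears as `r² a`. -/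
theorem term_degree_pred {r s t w x a b k k' F G X Y : ℂ} (hr : r ≠ 0) (hs : s ≠ 0) (ht : t ≠ 0)
    (ha : a ≠ 0) (hb : b ≠ 0) (hw : w = -(r ^ 2) / s ^ 2) (hx : x = -(r ^ 2) / t ^ 2)
    (h1 : 1 - r ^ 2 * a * b ≠ 0) (h2 : 1 + r ^ 2 * (r ^ 2 * a) ≠ 0)
    (h3 : 1 - r ^ 2 * (r ^ 2 * a) ^ 2 ≠ 0)
    (h4 : 1 + r ^ 2 * a ≠ 0) (h5 : b - r ^ 2 * a ≠ 0)
    (hk : k = k' * (s * t / (a * b ^ 2 * r ^ 3) * (1 - w * a) * (1 - x * a) * (1 - r ^ 2 * a) *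
      (b - r ^ 2 * a) / (1 - r ^ 2 * a * b)))
    (hF : r ^ 2 * a * b ^ 2 * (1 - r ^ 2 * a * b) * (r ^ 2 * (r ^ 2 * a) - w) *
      (1 + r ^ 2 * (r ^ 2 * a)) * F = X)
    (hG : r ^ 2 * a * b ^ 2 * (1 - r ^ 2 * a * b) * (r ^ 2 * (r ^ 2 * a) - x) *
      (1 + r ^ 2 * (r ^ 2 * a)) * G = Y) :
    (1 - r ^ 2 * a) ^ 2 * (1 - w * a) * (1 - x * a) * (1 - r ^ 2 * (r ^ 2 * a) / w) *
        (1 - r ^ 2 * (r ^ 2 * a) / x) / ((1 + r ^ 2 * a) * (1 - r ^ 2 * (r ^ 2 * a) ^ 2)) *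
        (k' * F * G) =
      k * (s * t / (r ^ 3 * (1 + r ^ 2 * (r ^ 2 * a)) ^ 2 * (r ^ 2 * a) * b)) *
      ((1 - r ^ 2 * a) * (X * Y) / (b * (b - r ^ 2 * a) * (1 - r ^ 2 * a * b) * (1 + r ^ 2 * a) *
        (1 - r ^ 2 * (r ^ 2 * a) ^ 2))) := by
  have hw0 : w ≠ 0 := by rw [hw]; simp [hr, hs]
  have hx0 : x ≠ 0 := by rw [hx]; simp [hr, ht]
  have e1 : 1 - r ^ 2 * (r ^ 2 * a) / w = -(r ^ 2 * (r ^ 2 * a) - w) / w := by field_simp; ring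
  have e2 : 1 - r ^ 2 * (r ^ 2 * a) / x = -(r ^ 2 * (r ^ 2 * a) - x) / x := by field_simp; ring
  -- Only the product `w x` remains in the denominator, so `w` and `x` need not be expanded
  -- separately.
  have e3 : w * x = r ^ 4 / (s ^ 2 * t ^ 2) := by rw [hw, hx]; field_simp
  rw [e1, e2]
  subst hk hF hG
  generalize 1 - r ^ 2 * a * b = A at *
  generalize 1 + r ^ 2 * (r ^ 2 * a) = C at *
  generalize 1 - r ^ 2 * (r ^ 2 * a) ^ 2 = D at *
  generalize b - r ^ 2 * a = B at *
  generalize 1 + r ^ 2 * a = E at *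
  generalize r ^ 2 * (r ^ 2 * a) - w = W
  generalize r ^ 2 * (r ^ 2 * a) - x = V
  have : ∀ y z : ℂ, -W / w = y → -V / x = z → y * z = W * V * (s ^ 2 * t ^ 2) / r ^ 4 := by
    rintro _ _ rfl rfl
    rw [div_mul_div_comm, e3]
    field_simp
  generalize -W / w = y at *
  generalize -V / x = z at *
  have h := this y z rfl rfl
  rw [show ∀ c d e : ℂ, c * d * e * y * z = c * d * e * (y * z) by intros; ring, h]
  field_simp

/-! ### The coefficients of the addition formula -/

/-- The parameters for which all denominators below are nonzero. -/
structure GenericParams (r s t : ℂ) : Prop where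
  hr : r ≠ 0
  hs : s ≠ 0
  ht : t ≠ 0
  base : GenericBase (r ^ 2)
  hw : ∀ k : ℕ, 1 - -(r ^ 2) / s ^ 2 * (r ^ 2) ^ k ≠ 0
  hx : ∀ k : ℕ, 1 - -(r ^ 2) / t ^ 2 * (r ^ 2) ^ k ≠ 0

/-- The scalar factor of the coefficients in the addition formula. -/
def additionScale (r s t : ℂ) (n l : ℕ) : ℂ :=
  (s * t) ^ (l - n) * (r⁻¹) ^ ((l - n) * (l + 3 * n + 2)) *
    qShifted (-(r ^ 2) / s ^ 2) (r ^ 2) l * qShifted (-(r ^ 2) / t ^ 2) (r ^ 2) l *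
    qShifted (r ^ 2) (r ^ 2) l * qShifted (r ^ 2) (r ^ 2) (l - n) / qShifted (r ^ 2) (r ^ 2) (l + n)

theorem additionScale_order {r s t : ℂ} (h : GenericParams r s t) {n l : ℕ} (hn : n + 1 ≤ l) :
    additionScale r s t n l = additionScale r s t (n + 1) l *
      (s * t * r * (r ^ 2) ^ l / ((r ^ 2) ^ (n + 1)) ^ 4 *
        ((r ^ 2) ^ (n + 1) - r ^ 2 * (r ^ 2) ^ l) * (1 - (r ^ 2) ^ l * (r ^ 2) ^ (n + 1))) := by
  obtain ⟨j, rfl⟩ := Nat.exists_eq_add_of_le hn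
  have hr := h.hr
  have h1 := h.base.one_sub_pow_ne (n + 1 + j + n)
  have h2 := h.base.qShifted_ne (n + 1 + j + n)
  unfold additionScale
  rw [show n + 1 + j - n = j + 1 by omega, show n + 1 + j - (n + 1) = j by omega,
    show n + 1 + j + (n + 1) = n + 1 + j + n + 1 by ring, qShifted_succ _ _ (n + 1 + j + n),
    qShifted_succ _ _ j, ← pow_succ' (r ^ 2) (n + 1 + j + n),
    show (r ^ 2) ^ (n + 1 + j) * (r ^ 2) ^ (n + 1) = (r ^ 2) ^ (n + 1 + j + n + 1) by ring]
  generalize 1 - (r ^ 2) ^ (n + 1 + j + n + 1) = A at *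
  rw [show (r ^ 2) ^ (n + 1) - r ^ 2 * (r ^ 2) ^ (n + 1 + j) =
    (r ^ 2) ^ (n + 1) * (1 - r ^ 2 * (r ^ 2) ^ j) by ring,
    show (r⁻¹) ^ ((j + 1) * (n + 1 + j + 3 * n + 2)) = (r⁻¹) ^ (j * (n + 1 + j + 3 * (n + 1) + 2)) *
      (r * (r ^ 2) ^ (n + 1 + j) / ((r ^ 2) ^ (n + 1)) ^ 3) by
      simp only [inv_pow]
      rw [← pow_mul, ← pow_mul, ← pow_mul]
      field_simp
      ring_nf]
  generalize (r⁻¹) ^ (j * (n + 1 + j + 3 * (n + 1) + 2)) = R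
  field_simp
  ring

theorem additionScale_degree {r s t : ℂ} (h : GenericParams r s t) {n l : ℕ} (hn : n ≤ l) :
    additionScale r s t n (l + 1) = additionScale r s t n l *
      (s * t / ((r ^ 2) ^ l * ((r ^ 2) ^ n) ^ 2 * r ^ 3) * (1 - -(r ^ 2) / s ^ 2 * (r ^ 2) ^ l) *
        (1 - -(r ^ 2) / t ^ 2 * (r ^ 2) ^ l) * (1 - r ^ 2 * (r ^ 2) ^ l) *
        ((r ^ 2) ^ n - r ^ 2 * (r ^ 2) ^ l) / (1 - r ^ 2 * (r ^ 2) ^ l * (r ^ 2) ^ n)) := by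
  obtain ⟨j, rfl⟩ := Nat.exists_eq_add_of_le hn
  have hr := h.hr
  have h1 := h.base.one_sub_pow_ne (n + j + n)
  have h2 := h.base.qShifted_ne (n + j + n)
  unfold additionScale
  rw [show n + j + 1 - n = j + 1 by omega, show n + j - n = j by omega,
    show n + j + 1 + n = n + j + n + 1 by ring]
  simp only [qShifted_succ]
  rw [← pow_succ' (r ^ 2) (n + j + n),
    show r ^ 2 * (r ^ 2) ^ (n + j) * (r ^ 2) ^ n = (r ^ 2) ^ (n + j + n + 1) by ring]
  generalize 1 - (r ^ 2) ^ (n + j + n + 1) = A at *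
  rw [show (r ^ 2) ^ n - r ^ 2 * (r ^ 2) ^ (n + j) =
    (r ^ 2) ^ n * (1 - r ^ 2 * (r ^ 2) ^ j) by ring,
    show (r⁻¹) ^ ((j + 1) * (n + j + 1 + 3 * n + 2)) = (r⁻¹) ^ (j * (n + j + 3 * n + 2)) /
      ((r ^ 2) ^ (n + j) * (r ^ 2) ^ n * r ^ 3) by
      simp only [inv_pow]
      rw [← pow_mul, ← pow_mul]
      field_simp
      ring_nf]
  generalize (r⁻¹) ^ (j * (n + j + 3 * n + 2)) = R
  field_simp
  ring

/-- The coefficient of the term of order `n` in the addition formula of degree `l`. -/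
def additionCoeff (r s t : ℂ) (n l : ℕ) (u v : ℂ) : ℂ :=
  additionScale r s t n l * bigQUltra (r ^ 2) (-(r ^ 2) / s ^ 2) n l u *
    bigQUltra (r ^ 2) (-(r ^ 2) / t ^ 2) n l v

theorem additionCoeff_of_lt (r s t : ℂ) {n l : ℕ} (h : l < n) (u v : ℂ) :
    additionCoeff r s t n l u v = 0 := by
  rw [additionCoeff, bigQUltra_of_lt _ _ h]
  ring

/-- The diagonal coefficient of the recurrence of the `q`-Laguerre polynomials. -/
def laguerreDiag (r s t u v : ℂ) : ℂ :=
  r * (u * (t - t⁻¹) / s + v * (s - s⁻¹) / t + (1 + r ^ 2) * u * v / (s * t))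

/-- The subdiagonal coefficient of the recurrence of the `q`-Laguerre polynomials. -/
def laguerreSub (s t u v : ℂ) : ℂ :=
  (1 - u) * (1 - v) * (1 + v / t ^ 2) * (1 + u / s ^ 2)

/-- The diagonal coefficient of the recurrence of the `q`-Legendre polynomials; `a = q^l`. -/
def legendreDiag (r s t a : ℂ) : ℂ :=
  -(2 * r * a * (s - s⁻¹) * (t - t⁻¹) / ((1 + a) * (1 + r ^ 2 * a)))

/-- The subdiagonal coefficient of the recurrence of the `q`-Legendre polynomials in degree `l + 1`;
`a = q^l`. -/
def legendreSub (r s t a : ℂ) : ℂ :=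
  (1 - r ^ 2 * a) ^ 2 * (1 - -(r ^ 2) / s ^ 2 * a) * (1 - -(r ^ 2) / t ^ 2 * a) *
    (1 - r ^ 2 * (r ^ 2 * a) / (-(r ^ 2) / s ^ 2)) *
    (1 - r ^ 2 * (r ^ 2 * a) / (-(r ^ 2) / t ^ 2)) /
    ((1 + r ^ 2 * a) * (1 - r ^ 2 * (r ^ 2 * a) ^ 2))

/-- The superdiagonal coefficient of the recurrence of the `q`-Legendre polynomials; `a = q^l`. -/
def legendreSuper (r a : ℂ) : ℂ := 1 / ((1 - r ^ 2 * a ^ 2) * (1 + r ^ 2 * a))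

theorem laguerreDiag_eq {r s t a b : ℂ} (hr : r ≠ 0) (hs : s ≠ 0) (ht : t ≠ 0) (ha : a ≠ 0)
    (hb : b ≠ 0) (h : 1 + r ^ 2 * a ≠ 0) (u v : ℂ) :
    laguerreDiag r s t u v = s * t / (r ^ 3 * (1 + r ^ 2 * a) ^ 2 * a * b) *
      (a * b * (1 + r ^ 2 * a) ^ 2 * (-(u * (-(r ^ 2) / s ^ 2) * (r ^ 2 + -(r ^ 2) / t ^ 2)) -
        v * (-(r ^ 2) / t ^ 2) * (r ^ 2 + -(r ^ 2) / s ^ 2) +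
        (1 + r ^ 2) * u * v * (-(r ^ 2) / s ^ 2) * (-(r ^ 2) / t ^ 2))) := by
  unfold laguerreDiag
  generalize 1 + r ^ 2 * a = C at *
  field_simp
  ring

theorem legendreDiag_eq {r s t a b : ℂ} (hr : r ≠ 0) (hs : s ≠ 0) (ht : t ≠ 0) (ha : a ≠ 0)
    (hb : b ≠ 0) (h : 1 + r ^ 2 * a ≠ 0) (h' : 1 + a ≠ 0) :
    legendreDiag r s t a = s * t / (r ^ 3 * (1 + r ^ 2 * a) ^ 2 * a * b) *
      -(2 * a ^ 2 * b * (1 + r ^ 2 * a) * (r ^ 2 + -(r ^ 2) / s ^ 2) *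
        (r ^ 2 + -(r ^ 2) / t ^ 2) / (1 + a)) := by
  unfold legendreDiag
  generalize 1 + r ^ 2 * a = C at *
  generalize 1 + a = D at *
  field_simp
  ring

/-! ### The difference equation of the coefficients -/

theorem pow_sub_pow_ne {q : ℂ} (hq : GenericBase q) {n l : ℕ} (h : n < l) : q ^ n - q ^ l ≠ 0 := by
  obtain ⟨j, rfl⟩ := Nat.exists_eq_add_of_lt h
  rw [show q ^ n - q ^ (n + j + 1) = q ^ n * (1 - q ^ (j + 1)) by ring]
  exact mul_ne_zero (pow_ne_zero _ hq.ne_zero) (hq.one_sub_pow_ne j)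

theorem bigQUltra_pred_eq {q w : ℂ} (hq : GenericBase q) (hw : ∀ k : ℕ, 1 - w * q ^ k ≠ 0)
    (n l : ℕ) (u : ℂ) :
    q * q ^ l * (q ^ n) ^ 2 * (1 - q * q ^ l * q ^ n) * (q * (q * q ^ l) - w) *
        (1 + q * (q * q ^ l)) * bigQUltra q w n l u =
      q ^ n * (1 - q * (q * q ^ l) ^ 2) * (-(q * q ^ l * (1 + q ^ n) * (q + w)) +
        w * q ^ n * (1 + q * (q * q ^ l)) * (1 + q * q ^ l) * u) * bigQUltra q w n (l + 1) u -
      (1 + q * q ^ l) * (q ^ n - q * (q * q ^ l)) * (1 - w * (q * q ^ l)) *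
        bigQUltra q w n (l + 2) u := by
  linear_combination bigQUltra_recurrence hq hw n l u

/-- The recurrence in the degree of the coefficients, from a bilinear identity for the terms that
change the order. -/
theorem additionCoeff_recurrence_of_bilinear {r s t : ℂ} (h : GenericParams r s t) {n l : ℕ}
    (hn : n ≤ l) {u v c₀ c₂ d d' t₀ t₂ a b : ℂ} (ha : a = r ^ 2 * (r ^ 2) ^ l)
    (hb : b = (r ^ 2) ^ n)
    (h₀ : c₀ = additionScale r s t n (l + 1) * (s * t / (r ^ 3 * (1 + r ^ 2 * a) ^ 2 * a * b)) * t₀)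
    (h₂ : c₂ = additionScale r s t n (l + 1) * (s * t / (r ^ 3 * (1 + r ^ 2 * a) ^ 2 * a * b)) * t₂)
    (hd : d = (s * t / (r ^ 3 * (1 + r ^ 2 * a) ^ 2 * a * b)) * d')
    (B : t₀ + t₂ + d' * (bigQUltra (r ^ 2) (-(r ^ 2) / s ^ 2) n (l + 1) u *
      bigQUltra (r ^ 2) (-(r ^ 2) / t ^ 2) n (l + 1) v) =
      (1 + r ^ 2 * a) * (1 - -(r ^ 2) / s ^ 2 * a) * (1 - -(r ^ 2) / t ^ 2 * a) * (1 - r ^ 2 * a) *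
        (b - r ^ 2 * a) *
        (bigQUltra (r ^ 2) (-(r ^ 2) / s ^ 2) n (l + 2) u *
          bigQUltra (r ^ 2) (-(r ^ 2) / t ^ 2) n (l + 2) v) /
          (b * (1 - r ^ 2 * a * b) * (1 - r ^ 2 * a ^ 2)) +
      -(2 * a ^ 2 * b * (1 + r ^ 2 * a) * (r ^ 2 + -(r ^ 2) / s ^ 2) * (r ^ 2 +
        -(r ^ 2) / t ^ 2) / (1 + a)) *
        (bigQUltra (r ^ 2) (-(r ^ 2) / s ^ 2) n (l + 1) u *
          bigQUltra (r ^ 2) (-(r ^ 2) / t ^ 2) n (l + 1) v) +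
      (1 - a) * ((b * (1 - r ^ 2 * a ^ 2) * (-(a * (1 + b) * (r ^ 2 + -(r ^ 2) / s ^ 2)) +
            -(r ^ 2) / s ^ 2 * b * (1 + r ^ 2 * a) * (1 + a) * u) *
              bigQUltra (r ^ 2) (-(r ^ 2) / s ^ 2) n (l + 1) u -
            (1 + a) * (b - r ^ 2 * a) * (1 - -(r ^ 2) / s ^ 2 * a) *
              bigQUltra (r ^ 2) (-(r ^ 2) / s ^ 2) n (l + 2) u) *
          (b * (1 - r ^ 2 * a ^ 2) * (-(a * (1 + b) * (r ^ 2 + -(r ^ 2) / t ^ 2)) +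
            -(r ^ 2) / t ^ 2 * b * (1 + r ^ 2 * a) * (1 + a) * v) *
              bigQUltra (r ^ 2) (-(r ^ 2) / t ^ 2) n (l + 1) v -
            (1 + a) * (b - r ^ 2 * a) * (1 - -(r ^ 2) / t ^ 2 * a) *
              bigQUltra (r ^ 2) (-(r ^ 2) / t ^ 2) n (l + 2) v)) /
        (b * (b - a) * (1 - a * b) * (1 + a) * (1 - r ^ 2 * a ^ 2))) :
    c₀ + d * additionCoeff r s t n (l + 1) u v + c₂ =
      legendreSuper r a * additionCoeff r s t n (l + 2) u v +
      legendreDiag r s t a * additionCoeff r s t n (l + 1) u v +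
      legendreSub r s t ((r ^ 2) ^ l) * additionCoeff r s t n l u v := by
  have hq := h.base
  have hr := h.hr
  have hs := h.hs
  have ht := h.ht
  have ha₀ : (r ^ 2) ^ l ≠ 0 := pow_ne_zero _ hq.ne_zero
  have hb₀ : b ≠ 0 := hb ▸ pow_ne_zero _ hq.ne_zero
  have hA : a ≠ 0 := ha ▸ mul_ne_zero hq.ne_zero ha₀
  have kl := additionScale_degree h (n := n) (l := l + 1) (by omega)
  have km := additionScale_degree h (n := n) (l := l) (by omega)
  have Fm := bigQUltra_pred_eq hq h.hw n l u
  have Gm := bigQUltra_pred_eq hq h.hx n l v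
  have n1 := hq.one_sub_pow_ne (l + n)
  have n2 := hq.one_add_pow_ne (l + 1)
  have n3 := hq.one_sub_pow_ne (l + 1 + n)
  have n4 := pow_sub_pow_ne hq (n := n) (l := l + 1) (by omega)
  have n5 := hq.one_sub_pow_ne (2 * l + 2)
  have n6 := hq.one_add_pow_ne l
  rw [show (r ^ 2) ^ (l + n + 1) = r ^ 2 * (r ^ 2) ^ l * (r ^ 2) ^ n by ring] at n1
  rw [show (r ^ 2) ^ (l + 1 + 1) = r ^ 2 * (r ^ 2 * (r ^ 2) ^ l) by ring] at n2
  rw [show (r ^ 2) ^ (l + 1 + n + 1) = r ^ 2 * (r ^ 2 * (r ^ 2) ^ l) * (r ^ 2) ^ n by ring] at n3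
  rw [show (r ^ 2) ^ (2 * l + 2 + 1) = r ^ 2 * (r ^ 2 * (r ^ 2) ^ l) ^ 2 by ring] at n5
  rw [pow_succ' _ l] at n4 n6 kl
  rw [← hb] at n1 n3 n4 kl km Fm Gm
  have T4 := term_degree_pred hr hs ht ha₀ hb₀ rfl rfl n1 n2 n5 n6 n4 km Fm Gm
  rw [← ha] at n1 n2 n3 n4 n5 n6 kl
  have T3 := term_degree_succ (F := bigQUltra (r ^ 2) (-(r ^ 2) / s ^ 2) n (l + 2) u)
    (G := bigQUltra (r ^ 2) (-(r ^ 2) / t ^ 2) n (l + 2) v) hr hA hb₀ n3 n2 n5 kl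
  have e2 := legendreDiag_eq hr hs ht hA hb₀ n2 n6
  unfold additionCoeff legendreSuper legendreSub
  rw [e2, T3, T4, h₀, h₂, hd, ← ha]
  rw [show ∀ K L e f g : ℂ, L * e * (K * f * g) = K * L * (e * (f * g)) by intros; ring,
    show ∀ K L e f g : ℂ, L * e * (K * f * g) = K * L * (e * (f * g)) by intros; ring,
    ← mul_add, ← mul_add, ← mul_add, ← mul_add, ← B]
  ring

/-- Order equal to degree `l + 1` means `b = a`: the generic identity has the denominator `b - a`,
but the terms carrying it are absent. -/
theorem additionCoeff_recurrence_of_bilinear_top {r s t : ℂ} (h : GenericParams r s t) (l : ℕ)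
    {u v c₀ d d' t₀ a : ℂ} (ha : a = r ^ 2 * (r ^ 2) ^ l)
    (h₀ : c₀ = additionScale r s t (l + 1) (l + 1) * (s * t / (r ^ 3 * (1 + r ^ 2 * a) ^ 2 * a *
      a)) * t₀)
    (hd : d = (s * t / (r ^ 3 * (1 + r ^ 2 * a) ^ 2 * a * a)) * d')
    (B : t₀ + d' * (bigQUltra (r ^ 2) (-(r ^ 2) / s ^ 2) (l + 1) (l + 1) u *
      bigQUltra (r ^ 2) (-(r ^ 2) / t ^ 2) (l + 1) (l + 1) v) =
      (1 + r ^ 2 * a) * (1 - -(r ^ 2) / s ^ 2 * a) * (1 - -(r ^ 2) / t ^ 2 * a) * (1 - r ^ 2 * a) *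
        (a - r ^ 2 * a) *
        (bigQUltra (r ^ 2) (-(r ^ 2) / s ^ 2) (l + 1) (l + 2) u *
          bigQUltra (r ^ 2) (-(r ^ 2) / t ^ 2) (l + 1) (l + 2) v) /
          (a * (1 - r ^ 2 * a * a) * (1 - r ^ 2 * a ^ 2)) +
      -(2 * a ^ 2 * a * (1 + r ^ 2 * a) * (r ^ 2 + -(r ^ 2) / s ^ 2) * (r ^ 2 +
        -(r ^ 2) / t ^ 2) / (1 + a)) *
        (bigQUltra (r ^ 2) (-(r ^ 2) / s ^ 2) (l + 1) (l + 1) u *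
          bigQUltra (r ^ 2) (-(r ^ 2) / t ^ 2) (l + 1) (l + 1) v)) :
    c₀ + d * additionCoeff r s t (l + 1) (l + 1) u v =
      legendreSuper r a * additionCoeff r s t (l + 1) (l + 2) u v +
      legendreDiag r s t a * additionCoeff r s t (l + 1) (l + 1) u v := by
  have hq := h.base
  have hr := h.hr
  have hs := h.hs
  have ht := h.ht
  have hA : a ≠ 0 := ha ▸ mul_ne_zero hq.ne_zero (pow_ne_zero _ hq.ne_zero)
  have kl := additionScale_degree h (n := l + 1) (l := l + 1) le_rfl
  have n2 := hq.one_add_pow_ne (l + 1)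
  have n5 := hq.one_sub_pow_ne (2 * l + 2)
  have n6 := hq.one_add_pow_ne l
  rw [show (r ^ 2) ^ (l + 1 + 1) = r ^ 2 * (r ^ 2 * (r ^ 2) ^ l) by ring, ← ha] at n2
  rw [show (r ^ 2) ^ (2 * l + 2 + 1) = r ^ 2 * (r ^ 2 * (r ^ 2) ^ l) ^ 2 by ring, ← ha] at n5
  rw [pow_succ' _ l, ← ha] at n6 kl
  have n3 : 1 - r ^ 2 * a * a ≠ 0 := by rwa [mul_assoc, ← sq]
  have T3 := term_degree_succ (F := bigQUltra (r ^ 2) (-(r ^ 2) / s ^ 2) (l + 1) (l + 2) u)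
    (G := bigQUltra (r ^ 2) (-(r ^ 2) / t ^ 2) (l + 1) (l + 2) v) hr hA hA n3 n2 n5 kl
  have e2 := legendreDiag_eq hr hs ht hA hA n2 n6
  unfold additionCoeff legendreSuper
  rw [e2, T3, h₀, hd]
  rw [show ∀ K L e f g : ℂ, L * e * (K * f * g) = K * L * (e * (f * g)) by intros; ring,
    show ∀ K L e f g : ℂ, L * e * (K * f * g) = K * L * (e * (f * g)) by intros; ring,
    ← mul_add, ← mul_add, ← B]

/-- The Laguerre subdiagonal coefficient splits into the prefactors of `bigQUltra_raise_shift` in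
the two variables; this is what makes the order-raising term computable. -/
theorem laguerreSub_eq {r : ℂ} (hr : r ≠ 0) (s t u v : ℂ) : laguerreSub s t u v =
    ((1 - u) * (1 - -(r ^ 2) / s ^ 2 * u / r ^ 2)) *
      ((1 - v) * (1 - -(r ^ 2) / t ^ 2 * v / r ^ 2)) := by
  have e : ∀ s u : ℂ, -(r ^ 2) / s ^ 2 * u / r ^ 2 = -(u / s ^ 2) := by
    intro s u
    rw [neg_div, neg_mul, neg_div]
    congr 1
    field_simp
  rw [e, e, laguerreSub]
  ring

theorem laguerreSub_mul_eq (r s t b u v : ℂ) : laguerreSub s t (r ^ 2 * b * u) (r ^ 2 * b * v) =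
    ((1 - r ^ 2 * b * u) * (1 - -(r ^ 2) / s ^ 2 * b * u)) *
      ((1 - r ^ 2 * b * v) * (1 - -(r ^ 2) / t ^ 2 * b * v)) := by
  unfold laguerreSub
  ring

/-- The coefficient of `L m`, where the two sums meet: both neighbours have order one, reached by
shifted raising from `L (m - 1)` and by plain raising from `L (m + 1)`. -/
theorem additionCoeff_zero_recurrence {r s t : ℂ} (h : GenericParams r s t) (l : ℕ) (u v : ℂ) :
    laguerreSub s t u v * additionCoeff r s t 1 (l + 1) (u / r ^ 2) (v / r ^ 2) +
      laguerreDiag r s t u v * additionCoeff r s t 0 (l + 1) u v +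
      laguerreSub s t (r ^ 2 * u) (r ^ 2 * v) * additionCoeff r s t 1 (l + 1) u v =
    legendreSuper r (r ^ 2 * (r ^ 2) ^ l) * additionCoeff r s t 0 (l + 2) u v +
      legendreDiag r s t (r ^ 2 * (r ^ 2) ^ l) * additionCoeff r s t 0 (l + 1) u v +
      legendreSub r s t ((r ^ 2) ^ l) * additionCoeff r s t 0 l u v := by
  have hq := h.base
  have hr := h.hr
  have hs := h.hs
  have ht := h.ht
  have hA : r ^ 2 * (r ^ 2) ^ l ≠ 0 := mul_ne_zero hq.ne_zero (pow_ne_zero _ hq.ne_zero)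
  have n2 := hq.one_add_pow_ne (l + 1)
  have n5 := hq.one_sub_pow_ne (2 * l + 2)
  have n6 := hq.one_add_pow_ne l
  rw [show (r ^ 2) ^ (l + 1 + 1) = r ^ 2 * (r ^ 2 * (r ^ 2) ^ l) by ring] at n2
  rw [show (r ^ 2) ^ (2 * l + 2 + 1) = r ^ 2 * (r ^ 2 * (r ^ 2) ^ l) ^ 2 by ring] at n5
  have hb : (r ^ 2) ^ (0) ≠ 0 := pow_ne_zero _ hq.ne_zero
  have n1 := hq.one_sub_pow_ne (l + (0))
  have n3 := hq.one_sub_pow_ne (l + 1 + (0))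
  have n4 := pow_sub_pow_ne hq (n := 0) (l := l + 1) (by omega)
  rw [show (r ^ 2) ^ (l + (0) + 1) = r ^ 2 * (r ^ 2) ^ l * (r ^ 2) ^ (0) by ring] at n1
  rw [show (r ^ 2) ^ (l + 1 + (0) + 1) =
    r ^ 2 * (r ^ 2 * (r ^ 2) ^ l) * (r ^ 2) ^ (0) by ring] at n3
  have k2 := additionScale_order h (n := 0) (l := l + 1) (by omega)
  have F2 := bigQUltra_raise hq h.hw 0 (l + 1) u
  have G2 := bigQUltra_raise hq h.hx 0 (l + 1) v
  have F3 := bigQUltra_raise_shift hq h.hw 0 (l + 1) u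
  have G3 := bigQUltra_raise_shift hq h.hx 0 (l + 1) v
  rw [pow_succ' _ l] at n4 n6 k2 F2 G2 F3 G3
  rw [pow_succ' _ 0] at k2
  have T2 := term_order_succ hr hs ht hA hb n3 n2 n4 k2
    ((mul_assoc _ _ _).symm.trans F2) ((mul_assoc _ _ _).symm.trans G2)
  have T1 := term_order_succ hr hs ht hA hb n3 n2 n4 k2
    ((mul_assoc _ _ _).symm.trans F3) ((mul_assoc _ _ _).symm.trans G3)
  have e1 := laguerreDiag_eq hr hs ht hA hb n2 u v
  have e3 := laguerreSub_mul_eq r s t ((r ^ 2) ^ 0) u v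
  rw [pow_zero, mul_one] at e3
  refine additionCoeff_recurrence_of_bilinear h (Nat.zero_le l) rfl rfl
    (Eq.trans ?_ T1) (Eq.trans ?_ T2) e1 ?_
  · rw [laguerreSub_eq hr, additionCoeff]
    ring
  · rw [e3, additionCoeff, pow_zero]
    ring
  -- At `b = 1` the shifted raising term equals the lowering term of the generic identity, so no
  -- separate bilinear identity is needed.
  · refine Eq.trans ?_ (bilinear_upper hb n1 n4 n3 n5 n6)
    rw [pow_zero] at n1 n3 ⊢
    congr 2
    · rw [pow_zero] at n4
      rw [div_eq_div_iff (mul_ne_zero (mul_ne_zero one_ne_zero n4) n3) (mul_ne_zero one_ne_zero n1)]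
      ring
    · ring

/-- Orders `n` and `n + 2` are reached from the middle order `n + 1` by lowering and raising with
`u`, `v` fixed; `n < l` makes `q^(n+1) - q^(l+1)` nonzero. -/
theorem additionCoeff_upper_recurrence_of_lt {r s t : ℂ} (h : GenericParams r s t) {n l : ℕ}
    (hn : n < l) {u v : ℂ}
    (hu : 1 - -(r ^ 2) / s ^ 2 * u * (r ^ 2) ^ n ≠ 0) (hv : 1 - -(r ^ 2) / t ^ 2 * v *
      (r ^ 2) ^ n ≠ 0) :
    additionCoeff r s t n (l + 1) u v +
      laguerreDiag r s t ((r ^ 2) ^ (n + 1) * u) ((r ^ 2) ^ (n + 1) * v) *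
        additionCoeff r s t (n + 1) (l + 1) u v +
      laguerreSub s t ((r ^ 2) ^ (n + 2) * u) ((r ^ 2) ^ (n + 2) * v) *
        additionCoeff r s t (n + 2) (l + 1) u v =
    legendreSuper r (r ^ 2 * (r ^ 2) ^ l) * additionCoeff r s t (n + 1) (l + 2) u v +
      legendreDiag r s t (r ^ 2 * (r ^ 2) ^ l) * additionCoeff r s t (n + 1) (l + 1) u v +
      legendreSub r s t ((r ^ 2) ^ l) * additionCoeff r s t (n + 1) l u v := by
  have hq := h.base
  have hr := h.hr
  have hs := h.hs
  have ht := h.ht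
  have hA : r ^ 2 * (r ^ 2) ^ l ≠ 0 := mul_ne_zero hq.ne_zero (pow_ne_zero _ hq.ne_zero)
  have n2 := hq.one_add_pow_ne (l + 1)
  have n5 := hq.one_sub_pow_ne (2 * l + 2)
  have n6 := hq.one_add_pow_ne l
  rw [show (r ^ 2) ^ (l + 1 + 1) = r ^ 2 * (r ^ 2 * (r ^ 2) ^ l) by ring] at n2
  rw [show (r ^ 2) ^ (2 * l + 2 + 1) = r ^ 2 * (r ^ 2 * (r ^ 2) ^ l) ^ 2 by ring] at n5
  have hb : (r ^ 2) ^ (n + 1) ≠ 0 := pow_ne_zero _ hq.ne_zero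
  have n1 := hq.one_sub_pow_ne (l + (n + 1))
  have n3 := hq.one_sub_pow_ne (l + 1 + (n + 1))
  have n4 := pow_sub_pow_ne hq (n := n + 1) (l := l + 1) (by omega)
  rw [show (r ^ 2) ^ (l + (n + 1) + 1) = r ^ 2 * (r ^ 2) ^ l * (r ^ 2) ^ (n + 1) by ring] at n1
  rw [show (r ^ 2) ^ (l + 1 + (n + 1) + 1) =
    r ^ 2 * (r ^ 2 * (r ^ 2) ^ l) * (r ^ 2) ^ (n + 1) by ring] at n3
  have k0 := additionScale_order h (n := n) (l := l + 1) (by omega)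
  have k2 := additionScale_order h (n := n + 1) (l := l + 1) (by omega)
  have F0 := bigQUltra_lower hq h.hw n (l + 1) u hu
  have G0 := bigQUltra_lower hq h.hx n (l + 1) v hv
  have F2 := bigQUltra_raise hq h.hw (n + 1) (l + 1) u
  have G2 := bigQUltra_raise hq h.hx (n + 1) (l + 1) v
  rw [pow_succ' _ l] at n4 n6 k0 k2 F0 G0 F2 G2
  rw [pow_succ' _ (n + 1)] at k2
  have T1 := term_order_pred hr hA hb n1 n2 k0
    (F0.trans (show _ = (r ^ 2) ^ (n + 1) * ((r ^ 2 * (r ^ 2) ^ l) * (r ^ 2) ^ (n + 1) * ((r ^ 2 +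
      -(r ^ 2) / s ^ 2) - -(r ^ 2) / s ^ 2 * (r ^ 2) ^ (n + 1) * (1 + r ^ 2 * (r ^ 2 *
      (r ^ 2) ^ l)) * u) * bigQUltra (r ^ 2) (-(r ^ 2) / s ^ 2) (n + 1) (l + 1) u + (1 -
      -(r ^ 2) / s ^ 2 * (r ^ 2 * (r ^ 2) ^ l)) * bigQUltra (r ^ 2) (-(r ^ 2) / s ^ 2) (n + 1) (l +
      2) u) by ring))
    (G0.trans (show _ = (r ^ 2) ^ (n + 1) * ((r ^ 2 * (r ^ 2) ^ l) * (r ^ 2) ^ (n + 1) * ((r ^ 2 +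
      -(r ^ 2) / t ^ 2) - -(r ^ 2) / t ^ 2 * (r ^ 2) ^ (n + 1) * (1 + r ^ 2 * (r ^ 2 *
      (r ^ 2) ^ l)) * v) * bigQUltra (r ^ 2) (-(r ^ 2) / t ^ 2) (n + 1) (l + 1) v + (1 -
      -(r ^ 2) / t ^ 2 * (r ^ 2 * (r ^ 2) ^ l)) * bigQUltra (r ^ 2) (-(r ^ 2) / t ^ 2) (n + 1) (l +
      2) v) by ring))
  have T2 := term_order_succ hr hs ht hA hb n3 n2 n4 k2
    ((mul_assoc _ _ _).symm.trans F2) ((mul_assoc _ _ _).symm.trans G2)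
  refine additionCoeff_recurrence_of_bilinear h (n := n + 1) hn rfl rfl T1 (Eq.trans ?_ T2)
    (laguerreDiag_eq hr hs ht hA hb n2 _ _) ?_
  · rw [pow_succ' _ (n + 1), laguerreSub_mul_eq, additionCoeff]
    ring
  · exact bilinear_upper hb n1 n4 n3 n5 n6

theorem additionCoeff_upper_recurrence_self {r s t : ℂ} (h : GenericParams r s t) {n : ℕ}
    {u v : ℂ}
    (hu : 1 - -(r ^ 2) / s ^ 2 * u * (r ^ 2) ^ n ≠ 0) (hv : 1 - -(r ^ 2) / t ^ 2 * v *
      (r ^ 2) ^ n ≠ 0) :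
    additionCoeff r s t n (n + 1) u v +
      laguerreDiag r s t ((r ^ 2) ^ (n + 1) * u) ((r ^ 2) ^ (n + 1) * v) *
        additionCoeff r s t (n + 1) (n + 1) u v =
    legendreSuper r (r ^ 2 * (r ^ 2) ^ n) * additionCoeff r s t (n + 1) (n + 2) u v +
      legendreDiag r s t (r ^ 2 * (r ^ 2) ^ n) * additionCoeff r s t (n + 1) (n + 1) u v := by
  have hq := h.base
  have hr := h.hr
  have hs := h.hs
  have ht := h.ht
  -- Keeping `l` apart from `n` preserves the shapes in `q^l` and `q^(n+1)` until the relations have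
  -- been applied.
  obtain ⟨l, hl⟩ : ∃ l, l = n := ⟨_, rfl⟩
  have hA : r ^ 2 * (r ^ 2) ^ l ≠ 0 := mul_ne_zero hq.ne_zero (pow_ne_zero _ hq.ne_zero)
  have n2 := hq.one_add_pow_ne (l + 1)
  have n5 := hq.one_sub_pow_ne (2 * l + 2)
  have n6 := hq.one_add_pow_ne l
  rw [show (r ^ 2) ^ (l + 1 + 1) = r ^ 2 * (r ^ 2 * (r ^ 2) ^ l) by ring] at n2
  rw [show (r ^ 2) ^ (2 * l + 2 + 1) = r ^ 2 * (r ^ 2 * (r ^ 2) ^ l) ^ 2 by ring] at n5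
  have hb : (r ^ 2) ^ (n + 1) ≠ 0 := pow_ne_zero _ hq.ne_zero
  have n1 := hq.one_sub_pow_ne (l + (n + 1))
  rw [show (r ^ 2) ^ (l + (n + 1) + 1) = r ^ 2 * (r ^ 2) ^ l * (r ^ 2) ^ (n + 1) by ring] at n1
  have n7 : 1 - r ^ 2 ≠ 0 := by simpa using hq.one_sub_pow_ne 0
  have k0 := additionScale_order h (n := n) (l := l + 1) (by omega)
  have F0 := bigQUltra_lower hq h.hw n (l + 1) u hu
  have G0 := bigQUltra_lower hq h.hx n (l + 1) v hv
  have F2 := bigQUltra_raise hq h.hw (n + 1) (l + 1) u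
  have G2 := bigQUltra_raise hq h.hx (n + 1) (l + 1) v
  -- Order `n + 2` exceeds degree `l + 1`, so raising becomes the linear relation between degrees `l
  -- + 1` and `l + 2` required by `bilinear_top_upper`.
  rw [bigQUltra_of_lt _ _ (by omega), mul_zero] at F2 G2
  rw [pow_succ' _ l] at n6 k0 F0 G0 F2 G2
  have T1 := term_order_pred hr hA hb n1 n2 k0
    (F0.trans (show _ = (r ^ 2) ^ (n + 1) * ((r ^ 2 * (r ^ 2) ^ l) * (r ^ 2) ^ (n + 1) * ((r ^ 2 +
      -(r ^ 2) / s ^ 2) - -(r ^ 2) / s ^ 2 * (r ^ 2) ^ (n + 1) * (1 + r ^ 2 * (r ^ 2 *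
      (r ^ 2) ^ l)) * u) * bigQUltra (r ^ 2) (-(r ^ 2) / s ^ 2) (n + 1) (l + 1) u + (1 -
      -(r ^ 2) / s ^ 2 * (r ^ 2 * (r ^ 2) ^ l)) * bigQUltra (r ^ 2) (-(r ^ 2) / s ^ 2) (n + 1) (l +
      2) u) by ring))
    (G0.trans (show _ = (r ^ 2) ^ (n + 1) * ((r ^ 2 * (r ^ 2) ^ l) * (r ^ 2) ^ (n + 1) * ((r ^ 2 +
      -(r ^ 2) / t ^ 2) - -(r ^ 2) / t ^ 2 * (r ^ 2) ^ (n + 1) * (1 + r ^ 2 * (r ^ 2 *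
      (r ^ 2) ^ l)) * v) * bigQUltra (r ^ 2) (-(r ^ 2) / t ^ 2) (n + 1) (l + 1) v + (1 -
      -(r ^ 2) / t ^ 2 * (r ^ 2 * (r ^ 2) ^ l)) * bigQUltra (r ^ 2) (-(r ^ 2) / t ^ 2) (n + 1) (l +
      2) v) by ring))
  subst hl
  rw [pow_succ' _ l] at *
  have n8 : 1 - (r ^ 2 * (r ^ 2) ^ l) ^ 2 ≠ 0 := by rwa [sq]
  refine additionCoeff_recurrence_of_bilinear_top h l rfl T1
    (laguerreDiag_eq hr hs ht hA hA n2 _ _) (bilinear_top_upper hA n8 n7 n5 n6 ?_ ?_)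
  · refine (mul_eq_zero.1 (?_ : (r ^ 2 * (r ^ 2) ^ l) * _ = 0)).resolve_left hA
    linear_combination -F2
  · refine (mul_eq_zero.1 (?_ : (r ^ 2 * (r ^ 2) ^ l) * _ = 0)).resolve_left hA
    linear_combination -G2

theorem additionCoeff_lower_recurrence_of_lt {r s t : ℂ} (h : GenericParams r s t) {n l : ℕ}
    (hn : n < l) {u v : ℂ} :
    additionCoeff r s t n (l + 1) (u * r ^ 2) (v * r ^ 2) +
      laguerreDiag r s t u v *
        additionCoeff r s t (n + 1) (l + 1) u v +
      laguerreSub s t u v * additionCoeff r s t (n + 2) (l + 1) (u / r ^ 2) (v / r ^ 2) =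
    legendreSuper r (r ^ 2 * (r ^ 2) ^ l) * additionCoeff r s t (n + 1) (l + 2) u v +
      legendreDiag r s t (r ^ 2 * (r ^ 2) ^ l) * additionCoeff r s t (n + 1) (l + 1) u v +
      legendreSub r s t ((r ^ 2) ^ l) * additionCoeff r s t (n + 1) l u v := by
  have hq := h.base
  have hr := h.hr
  have hs := h.hs
  have ht := h.ht
  have hA : r ^ 2 * (r ^ 2) ^ l ≠ 0 := mul_ne_zero hq.ne_zero (pow_ne_zero _ hq.ne_zero)
  have n2 := hq.one_add_pow_ne (l + 1)
  have n5 := hq.one_sub_pow_ne (2 * l + 2)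
  have n6 := hq.one_add_pow_ne l
  rw [show (r ^ 2) ^ (l + 1 + 1) = r ^ 2 * (r ^ 2 * (r ^ 2) ^ l) by ring] at n2
  rw [show (r ^ 2) ^ (2 * l + 2 + 1) = r ^ 2 * (r ^ 2 * (r ^ 2) ^ l) ^ 2 by ring] at n5
  have hb : (r ^ 2) ^ (n + 1) ≠ 0 := pow_ne_zero _ hq.ne_zero
  have n1 := hq.one_sub_pow_ne (l + (n + 1))
  have n3 := hq.one_sub_pow_ne (l + 1 + (n + 1))
  have n4 := pow_sub_pow_ne hq (n := n + 1) (l := l + 1) (by omega)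
  rw [show (r ^ 2) ^ (l + (n + 1) + 1) = r ^ 2 * (r ^ 2) ^ l * (r ^ 2) ^ (n + 1) by ring] at n1
  rw [show (r ^ 2) ^ (l + 1 + (n + 1) + 1) =
    r ^ 2 * (r ^ 2 * (r ^ 2) ^ l) * (r ^ 2) ^ (n + 1) by ring] at n3
  have k0 := additionScale_order h (n := n) (l := l + 1) (by omega)
  have k2 := additionScale_order h (n := n + 1) (l := l + 1) (by omega)
  have F0 := bigQUltra_lower_shift hq h.hw n (l + 1) u
  have G0 := bigQUltra_lower_shift hq h.hx n (l + 1) v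
  have F2 := bigQUltra_raise_shift hq h.hw (n + 1) (l + 1) u
  have G2 := bigQUltra_raise_shift hq h.hx (n + 1) (l + 1) v
  rw [pow_succ' _ l] at n4 n6 k0 k2 F0 G0 F2 G2
  rw [pow_succ' _ (n + 1)] at k2
  have T1 := term_order_pred hr hA hb n1 n2 k0
    (F0.trans (show _ = (r ^ 2) ^ (n + 1) * ((r ^ 2) ^ (n + 1) * ((r ^ 2 * (r ^ 2) ^ l) * (r ^ 2 +
      -(r ^ 2) / s ^ 2) - -(r ^ 2) / s ^ 2 * (1 + r ^ 2 * (r ^ 2 * (r ^ 2) ^ l)) * u) *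
      bigQUltra (r ^ 2) (-(r ^ 2) / s ^ 2) (n + 1) (l + 1) u + (1 - -(r ^ 2) / s ^ 2 * (r ^ 2 *
      (r ^ 2) ^ l)) * bigQUltra (r ^ 2) (-(r ^ 2) / s ^ 2) (n + 1) (l + 2) u) by ring))
    (G0.trans (show _ = (r ^ 2) ^ (n + 1) * ((r ^ 2) ^ (n + 1) * ((r ^ 2 * (r ^ 2) ^ l) * (r ^ 2 +
      -(r ^ 2) / t ^ 2) - -(r ^ 2) / t ^ 2 * (1 + r ^ 2 * (r ^ 2 * (r ^ 2) ^ l)) * v) *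
      bigQUltra (r ^ 2) (-(r ^ 2) / t ^ 2) (n + 1) (l + 1) v + (1 - -(r ^ 2) / t ^ 2 * (r ^ 2 *
      (r ^ 2) ^ l)) * bigQUltra (r ^ 2) (-(r ^ 2) / t ^ 2) (n + 1) (l + 2) v) by ring))
  have T2 := term_order_succ hr hs ht hA hb n3 n2 n4 k2
    ((mul_assoc _ _ _).symm.trans F2) ((mul_assoc _ _ _).symm.trans G2)
  refine additionCoeff_recurrence_of_bilinear h (n := n + 1) hn rfl rfl T1 (Eq.trans ?_ T2)
    (laguerreDiag_eq hr hs ht hA hb n2 _ _) ?_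
  · rw [laguerreSub_eq hr, additionCoeff]
    ring
  · exact bilinear_lower hb n1 n4 n3 n5 n6

theorem additionCoeff_lower_recurrence_self {r s t : ℂ} (h : GenericParams r s t) {n : ℕ}
    {u v : ℂ} :
    additionCoeff r s t n (n + 1) (u * r ^ 2) (v * r ^ 2) +
      laguerreDiag r s t u v *
        additionCoeff r s t (n + 1) (n + 1) u v =
    legendreSuper r (r ^ 2 * (r ^ 2) ^ n) * additionCoeff r s t (n + 1) (n + 2) u v +
      legendreDiag r s t (r ^ 2 * (r ^ 2) ^ n) * additionCoeff r s t (n + 1) (n + 1) u v := by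
  have hq := h.base
  have hr := h.hr
  have hs := h.hs
  have ht := h.ht
  obtain ⟨l, hl⟩ : ∃ l, l = n := ⟨_, rfl⟩
  have hA : r ^ 2 * (r ^ 2) ^ l ≠ 0 := mul_ne_zero hq.ne_zero (pow_ne_zero _ hq.ne_zero)
  have n2 := hq.one_add_pow_ne (l + 1)
  have n5 := hq.one_sub_pow_ne (2 * l + 2)
  have n6 := hq.one_add_pow_ne l
  rw [show (r ^ 2) ^ (l + 1 + 1) = r ^ 2 * (r ^ 2 * (r ^ 2) ^ l) by ring] at n2
  rw [show (r ^ 2) ^ (2 * l + 2 + 1) = r ^ 2 * (r ^ 2 * (r ^ 2) ^ l) ^ 2 by ring] at n5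
  have hb : (r ^ 2) ^ (n + 1) ≠ 0 := pow_ne_zero _ hq.ne_zero
  have n1 := hq.one_sub_pow_ne (l + (n + 1))
  rw [show (r ^ 2) ^ (l + (n + 1) + 1) = r ^ 2 * (r ^ 2) ^ l * (r ^ 2) ^ (n + 1) by ring] at n1
  have n7 : 1 - r ^ 2 ≠ 0 := by simpa using hq.one_sub_pow_ne 0
  have k0 := additionScale_order h (n := n) (l := l + 1) (by omega)
  have F0 := bigQUltra_lower_shift hq h.hw n (l + 1) u
  have G0 := bigQUltra_lower_shift hq h.hx n (l + 1) v
  -- Only a relation between the two degrees at the same `u` is wanted, so plain raising serves even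
  -- in the shifted case.
  have F2 := bigQUltra_raise hq h.hw (n + 1) (l + 1) u
  have G2 := bigQUltra_raise hq h.hx (n + 1) (l + 1) v
  rw [bigQUltra_of_lt _ _ (by omega), mul_zero] at F2 G2
  rw [pow_succ' _ l] at n6 k0 F0 G0 F2 G2
  have T1 := term_order_pred hr hA hb n1 n2 k0
    (F0.trans (show _ = (r ^ 2) ^ (n + 1) * ((r ^ 2) ^ (n + 1) * ((r ^ 2 * (r ^ 2) ^ l) * (r ^ 2 +
      -(r ^ 2) / s ^ 2) - -(r ^ 2) / s ^ 2 * (1 + r ^ 2 * (r ^ 2 * (r ^ 2) ^ l)) * u) *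
      bigQUltra (r ^ 2) (-(r ^ 2) / s ^ 2) (n + 1) (l + 1) u + (1 - -(r ^ 2) / s ^ 2 * (r ^ 2 *
      (r ^ 2) ^ l)) * bigQUltra (r ^ 2) (-(r ^ 2) / s ^ 2) (n + 1) (l + 2) u) by ring))
    (G0.trans (show _ = (r ^ 2) ^ (n + 1) * ((r ^ 2) ^ (n + 1) * ((r ^ 2 * (r ^ 2) ^ l) * (r ^ 2 +
      -(r ^ 2) / t ^ 2) - -(r ^ 2) / t ^ 2 * (1 + r ^ 2 * (r ^ 2 * (r ^ 2) ^ l)) * v) *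
      bigQUltra (r ^ 2) (-(r ^ 2) / t ^ 2) (n + 1) (l + 1) v + (1 - -(r ^ 2) / t ^ 2 * (r ^ 2 *
      (r ^ 2) ^ l)) * bigQUltra (r ^ 2) (-(r ^ 2) / t ^ 2) (n + 1) (l + 2) v) by ring))
  subst hl
  rw [pow_succ' _ l] at *
  have n8 : 1 - (r ^ 2 * (r ^ 2) ^ l) ^ 2 ≠ 0 := by rwa [sq]
  refine additionCoeff_recurrence_of_bilinear_top h l rfl T1
    (laguerreDiag_eq hr hs ht hA hA n2 _ _) (bilinear_top_lower hA n8 n7 n5 n6 ?_ ?_)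
  · refine (mul_eq_zero.1 (?_ : (r ^ 2 * (r ^ 2) ^ l) * _ = 0)).resolve_left hA
    linear_combination -F2
  · refine (mul_eq_zero.1 (?_ : (r ^ 2 * (r ^ 2) ^ l) * _ = 0)).resolve_left hA
    linear_combination -G2

/-! ### Boundary cases and the full difference equation -/

/-- When order equals degree only the term `k = 0` survives, so there is no dependence on `u` and
`v`. -/
theorem additionCoeff_self {r s t : ℂ} (h : GenericParams r s t) (l : ℕ) (u v : ℂ) :
    additionCoeff r s t l l u v =
      qShifted (r ^ 2) (r ^ 2) (l + l) / qShifted (r ^ 2) (r ^ 2) l := by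
  have h1 := h.base.qShifted_ne l
  have h2 := h.base.qShifted_ne (l + l)
  have h3 := qShifted_ne_zero h.hw l
  have h4 := qShifted_ne_zero h.hx l
  have e : ∀ w u : ℂ, bigQUltra (r ^ 2) w l l u = qShifted (r ^ 2) (r ^ 2) (l + l) /
      (qShifted (r ^ 2) (r ^ 2) l * qShifted w (r ^ 2) l) := by
    intro w u
    rw [bigQUltra, Finset.sum_eq_single 0]
    · have := recipQFactorial_natCast (r ^ 2) 0
      simp only [Nat.cast_zero] at this
      simp [bigQUltraCoeff, seriesFactor, qShifted_zero, this]
      ring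
    · intro k _ hk
      rw [bigQUltraCoeff_of_lt _ _ (by omega), zero_mul]
    · simp
  rw [additionCoeff, e, e, additionScale]
  simp only [Nat.sub_self, zero_mul, pow_zero, qShifted_zero, one_mul, mul_one]
  generalize qShifted (-(r ^ 2) / s ^ 2) (r ^ 2) l = A at *
  generalize qShifted (-(r ^ 2) / t ^ 2) (r ^ 2) l = B at *
  field_simp

/-- The outermost coefficient of the difference equation. Both sides are constant, so the arguments
need not match and the lemma serves both sums. -/
theorem additionCoeff_self_succ {r s t : ℂ} (h : GenericParams r s t) (l : ℕ) (u v u' v' : ℂ) :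
    additionCoeff r s t l l u v =
      legendreSuper r ((r ^ 2) ^ l) * additionCoeff r s t (l + 1) (l + 1) u' v' := by
  have h1 := h.base.qShifted_ne l
  have h2 := h.base.one_sub_pow_ne (l + l)
  have h3 := h.base.one_sub_pow_ne l
  have h4 := h.base.one_add_pow_ne l
  rw [pow_succ'] at h2 h3 h4
  rw [show r ^ 2 * (r ^ 2) ^ (l + l) = r ^ 2 * ((r ^ 2) ^ l) ^ 2 by ring] at h2
  rw [additionCoeff_self h, additionCoeff_self h, show l + 1 + (l + 1) = l + l + 1 + 1 by ring,
    qShifted_succ _ _ (l + l + 1), qShifted_succ _ _ (l + l), qShifted_succ _ _ l, legendreSuper,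
    show r ^ 2 * (r ^ 2) ^ (l + l) = r ^ 2 * ((r ^ 2) ^ l) ^ 2 by ring,
    show 1 - r ^ 2 * (r ^ 2) ^ (l + l + 1) =
      (1 - r ^ 2 * (r ^ 2) ^ l) * (1 + r ^ 2 * (r ^ 2) ^ l) by ring]
  generalize 1 - r ^ 2 * ((r ^ 2) ^ l) ^ 2 = A at *
  generalize 1 - r ^ 2 * (r ^ 2) ^ l = B at *
  generalize 1 + r ^ 2 * (r ^ 2) ^ l = C at *
  field_simp

theorem additionCoeff_upper_recurrence {r s t : ℂ} (h : GenericParams r s t) (n l : ℕ) {u v : ℂ}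
    (hu : 1 - -(r ^ 2) / s ^ 2 * u * (r ^ 2) ^ n ≠ 0)
    (hv : 1 - -(r ^ 2) / t ^ 2 * v * (r ^ 2) ^ n ≠ 0) :
    additionCoeff r s t n (l + 1) u v +
      laguerreDiag r s t ((r ^ 2) ^ (n + 1) * u) ((r ^ 2) ^ (n + 1) * v) *
        additionCoeff r s t (n + 1) (l + 1) u v +
      laguerreSub s t ((r ^ 2) ^ (n + 2) * u) ((r ^ 2) ^ (n + 2) * v) *
        additionCoeff r s t (n + 2) (l + 1) u v =
    legendreSuper r (r ^ 2 * (r ^ 2) ^ l) * additionCoeff r s t (n + 1) (l + 2) u v +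
      legendreDiag r s t (r ^ 2 * (r ^ 2) ^ l) * additionCoeff r s t (n + 1) (l + 1) u v +
      legendreSub r s t ((r ^ 2) ^ l) * additionCoeff r s t (n + 1) l u v := by
  rcases lt_trichotomy n l with hn | rfl | hn
  · exact additionCoeff_upper_recurrence_of_lt h hn hu hv
  · rw [additionCoeff_of_lt r s t (n := n + 2) (by omega),
      additionCoeff_of_lt r s t (n := n + 1) (l := n) (by omega), mul_zero, mul_zero, add_zero,
      add_zero]
    exact additionCoeff_upper_recurrence_self h hu hv
  · rw [additionCoeff_of_lt r s t (n := n + 2) (by omega),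
      additionCoeff_of_lt r s t (n := n + 1) (l := l) (by omega),
      additionCoeff_of_lt r s t (n := n + 1) (l := l + 1) (by omega)]
    simp only [mul_zero, add_zero]
    rcases Nat.lt_or_eq_of_le (Nat.succ_le_of_lt hn) with hn | rfl
    · rw [additionCoeff_of_lt r s t (by omega), additionCoeff_of_lt r s t (by omega), mul_zero]
    · rw [← pow_succ']
      exact additionCoeff_self_succ h (l + 1) u v u v

/-- Valid for all `u`, `v`, because `bigQUltra_lower_shift` needs no nonvanishing; the plain version
does. -/
theorem additionCoeff_lower_recurrence {r s t : ℂ} (h : GenericParams r s t) (n l : ℕ) (u v : ℂ) :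
    additionCoeff r s t n (l + 1) (u * r ^ 2) (v * r ^ 2) +
      laguerreDiag r s t u v * additionCoeff r s t (n + 1) (l + 1) u v +
      laguerreSub s t u v * additionCoeff r s t (n + 2) (l + 1) (u / r ^ 2) (v / r ^ 2) =
    legendreSuper r (r ^ 2 * (r ^ 2) ^ l) * additionCoeff r s t (n + 1) (l + 2) u v +
      legendreDiag r s t (r ^ 2 * (r ^ 2) ^ l) * additionCoeff r s t (n + 1) (l + 1) u v +
      legendreSub r s t ((r ^ 2) ^ l) * additionCoeff r s t (n + 1) l u v := by
  rcases lt_trichotomy n l with hn | rfl | hn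
  · exact additionCoeff_lower_recurrence_of_lt h hn
  · rw [additionCoeff_of_lt r s t (n := n + 2) (by omega),
      additionCoeff_of_lt r s t (n := n + 1) (l := n) (by omega), mul_zero, mul_zero, add_zero,
      add_zero]
    exact additionCoeff_lower_recurrence_self h
  · rw [additionCoeff_of_lt r s t (n := n + 2) (by omega),
      additionCoeff_of_lt r s t (n := n + 1) (l := l) (by omega),
      additionCoeff_of_lt r s t (n := n + 1) (l := l + 1) (by omega)]
    simp only [mul_zero, add_zero]
    rcases Nat.lt_or_eq_of_le (Nat.succ_le_of_lt hn) with hn | rfl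
    · rw [additionCoeff_of_lt r s t (by omega), additionCoeff_of_lt r s t (by omega), mul_zero]
    · rw [← pow_succ']
      exact additionCoeff_self_succ h (l + 1) _ _ u v

theorem additionCoeff_zero_zero {r s t : ℂ} (h : GenericParams r s t) (u v : ℂ) :
    additionCoeff r s t 0 0 u v = 1 := by
  rw [additionCoeff_self h, qShifted_zero, div_one]

/-- The start of the induction. Raising from order and degree zero gives zero, which determines the
order zero polynomial of degree one. -/
theorem additionCoeff_zero_one {r s t : ℂ} (h : GenericParams r s t) (u v : ℂ) :
    laguerreDiag r s t u v = legendreSuper r 1 * additionCoeff r s t 0 1 u v +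
      legendreDiag r s t 1 := by
  have hr := h.hr
  have hs := h.hs
  have ht := h.ht
  have h1 : 1 - r ^ 2 ≠ 0 := by simpa using h.base.one_sub_pow_ne 0
  have h2 : 1 + r ^ 2 ≠ 0 := by simpa using h.base.one_add_pow_ne 0
  have key : ∀ w u : ℂ, (∀ k : ℕ, 1 - w * (r ^ 2) ^ k ≠ 0) →
      (1 - w) * bigQUltra (r ^ 2) w 0 1 u = -((r ^ 2 + w) - w * (1 + r ^ 2) * u) := by
    intro w u hw
    have e := bigQUltra_raise h.base hw 0 0 u
    have e0 : bigQUltra (r ^ 2) w 0 0 u = 1 := by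
      have := recipQFactorial_natCast (r ^ 2) 0
      simp only [Nat.cast_zero] at this
      simp [bigQUltra, bigQUltraCoeff, seriesFactor, qShifted_zero, this]
    rw [bigQUltra_of_lt _ _ (by omega), e0] at e
    simp only [pow_zero, mul_one, one_mul, mul_zero, zero_add] at e
    refine mul_left_cancel₀ h1 ?_
    linear_combination -e
  have k1 := key _ u h.hw
  have k2 := key _ v h.hx
  have e : additionScale r s t 0 1 = s * t / r ^ 3 * (1 - r ^ 2) *
      ((1 - -(r ^ 2) / s ^ 2) * (1 - -(r ^ 2) / t ^ 2)) := by
    simp [additionScale, qShifted]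
    field_simp
  rw [additionCoeff, e, show ∀ a b c d f g : ℂ, a * b * (c * d) * f * g = a * b * ((c * f) * (d *
    g))
    by intros; ring, k1, k2, legendreSuper, legendreDiag, laguerreDiag]
  simp only [one_pow, mul_one]
  generalize hA : 1 - r ^ 2 = A at *
  obtain ⟨B, hB⟩ : ∃ B, B = 1 + r ^ 2 := ⟨_, rfl⟩
  rw [← hB] at h2 ⊢
  field_simp
  rw [hB]
  ring

/-! ### The induction on the degree -/

/-- The product of the subdiagonal coefficients of degrees `m, m - 1, …, m - n + 1`. -/
def laguerreSubProd (r s t : ℂ) (m p n : ℕ) : ℂ :=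
  ∏ i ∈ Finset.range n, laguerreSub s t ((r ^ 2) ^ m / (r ^ 2) ^ i) ((r ^ 2) ^ (m +
    p) / (r ^ 2) ^ i)

theorem laguerreSubProd_succ (r s t : ℂ) (m p n : ℕ) :
    laguerreSubProd r s t m p (n + 1) = laguerreSubProd r s t m p n *
      laguerreSub s t ((r ^ 2) ^ m / (r ^ 2) ^ n) ((r ^ 2) ^ (m + p) / (r ^ 2) ^ n) :=
  Finset.prod_range_succ _ _

theorem laguerreSubProd_of_lt {r : ℂ} (hr : r ≠ 0) (s t : ℂ) {m n : ℕ} (p : ℕ) (h : m < n) :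
    laguerreSubProd r s t m p n = 0 := by
  refine Finset.prod_eq_zero (Finset.mem_range.2 h) ?_
  rw [div_self (pow_ne_zero _ (pow_ne_zero _ hr)), laguerreSub]
  ring

/-- The action of a tridiagonal operator on a linear combination of its basis. -/
theorem tridiagonal_action {X : ℂ} {c d up lo G : ℕ → ℂ} {β γ β' γ' : ℕ → ℂ} {β₀ : ℂ} (N : ℕ)
    (hN : c N = 0) (hN' : c (N + 1) = 0) (hd : d 0 = c 0) (hdN : d N = 0) (hdN' : d (N + 1) = 0)
    (h0 : X * up 0 = up 1 + β₀ * up 0 + G 1 * lo 1)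
    (hup : ∀ n, X * up (n + 1) = up (n + 2) + β (n + 1) * up (n + 1) + γ (n + 1) * up n)
    (hlo : ∀ n, G (n + 1) * (X * lo (n + 1)) =
      G (n + 1) * (lo n + β' (n + 1) * lo (n + 1)) + G (n + 2) * lo (n + 2))
    (hG : ∀ n, G (n + 2) = G (n + 1) * γ' (n + 1)) (hl0 : lo 0 = up 0) :
    X * (c 0 * up 0 + ∑ n ∈ Finset.range N, c (n + 1) * up (n + 1) +
        ∑ n ∈ Finset.range N, G (n + 1) * d (n + 1) * lo (n + 1)) =
      (G 1 * d 1 + β₀ * c 0 + γ 1 * c 1) * up 0 +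
      ∑ n ∈ Finset.range N, (c n + β (n + 1) * c (n + 1) + γ (n + 2) * c (n + 2)) * up (n + 1) +
      ∑ n ∈ Finset.range N, G (n + 1) * (d n + β' (n + 1) * d (n + 1) + γ' (n + 1) * d (n + 2)) *
        lo (n + 1) := by
  -- Summation by parts: regrouping by basis element leaves a difference in `n`, whose end at `N`
  -- vanishes while the end at `0` feeds the coefficient of `up 0`.
  have e1 : ∑ n ∈ Finset.range N, X * (c (n + 1) * up (n + 1)) =
      ∑ n ∈ Finset.range N, ((c n + β (n + 1) * c (n + 1) + γ (n + 2) * c (n + 2)) * up (n + 1) +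
        ((c (n + 1) * up (n + 2) - γ (n + 2) * c (n + 2) * up (n + 1)) -
          (c n * up (n + 1) - γ (n + 1) * c (n + 1) * up n))) :=
    Finset.sum_congr rfl fun n _ => by linear_combination c (n + 1) * hup n
  have e2 : ∑ n ∈ Finset.range N, X * (G (n + 1) * d (n + 1) * lo (n + 1)) =
      ∑ n ∈ Finset.range N, (G (n + 1) * (d n + β' (n + 1) * d (n + 1) + γ' (n + 1) * d (n + 2)) *
        lo (n + 1) + ((d (n + 1) * G (n + 2) * lo (n + 2) - G (n + 2) * d (n + 2) * lo (n + 1)) -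
          (d n * G (n + 1) * lo (n + 1) - G (n + 1) * d (n + 1) * lo n))) :=
    Finset.sum_congr rfl fun n _ => by
      linear_combination d (n + 1) * hlo n + d (n + 2) * lo (n + 1) * hG n
  rw [mul_add, mul_add, Finset.mul_sum, Finset.mul_sum, e1, e2, Finset.sum_add_distrib,
    Finset.sum_add_distrib,
    Finset.sum_range_sub (fun n => c n * up (n + 1) - γ (n + 1) * c (n + 1) * up n),
    Finset.sum_range_sub (fun n => d n * G (n + 1) * lo (n + 1) - G (n + 1) * d (n + 1) * lo n),
    hN, hN', hdN, hdN', hd, hl0]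
  linear_combination c 0 * h0

/-- The sums may have any length `N ≥ l`, the added terms being zero; the inductive step can then
compare degrees `l`, `l + 1`, `l + 2` over the same range. -/
theorem addition_formula_of_recurrences {r s t X : ℂ} (h : GenericParams r s t) (p : ℕ)
    {P L : ℕ → ℂ} (hP0 : P 0 = 1)
    (hP1 : X * P 0 = legendreSuper r 1 * P 1 + legendreDiag r s t 1 * P 0)
    (hP : ∀ l, X * P (l + 1) = legendreSuper r (r ^ 2 * (r ^ 2) ^ l) * P (l + 2) +
      legendreDiag r s t (r ^ 2 * (r ^ 2) ^ l) * P (l + 1) + legendreSub r s t ((r ^ 2) ^ l) * P l)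
    (hL : ∀ m, X * L m = L (m + 1) + laguerreDiag r s t ((r ^ 2) ^ m) ((r ^ 2) ^ (m + p)) * L m +
      laguerreSub s t ((r ^ 2) ^ m) ((r ^ 2) ^ (m + p)) * L (m - 1)) (m l : ℕ) :
    ∀ N, l ≤ N → P l * L m =
      additionCoeff r s t 0 l ((r ^ 2) ^ m) ((r ^ 2) ^ (m + p)) * L m +
      ∑ n ∈ Finset.range N,
        additionCoeff r s t (n + 1) l ((r ^ 2) ^ m) ((r ^ 2) ^ (m + p)) * L (m + (n + 1)) +
      ∑ n ∈ Finset.range N, laguerreSubProd r s t m p (n + 1) *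
        additionCoeff r s t (n + 1) l ((r ^ 2) ^ m / (r ^ 2) ^ (n + 1))
          ((r ^ 2) ^ (m + p) / (r ^ 2) ^ (n + 1)) * L (m - (n + 1)) := by
  have hr := h.hr
  have hq0 := h.base.ne_zero
  -- This permits solving the Legendre recurrence for the highest degree.
  have super_ne : ∀ l : ℕ, legendreSuper r ((r ^ 2) ^ l) ≠ 0 := by
    intro l
    refine one_div_ne_zero (mul_ne_zero ?_ ?_)
    · have := h.base.one_sub_pow_ne (2 * l)
      rwa [show (r ^ 2) ^ (2 * l + 1) = r ^ 2 * ((r ^ 2) ^ l) ^ 2 by ring] at this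
    · have := h.base.one_add_pow_ne l
      rwa [pow_succ'] at this
  induction l using Nat.twoStepInduction with
  | zero =>
    intro N _
    rw [hP0, additionCoeff_zero_zero h, Finset.sum_eq_zero, Finset.sum_eq_zero]
    · ring
    · intro n _
      rw [additionCoeff_of_lt _ _ _ (by omega)]
      ring
    · intro n _
      rw [additionCoeff_of_lt _ _ _ (by omega)]
      ring
  | one =>
    intro N hN
    refine mul_left_cancel₀ (super_ne 0) ?_
    rw [pow_zero]
    obtain ⟨N, rfl⟩ := Nat.exists_eq_add_of_le' hN
    rw [Finset.sum_range_succ', Finset.sum_range_succ', Finset.sum_eq_zero, Finset.sum_eq_zero]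
    · have e1 := additionCoeff_self_succ h 0 0 0 ((r ^ 2) ^ m) ((r ^ 2) ^ (m + p))
      have e2 := additionCoeff_self_succ h 0 0 0 ((r ^ 2) ^ m / (r ^ 2) ^ (0 + 1))
          ((r ^ 2) ^ (m + p) / (r ^ 2) ^ (0 + 1))
      have e3 := additionCoeff_zero_one h ((r ^ 2) ^ m) ((r ^ 2) ^ (m + p))
      rw [additionCoeff_zero_zero h, pow_zero] at e1 e2
      rw [laguerreSubProd_succ, laguerreSubProd, Finset.prod_range_zero, pow_zero, div_one, div_one,
        one_mul]
      rw [hP0] at hP1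
      simp only [zero_add] at e1 e2 ⊢
      linear_combination (-L m) * hP1 + hL m + L m * e3 + L (m + 1) * e1 +
        laguerreSub s t ((r ^ 2) ^ m) ((r ^ 2) ^ (m + p)) * L (m - 1) * e2
    · intro n _
      rw [additionCoeff_of_lt _ _ _ (by omega)]
      ring
    · intro n _
      rw [additionCoeff_of_lt _ _ _ (by omega)]
      ring
  | more l ih0 ih1 =>
    intro N hN
    have s_ne := super_ne (l + 1)
    rw [pow_succ'] at s_ne
    refine mul_left_cancel₀ s_ne ?_
    have i0 := ih0 N (by omega)
    have i1 := ih1 N (by omega)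
    have act := tridiagonal_action (X := X)
      (c := fun n => additionCoeff r s t n (l + 1) ((r ^ 2) ^ m) ((r ^ 2) ^ (m + p)))
      (d := fun n => additionCoeff r s t n (l + 1) ((r ^ 2) ^ m / (r ^ 2) ^ n)
        ((r ^ 2) ^ (m + p) / (r ^ 2) ^ n))
      (up := fun n => L (m + n)) (lo := fun n => L (m - n)) (G := laguerreSubProd r s t m p)
      (β := fun n => laguerreDiag r s t ((r ^ 2) ^ n * (r ^ 2) ^ m) ((r ^ 2) ^ n * (r ^ 2) ^ (m +
        p)))
      (γ := fun n => laguerreSub s t ((r ^ 2) ^ n * (r ^ 2) ^ m) ((r ^ 2) ^ n * (r ^ 2) ^ (m + p)))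
      (β' := fun n => laguerreDiag r s t ((r ^ 2) ^ m / (r ^ 2) ^ n) ((r ^ 2) ^ (m +
        p) / (r ^ 2) ^ n))
      (γ' := fun n => laguerreSub s t ((r ^ 2) ^ m / (r ^ 2) ^ n) ((r ^ 2) ^ (m + p) / (r ^ 2) ^ n))
      (β₀ := laguerreDiag r s t ((r ^ 2) ^ m) ((r ^ 2) ^ (m + p))) N
      (additionCoeff_of_lt _ _ _ (by omega) _ _) (additionCoeff_of_lt _ _ _ (by omega) _ _)
      (by simp) (additionCoeff_of_lt _ _ _ (by omega) _ _) (additionCoeff_of_lt _ _ _ (by omega) _ _)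
      ?_ ?_ ?_ (fun n => laguerreSubProd_succ ..) rfl
    · have G1 : laguerreSubProd r s t m p 1 = laguerreSub s t ((r ^ 2) ^ m) ((r ^ 2) ^ (m +
      p)) := by
        simp [laguerreSubProd]
      have A0 := additionCoeff_zero_recurrence h l ((r ^ 2) ^ m) ((r ^ 2) ^ (m + p))
      have A1 : ∑ n ∈ Finset.range N, (additionCoeff r s t n (l + 1) ((r ^ 2) ^ m) ((r ^ 2) ^ (m +
        p)) +
          laguerreDiag r s t ((r ^ 2) ^ (n + 1) * (r ^ 2) ^ m)
            ((r ^ 2) ^ (n + 1) * (r ^ 2) ^ (m + p)) * additionCoeff r s t (n + 1) (l +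
              1) ((r ^ 2) ^ m) ((r ^ 2) ^ (m + p)) +
          laguerreSub s t ((r ^ 2) ^ (n + 2) * (r ^ 2) ^ m)
            ((r ^ 2) ^ (n + 2) * (r ^ 2) ^ (m + p)) * additionCoeff r s t (n + 2) (l +
              1) ((r ^ 2) ^ m) ((r ^ 2) ^ (m + p))) *
          L (m + (n + 1)) =
          legendreSuper r (r ^ 2 * (r ^ 2) ^ l) * ∑ n ∈ Finset.range N,
        additionCoeff r s t (n + 1) (l + 2) ((r ^ 2) ^ m) ((r ^ 2) ^ (m + p)) * L (m + (n + 1)) +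
          legendreDiag r s t (r ^ 2 * (r ^ 2) ^ l) * ∑ n ∈ Finset.range N,
        additionCoeff r s t (n + 1) (l + 1) ((r ^ 2) ^ m) ((r ^ 2) ^ (m + p)) * L (m + (n + 1)) +
          legendreSub r s t ((r ^ 2) ^ l) * ∑ n ∈ Finset.range N,
        additionCoeff r s t (n + 1) l ((r ^ 2) ^ m) ((r ^ 2) ^ (m + p)) * L (m + (n + 1)) := by
        rw [Finset.mul_sum, Finset.mul_sum, Finset.mul_sum, ← Finset.sum_add_distrib,
          ← Finset.sum_add_distrib]
        refine Finset.sum_congr rfl fun n _ => ?_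
        -- With `u = q^m` the required nonvanishing is `hw` at index `m + n`; similarly for `v`.
        rw [additionCoeff_upper_recurrence h n l (by rw [mul_assoc, ← pow_add]; exact h.hw _)
          (by rw [mul_assoc, ← pow_add]; exact h.hx _)]
        ring
      have A2 : ∑ n ∈ Finset.range N, laguerreSubProd r s t m p (n + 1) *
          (additionCoeff r s t n (l + 1) ((r ^ 2) ^ m / (r ^ 2) ^ n) ((r ^ 2) ^ (m +
            p) / (r ^ 2) ^ n) +
          laguerreDiag r s t ((r ^ 2) ^ m / (r ^ 2) ^ (n + 1))
          ((r ^ 2) ^ (m + p) / (r ^ 2) ^ (n + 1)) * additionCoeff r s t (n + 1) (l +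
            1) ((r ^ 2) ^ m / (r ^ 2) ^ (n + 1))
          ((r ^ 2) ^ (m + p) / (r ^ 2) ^ (n + 1)) +
          laguerreSub s t ((r ^ 2) ^ m / (r ^ 2) ^ (n + 1))
          ((r ^ 2) ^ (m + p) / (r ^ 2) ^ (n + 1)) * additionCoeff r s t (n + 2) (l +
            1) ((r ^ 2) ^ m / (r ^ 2) ^ (n + 2))
            ((r ^ 2) ^ (m + p) / (r ^ 2) ^ (n + 2))) * L (m - (n + 1)) =
          legendreSuper r (r ^ 2 * (r ^ 2) ^ l) *
            ∑ n ∈ Finset.range N, laguerreSubProd r s t m p (n + 1) *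
        additionCoeff r s t (n + 1) (l + 2) ((r ^ 2) ^ m / (r ^ 2) ^ (n + 1))
          ((r ^ 2) ^ (m + p) / (r ^ 2) ^ (n + 1)) * L (m - (n + 1)) +
          legendreDiag r s t (r ^ 2 * (r ^ 2) ^ l) *
            ∑ n ∈ Finset.range N, laguerreSubProd r s t m p (n + 1) *
        additionCoeff r s t (n + 1) (l + 1) ((r ^ 2) ^ m / (r ^ 2) ^ (n + 1))
          ((r ^ 2) ^ (m + p) / (r ^ 2) ^ (n + 1)) * L (m - (n + 1)) +
          legendreSub r s t ((r ^ 2) ^ l) * ∑ n ∈ Finset.range N, laguerreSubProd r s t m p (n +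
            1) *
        additionCoeff r s t (n + 1) l ((r ^ 2) ^ m / (r ^ 2) ^ (n + 1))
          ((r ^ 2) ^ (m + p) / (r ^ 2) ^ (n + 1)) * L (m - (n + 1)) := by
        rw [Finset.mul_sum, Finset.mul_sum, Finset.mul_sum, ← Finset.sum_add_distrib,
          ← Finset.sum_add_distrib]
        refine Finset.sum_congr rfl fun n _ => ?_
        have e := additionCoeff_lower_recurrence h n l ((r ^ 2) ^ m / (r ^ 2) ^ (n + 1))
          ((r ^ 2) ^ (m + p) / (r ^ 2) ^ (n + 1))
        have e1 : ∀ x : ℂ, x / (r ^ 2) ^ (n + 1) * r ^ 2 = x / (r ^ 2) ^ n := by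
          intro x; rw [pow_succ]; field_simp
        have e2 : ∀ x : ℂ, x / (r ^ 2) ^ (n + 1) / r ^ 2 = x / (r ^ 2) ^ (n + 2) := by
          intro x; rw [div_div, ← pow_succ]
        rw [e1, e1, e2, e2] at e
        rw [e]
        ring
      simp only [G1, add_zero, pow_one] at act
      -- The two evaluations of `X * P (l+1) * L m`: `hP` on the product, `act` on its expansion.
      -- `A0`, `A1`, `A2` match the terms in `L m`, `L (m + n)` and `L (m - n)`.
      linear_combination (-L m) * hP l + X * i1 - legendreDiag r s t (r ^ 2 * (r ^ 2) ^ l) * i1 -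
        legendreSub r s t ((r ^ 2) ^ l) * i0 + act + L m * A0 + A1 + A2
    · have e := hL m
      simp [laguerreSubProd]
      linear_combination e
    · intro n
      have e := hL (m + (n + 1))
      rw [show m + (n + 1) - 1 = m + n by omega, show m + (n + 1) + p = n + 1 + (m + p) by ring,
        show m + (n + 1) + 1 = m + (n + 2) by ring, add_comm m (n + 1), pow_add _ (n + 1) m,
        pow_add _ (n + 1) (m + p)] at e
      simpa only [add_comm m] using e
    · intro n
      -- Beyond `n = m` the index `m - n` is truncated, but the product of subdiagonal coefficients
      -- already contains a zero factor.
      rcases Nat.lt_or_ge m (n + 1) with hm | hm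
      · rw [laguerreSubProd_of_lt hr s t p hm, laguerreSubProd_of_lt hr s t p (by omega)]
        ring
      · obtain ⟨j, rfl⟩ := Nat.exists_eq_add_of_le' hm
        have e := hL j
        have e1 : (r ^ 2) ^ (j + (n + 1)) / (r ^ 2) ^ (n + 1) = (r ^ 2) ^ j := by
          rw [pow_add _ j]; field_simp
        have e2 : (r ^ 2) ^ (j + (n + 1) + p) / (r ^ 2) ^ (n + 1) = (r ^ 2) ^ (j + p) := by
          rw [show j + (n + 1) + p = j + p + (n + 1) by ring, pow_add _ (j + p)]; field_simp
        rw [laguerreSubProd_succ _ _ _ _ _ (n + 1)]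
        simp only [e1, e2]
        rw [show j + (n + 1) - (n + 1) = j by omega, show j + (n + 1) - n = j + 1 by omega,
          show j + (n + 1) - (n + 2) = j - 1 by omega, e]
        ring

/-! ### The terminating series -/

theorem qShifted_one (a q : ℂ) : qShifted a q 1 = 1 - a := by simp [qShifted]

theorem qShifted_add (a q : ℂ) (m k : ℕ) :
    qShifted a q (m + k) = qShifted a q m * qShifted (a * q ^ m) q k := by
  simp only [qShifted, Finset.prod_range_add, pow_add, mul_assoc]

theorem qShifted_pow_succ {q : ℂ} (hq : GenericBase q) (m k : ℕ) :
    qShifted (q ^ (m + 1)) q k = qShifted q q (m + k) / qShifted q q m := by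
  rw [eq_div_iff (hq.qShifted_ne m), qShifted_add, pow_succ', mul_comm]

/-- The factor `q^k` comes from the argument `z = q` of the series and turns the usual exponent
`k(k-1)/2` into `k(k+1)/2`. Termination is built into `recipQFactorial`. -/
theorem qShifted_neg_pow {q : ℂ} (hq : GenericBase q) (n k : ℕ) :
    qShifted (q ^ (-(n : ℤ))) q k * q ^ k = qShifted q q n *
      ((-1) ^ k * q ^ ((k + 1).choose 2) * (1 / q ^ n) ^ k * recipQFactorial q ((n : ℤ) - k)) := by
  have hq0 := hq.ne_zero
  induction k with
  | zero =>
    have := recipQFactorial_natCast q n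
    simp [qShifted_zero, this, hq.qShifted_ne]
  | succ k ih =>
    have e : (k + 1 + 1).choose 2 = (k + 1).choose 2 + (k + 1) := by
      rw [Nat.choose_succ_succ' (k + 1) 1]; simp; ring
    have e1 := recipQFactorial_eq hq ((n : ℤ) - (k + 1 : ℕ))
    rw [show (n : ℤ) - (k + 1 : ℕ) + 1 = n - k by push_cast; ring, zpow_sub₀ hq0, zpow_natCast,
      zpow_natCast] at e1
    rw [e1, qShifted_succ, pow_succ q k, e, pow_add q, pow_succ (-1 : ℂ), pow_succ (1 / q ^ n),
      show ∀ a b c d : ℂ, a * b * (c * d) = a * c * (b * d) by intros; ring, ih, zpow_neg,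
      zpow_natCast, pow_succ q k]
    field_simp
    ring

theorem basicHypergeometric_terminating {q : ℂ} (hq : GenericBase q) (n : ℕ) (as bs : List ℂ) :
    basicHypergeometric (q ^ (-(n : ℤ)) :: as) bs q q =
      ∑ k ∈ Finset.range (n + 1), qShifted q q n *
        ((-1) ^ k * q ^ ((k + 1).choose 2) * (1 / q ^ n) ^ k * recipQFactorial q ((n : ℤ) - k)) *
        qShiftedList as q k / qShiftedList (q :: bs) q k := by
  have key : ∀ k : ℕ, qShiftedList (q ^ (-(n : ℤ)) :: as) q k / qShiftedList (q :: bs) q k * q ^ k =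
      qShifted q q n *
        ((-1) ^ k * q ^ ((k + 1).choose 2) * (1 / q ^ n) ^ k * recipQFactorial q ((n : ℤ) - k)) *
        qShiftedList as q k / qShiftedList (q :: bs) q k := by
    intro k
    rw [← qShifted_neg_pow hq]
    simp only [qShiftedList, List.map_cons, List.prod_cons]
    ring
  unfold basicHypergeometric
  simp only [key]
  refine tsum_eq_sum fun k hk => ?_
  rw [recipQFactorial_of_neg q (by simp at hk; omega)]
  ring

/-- The basis `(a e^{iθ}, a e^{-iθ}; q)_k` of the polynomials in `cos θ`. -/
def askeyBasis (q a θ : ℂ) (k : ℕ) : ℂ :=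
  qShifted (a * Complex.exp (Complex.I * θ)) q k * qShifted (a * Complex.exp (-(Complex.I * θ))) q k

theorem askeyBasis_zero (q a θ : ℂ) : askeyBasis q a θ 0 = 1 := by
  simp [askeyBasis, qShifted_zero]

theorem askeyBasis_succ (q a θ : ℂ) (k : ℕ) :
    askeyBasis q a θ (k + 1) = askeyBasis q a θ k *
      (1 - 2 * Complex.cos θ * (a * q ^ k) + (a * q ^ k) ^ 2) := by
  have h1 : Complex.exp (Complex.I * θ) * Complex.exp (-(Complex.I * θ)) = 1 := by
    rw [← Complex.exp_add]; simp
  have h2 : 2 * Complex.cos θ = Complex.exp (Complex.I * θ) + Complex.exp (-(Complex.I * θ)) := by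
    rw [Complex.two_cos, mul_comm θ, neg_mul, mul_comm θ]
  rw [askeyBasis, askeyBasis, qShifted_succ, qShifted_succ, h2]
  generalize Complex.exp (Complex.I * θ) = e at *
  generalize Complex.exp (-(Complex.I * θ)) = f at *
  linear_combination (qShifted (a * e) q k * qShifted (a * f) q k * (a * q ^ k) ^ 2) * h1

/-- The conditions force `ABCD = q²`, so the second numerator parameter is `q^(l+1)`; with `AB = q`
the coefficients become those of `bigQUltraCoeff` at order zero. -/
theorem askeyWilson_legendre {q A B C D y z : ℂ} (hq : GenericBase q) (hAB : A * B = q)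
    (hy : A * C = y) (hz : A * D = z) (hyz : y * z = q * A ^ 2) (hA : A ≠ 0) (l : ℕ) (θ : ℂ) :
    askeyWilson l (Complex.cos θ) A B C D q = A ^ (-(l : ℤ)) *
      (qShifted q q l * qShifted y q l * qShifted z q l) *
      legendreSeries q y z (askeyBasis q A θ) l := by
  have hABCD : A * B * C * D = q ^ 2 := by
    have : A ^ 2 * (A * B * C * D) = A ^ 2 * q ^ 2 := by
      rw [show A ^ 2 * (A * B * C * D) = (A * B) * ((A * C) * (A * D)) by ring, hAB, hy, hz, hyz]
      ring
    exact mul_left_cancel₀ (pow_ne_zero 2 hA) this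
  have e : q ^ 2 * q ^ ((l : ℤ) - 1) = q ^ (l + 1) := by
    rw [← zpow_natCast, ← zpow_natCast, ← zpow_add₀ hq.ne_zero]
    congr 1
    push_cast
    ring
  rw [askeyWilson_cos, askeyWilsonAngle, basicHypergeometric_terminating hq, hABCD, e, hAB, hy, hz]
  congr 1
  · simp [qShiftedList, mul_assoc]
  · refine Finset.sum_congr rfl fun k _ => ?_
    have h1 := hq.qShifted_ne l
    simp only [qShiftedList, List.map_cons, List.map_nil, List.prod_cons, List.prod_nil, mul_one,
      bigQUltraCoeff, seriesFactor, qShifted_pow_succ hq, askeyBasis, pow_zero, add_zero, zero_add,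
      Nat.cast_zero, sub_zero]
    generalize (1 / q ^ l) ^ k = c₁
    generalize recipQFactorial q ((l : ℤ) - k) = c₂
    generalize (-1) ^ k * q ^ ((k + 1).choose 2) = c₃
    generalize qShifted q q l = c₄ at *
    rw [show ∀ x y z w : ℂ, c₄ * x * (y / c₄ * z) / w = c₄ / c₄ * (x * y * z / w) by intros; ring,
      div_self h1]
    ring

theorem askeyWilson_laguerre {q A B C y z : ℂ} (hq : GenericBase q) (hy : A * B = y)
    (hz : A * C = z) (m : ℕ) (θ : ℂ) :
    askeyWilson m (Complex.cos θ) A B C 0 q = A ^ (-(m : ℤ)) *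
      (qShifted y q m * qShifted z q m) * qShifted q q m *
      laguerreSeries q y z (askeyBasis q A θ) m := by
  have e : ∀ k, qShifted 0 q k = 1 := by simp [qShifted]
  rw [askeyWilson_cos, askeyWilsonAngle, basicHypergeometric_terminating hq, hy, hz, mul_zero,
    mul_zero, zero_mul, mul_assoc (A ^ (-(m : ℤ)) * _)]
  congr 1
  · simp [qShiftedList, e]
  · rw [laguerreSeries, Finset.mul_sum]
    refine Finset.sum_congr rfl fun k _ => ?_
    simp only [qShiftedList, List.map_cons, List.map_nil, List.prod_cons, List.prod_nil, mul_one,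
      laguerreCoeff, askeyBasis, e]
    ring

theorem three_phi_two_eq_bigQUltra {q w : ℂ} (hq : GenericBase q)
    (hw : ∀ k : ℕ, 1 - w * q ^ k ≠ 0) {n l : ℕ} (hn : n ≤ l) (u : ℂ) :
    basicHypergeometric [q ^ (-((l - n : ℕ) : ℤ)), q ^ (l + n + 1), w * u * q ^ n]
        [q ^ (n + 1), w * q ^ n] q q =
      qShifted q q (l - n) * qShifted q q n * qShifted w q n / qShifted q q (l + n) *
        bigQUltra q w n l u := by
  have hq0 := hq.ne_zero
  obtain ⟨j, rfl⟩ := Nat.exists_eq_add_of_le hn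
  rw [basicHypergeometric_terminating hq, bigQUltra, Finset.mul_sum,
    show n + j - n = j by omega]
  -- `bigQUltra` sums up to `l` for every order; the terms with `k > l - n` are zero.
  have hsub : Finset.range (j + 1) ⊆ Finset.range (n + j + 1) := Finset.range_mono (by omega)
  rw [← Finset.sum_subset hsub]
  · refine Finset.sum_congr rfl fun k _ => ?_
    have h1 := hq.qShifted_ne k
    have h2 := hq.qShifted_ne (n + k)
    have h3 := hq.qShifted_ne n
    have h4 := hq.qShifted_ne (n + j + n)
    have h5 := qShifted_ne_zero hw n
    have h6 := qShifted_ne_zero hw (n + k)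
    have e : qShifted (w * q ^ n) q k = qShifted w q (n + k) / qShifted w q n := by
      rw [eq_div_iff h5, qShifted_add, mul_comm]
    have e1 : q ^ n / q ^ (n + j) = 1 / q ^ j := by rw [pow_add]; field_simp
    simp only [qShiftedList, List.map_cons, List.map_nil, List.prod_cons, List.prod_nil, mul_one,
      bigQUltraCoeff, seriesFactor, qShifted_pow_succ hq, e, e1]
    rw [show ((n + j : ℕ) : ℤ) - n - k = j - k by push_cast; ring]
    field_simp
  · intro k _ hk
    rw [bigQUltraCoeff_of_lt q w (by simp at hk; omega)]
    ring

/-! ### The recurrences of the `q`-Legendre and `q`-Laguerre polynomials -/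

theorem zpow_neg_natCast_succ {A : ℂ} (hA : A ≠ 0) (n : ℕ) :
    A ^ (-((n + 1 : ℕ) : ℤ)) = A ^ (-(n : ℤ)) * A⁻¹ := by
  rw [Nat.cast_add, neg_add, zpow_add₀ hA, Nat.cast_one, zpow_neg_one]

/-- The `q`-Legendre polynomials at `cos θ`, in terms of their series. -/
def legendrePoly (r s t θ : ℂ) (l : ℕ) : ℂ :=
  (r * s / t) ^ (-(l : ℤ)) * (qShifted (r ^ 2) (r ^ 2) l *
    qShifted (-(r ^ 2) / t ^ 2) (r ^ 2) l * qShifted (-(r ^ 2 * s ^ 2)) (r ^ 2) l) *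
    legendreSeries (r ^ 2) (-(r ^ 2) / t ^ 2) (-(r ^ 2 * s ^ 2)) (askeyBasis (r ^ 2) (r *
      s / t) θ) l

theorem legendrePoly_zero (r s t θ : ℂ) : legendrePoly r s t θ 0 = 1 := by
  simp [legendrePoly, qShifted_zero, legendreSeries_zero _ _ (askeyBasis_zero _ _ _)]

theorem legendrePoly_one_recurrence {r s t : ℂ} (h : GenericParams r s t)
    (hz : ∀ k : ℕ, 1 - -(r ^ 2 * s ^ 2) * (r ^ 2) ^ k ≠ 0) (θ : ℂ) :
    2 * Complex.cos θ * legendrePoly r s t θ 0 =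
      legendreSuper r 1 * legendrePoly r s t θ 1 + legendreDiag r s t 1 *
        legendrePoly r s t θ 0 := by
  have hr := h.hr
  have hs := h.hs
  have ht := h.ht
  have h1 : 1 - r ^ 2 ≠ 0 := by simpa using h.base.one_sub_pow_ne 0
  have h2 : 1 + r ^ 2 ≠ 0 := by simpa using h.base.one_add_pow_ne 0
  have h3 : 1 - -(r ^ 2) / t ^ 2 ≠ 0 := by simpa using h.hx 0
  have h4 : 1 - -(r ^ 2 * s ^ 2) ≠ 0 := by simpa using hz 0
  rw [legendrePoly_zero, legendrePoly, legendreSeries_one h.base (askeyBasis_zero _ _ _),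
    askeyBasis_succ _ _ _ 0, askeyBasis_zero, qShifted_one, qShifted_one, qShifted_one,
    legendreSuper, legendreDiag]
  simp only [Nat.cast_one, zpow_neg, zpow_one, pow_zero, mul_one, one_mul, one_pow]
  have e : ∀ c : ℂ, (1 - r ^ 2) * (1 - -(r ^ 2) / t ^ 2) * (1 - -(r ^ 2 * s ^ 2)) *
      (1 - (1 + r ^ 2) / ((1 - -(r ^ 2) / t ^ 2) * (1 - -(r ^ 2 * s ^ 2))) * c) =
      (1 - r ^ 2) * ((1 - -(r ^ 2) / t ^ 2) * (1 - -(r ^ 2 * s ^ 2)) - (1 + r ^ 2) * c) := by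
    intro c
    generalize 1 - -(r ^ 2) / t ^ 2 = A at *
    generalize 1 - -(r ^ 2 * s ^ 2) = B at *
    field_simp
  rw [mul_assoc (r * s / t)⁻¹, e]
  generalize 1 - r ^ 2 = A at *
  obtain ⟨B, hB⟩ : ∃ B, B = 1 + r ^ 2 := ⟨_, rfl⟩
  rw [← hB] at h2 ⊢
  field_simp
  rw [hB]
  ring

theorem legendrePoly_recurrence {r s t : ℂ} (h : GenericParams r s t)
    (hz : ∀ k : ℕ, 1 - -(r ^ 2 * s ^ 2) * (r ^ 2) ^ k ≠ 0) (θ : ℂ) (l : ℕ) :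
    2 * Complex.cos θ * legendrePoly r s t θ (l + 1) =
      legendreSuper r (r ^ 2 * (r ^ 2) ^ l) * legendrePoly r s t θ (l + 2) +
      legendreDiag r s t (r ^ 2 * (r ^ 2) ^ l) * legendrePoly r s t θ (l + 1) +
      legendreSub r s t ((r ^ 2) ^ l) * legendrePoly r s t θ l := by
  have hr := h.hr
  have hs := h.hs
  have ht := h.ht
  have hA : r * s / t ≠ 0 := by simp [hr, hs, ht]
  have hrec := legendreSeries_recurrence (X := 2 * Complex.cos θ) h.base h.hx hz hA
    (by field_simp) (askeyBasis_succ (r ^ 2) (r * s / t) θ) l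
  have n1 := h.base.one_sub_pow_ne (2 * l + 2)
  have n2 := h.base.one_add_pow_ne (l + 1)
  have n3 := h.base.one_add_pow_ne l
  rw [show (r ^ 2) ^ (2 * l + 2 + 1) = (r ^ 2) ^ 3 * ((r ^ 2) ^ l) ^ 2 by ring] at n1
  rw [show (r ^ 2) ^ (l + 1 + 1) = (r ^ 2) ^ 2 * (r ^ 2) ^ l by ring] at n2
  rw [pow_succ'] at n3
  have z1 : (r * s / t) ^ (-((l + 1 : ℕ) : ℤ)) = (r * s / t) ^ (-(l : ℤ)) * (t / (r * s)) := by
    rw [zpow_neg_natCast_succ hA, inv_div]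
  have z2 : (r * s / t) ^ (-((l + 2 : ℕ) : ℤ)) = (r * s / t) ^ (-(l : ℤ)) * (t / (r * s)) ^ 2 := by
    rw [zpow_neg_natCast_succ hA, zpow_neg_natCast_succ hA, inv_div]
    ring
  unfold legendrePoly
  rw [z1, z2]
  simp only [qShifted_succ, pow_succ' _ l]
  generalize legendreSeries (r ^ 2) _ _ _ l = V₀ at *
  generalize legendreSeries (r ^ 2) _ _ _ (l + 1) = V₁ at *
  generalize legendreSeries (r ^ 2) _ _ _ (l + 2) = V₂ at *
  generalize (r * s / t) ^ (-(l : ℤ)) = N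
  generalize qShifted (r ^ 2) (r ^ 2) l = q₁
  generalize qShifted (-(r ^ 2) / t ^ 2) (r ^ 2) l = q₂
  generalize qShifted (-(r ^ 2 * s ^ 2)) (r ^ 2) l = q₃
  generalize 2 * Complex.cos θ = X at *
  generalize (r ^ 2) ^ l = a at *
  have e : X * V₁ = (r * s / t + (r * s / t)⁻¹) * V₁ + (X - r * s / t - (r * s / t)⁻¹) * V₁ := by
    ring
  rw [show ∀ c : ℂ, X * (N * (t / (r * s)) * c * V₁) = N * (t / (r * s)) * c * (X * V₁) by
    intro c; ring, e, hrec]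
  clear hrec e
  unfold legendreSuper legendreDiag legendreSub
  rw [show 1 - r ^ 2 * (r ^ 2 * a) ^ 2 = 1 - (r ^ 2) ^ 3 * a ^ 2 by ring,
    show 1 + r ^ 2 * (r ^ 2 * a) = 1 + (r ^ 2) ^ 2 * a by ring]
  obtain ⟨A, hA⟩ : ∃ A, A = 1 - (r ^ 2) ^ 3 * a ^ 2 := ⟨_, rfl⟩
  obtain ⟨B, hB⟩ : ∃ A, A = 1 + (r ^ 2) ^ 2 * a := ⟨_, rfl⟩
  obtain ⟨C, hC⟩ : ∃ A, A = 1 + r ^ 2 * a := ⟨_, rfl⟩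
  rw [← hA] at n1 ⊢
  rw [← hB] at n2 ⊢
  rw [← hC] at n3 ⊢
  field_simp
  rw [hA, hB, hC]
  ring

/-- The `q`-Laguerre polynomials at `cos θ`, in terms of their series. -/
def laguerrePoly (r s t θ : ℂ) (p m : ℕ) : ℂ :=
  (r * (r ^ 2) ^ p * s / t) ^ (-(m : ℤ)) * (qShifted ((r ^ 2) ^ (p + 1)) (r ^ 2) m *
    qShifted (-((r ^ 2) ^ (p + 1)) / t ^ 2) (r ^ 2) m) * qShifted (r ^ 2) (r ^ 2) m *
    laguerreSeries (r ^ 2) ((r ^ 2) ^ (p + 1)) (-((r ^ 2) ^ (p + 1)) / t ^ 2)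
      (askeyBasis (r ^ 2) (r * (r ^ 2) ^ p * s / t) θ) m

theorem laguerrePoly_recurrence {r s t : ℂ} (h : GenericParams r s t) (θ : ℂ) (p m : ℕ) :
    2 * Complex.cos θ * laguerrePoly r s t θ p m = laguerrePoly r s t θ p (m + 1) +
      laguerreDiag r s t ((r ^ 2) ^ m) ((r ^ 2) ^ (m + p)) * laguerrePoly r s t θ p m +
      laguerreSub s t ((r ^ 2) ^ m) ((r ^ 2) ^ (m + p)) * laguerrePoly r s t θ p (m - 1) := by
  have hr := h.hr
  have hs := h.hs
  have ht := h.ht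
  have hp : (r ^ 2) ^ p ≠ 0 := pow_ne_zero _ h.base.ne_zero
  have hA : r * (r ^ 2) ^ p * s / t ≠ 0 := by simp [hr, hs, ht]
  have hy : ∀ k : ℕ, 1 - (r ^ 2) ^ (p + 1) * (r ^ 2) ^ k ≠ 0 := by
    intro k
    rw [← pow_add, show p + 1 + k = p + k + 1 by ring]
    exact h.base.one_sub_pow_ne _
  have hz : ∀ k : ℕ, 1 - -((r ^ 2) ^ (p + 1)) / t ^ 2 * (r ^ 2) ^ k ≠ 0 := by
    intro k
    have := h.hx (p + k)
    rwa [show -(r ^ 2) / t ^ 2 * (r ^ 2) ^ (p + k) =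
      -((r ^ 2) ^ (p + 1)) / t ^ 2 * (r ^ 2) ^ k by ring] at this
  rcases m with _ | m
  · have h1 := hy 0
    have h2 := hz 0
    rw [pow_zero, mul_one] at h1 h2
    have e := laguerreSeries_one (y := (r ^ 2) ^ (p + 1)) (z := -((r ^ 2) ^ (p + 1)) / t ^ 2) h.base
      (askeyBasis_zero (r ^ 2) (r * (r ^ 2) ^ p * s / t) θ)
    rw [askeyBasis_succ _ _ _ 0, askeyBasis_zero] at e
    -- The factor `1 - q^0` removes the lower neighbour at `m = 0`, so the truncated index `m - 1`
    -- is harmless.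
    have e0 : laguerreSub s t ((r ^ 2) ^ 0) ((r ^ 2) ^ (0 + p)) = 0 := by
      rw [laguerreSub]; ring
    rw [e0, laguerrePoly, laguerrePoly, laguerreSeries_zero _ _ (askeyBasis_zero _ _ _),
      zpow_neg_natCast_succ hA]
    simp only [qShifted_zero, zero_add, qShifted_one, Nat.cast_zero, neg_zero, zpow_zero,
      add_zero, mul_one, one_mul, pow_zero] at e ⊢
    rw [mul_assoc _ (1 - r ^ 2), e, mul_assoc _ _ (1 - 1 / _ * _), mul_sub,
      show ∀ a b c : ℂ, a * b * (1 / (a * b) * c) = a * b * (a * b)⁻¹ * c by intros; ring,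
      mul_inv_cancel₀ (mul_ne_zero h1 h2), laguerreDiag, pow_succ']
    clear e e0 h1 h2 hy hz hA
    generalize (r ^ 2) ^ p = π at *
    field_simp
    ring
  · have hrec := laguerreSeries_recurrence (X := 2 * Complex.cos θ) h.base hy hz hA
      (askeyBasis_succ (r ^ 2) (r * (r ^ 2) ^ p * s / t) θ) m
    rw [Nat.add_sub_cancel]
    unfold laguerrePoly
    rw [zpow_neg_natCast_succ hA (m + 1), zpow_neg_natCast_succ hA m]
    simp only [qShifted_succ]
    rw [show (r ^ 2) ^ (m + 1 + p) = r ^ 2 * (r ^ 2) ^ m * (r ^ 2) ^ p by ring]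
    simp only [pow_succ' _ p, pow_succ' _ m] at hrec ⊢
    clear hy hz
    generalize laguerreSeries (r ^ 2) _ _ _ m = V₀ at *
    generalize laguerreSeries (r ^ 2) _ _ _ (m + 1) = V₁ at *
    generalize laguerreSeries (r ^ 2) _ _ _ (m + 2) = V₂ at *
    generalize (r * (r ^ 2) ^ p * s / t) ^ (-(m : ℤ)) = N
    generalize qShifted (r ^ 2) (r ^ 2) m = q₁
    generalize qShifted (r ^ 2 * (r ^ 2) ^ p) (r ^ 2) m = q₂
    generalize qShifted (-(r ^ 2 * (r ^ 2) ^ p) / t ^ 2) (r ^ 2) m = q₃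
    generalize 2 * Complex.cos θ = X at *
    generalize (r ^ 2) ^ m = a at *
    generalize (r ^ 2) ^ p = π at *
    have e : ∀ A b c R : ℂ, (X - A - A⁻¹ + b + c) * V₁ = R →
        X * V₁ = R + (A + A⁻¹ - b - c) * V₁ := by
      intro A b c R hR; linear_combination hR
    rw [show ∀ c d : ℂ, X * (N * (r * π * s / t)⁻¹ * c * d * V₁) =
      N * (r * π * s / t)⁻¹ * c * d * (X * V₁) by intros; ring, e _ _ _ _ hrec]
    clear hrec e
    unfold laguerreDiag laguerreSub
    field_simp
    ring

/-! ### The constants -/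

/-- Reversal of a shifted factorial: each factor `1 + t² q^(-i)` is `t² q^(-i) (1 + q^i / t²)`, for
`i` from `n + 1` to `n + j`. -/
theorem qShifted_neg_div_pow {r t : ℂ} (h : ∀ k : ℕ, 1 - -(r ^ 2) / t ^ 2 * (r ^ 2) ^ k ≠ 0)
    (hr : r ≠ 0) (ht : t ≠ 0) (n j : ℕ) :
    qShifted (-(t ^ 2 / (r ^ 2) ^ (n + j))) (r ^ 2) j = (t ^ 2) ^ j * (r⁻¹) ^ (j * (2 * n + j +
      1)) *
      (qShifted (-(r ^ 2) / t ^ 2) (r ^ 2) (n + j) / qShifted (-(r ^ 2) / t ^ 2) (r ^ 2) n) := by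
  have h0 := qShifted_ne_zero h n
  induction j with
  | zero => simp [qShifted_zero, h0]
  | succ j ih =>
    have e : -(t ^ 2 / (r ^ 2) ^ (n + (j + 1))) * r ^ 2 = -(t ^ 2 / (r ^ 2) ^ (n + j)) := by
      rw [← add_assoc, pow_succ]; field_simp; ring
    rw [qShifted_succ', e, ih, ← add_assoc, qShifted_succ,
      show (r⁻¹) ^ ((j + 1) * (2 * n + (j + 1) + 1)) =
        (r⁻¹) ^ (j * (2 * n + j + 1)) * ((r⁻¹) ^ 2) ^ (n + j + 1) by
        rw [← pow_mul, ← pow_add]; congr 1; ring]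
    generalize qShifted (-(r ^ 2) / t ^ 2) (r ^ 2) (n + j) = A
    generalize qShifted (-(r ^ 2) / t ^ 2) (r ^ 2) n = B at *
    generalize (r⁻¹) ^ (j * (2 * n + j + 1)) = C
    rw [inv_pow, inv_pow, pow_succ (r ^ 2), pow_succ (t ^ 2)]
    have hp : (r ^ 2) ^ (n + j) ≠ 0 := by simp [hr]
    generalize (r ^ 2) ^ (n + j) = P at *
    field_simp
    ring

/-- Matches the constant of the theorem, times the two normalizations from
`three_phi_two_eq_bigQUltra`, with `additionScale`. The reversed factorials supply the powers of
`s`, `t` and `r`. -/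
theorem additionCoeff_eq {r s t : ℂ} (h : GenericParams r s t) {n l : ℕ} (hn : n ≤ l) (u v : ℂ) :
    qShifted (-(t ^ 2 / (r ^ 2) ^ l)) (r ^ 2) (l - n) *
          qShifted (-(s ^ 2 / (r ^ 2) ^ l)) (r ^ 2) (l - n) *
        (qShifted ((r ^ 2) ^ (l - n + 1)) (r ^ 2) n / qShifted (r ^ 2) (r ^ 2) n) *
        qShifted ((r ^ 2) ^ (n + 1)) (r ^ 2) l * (r ^ (l - n) / (s * t)) ^ (l - n) *
      (qShifted (r ^ 2) (r ^ 2) (l - n) * qShifted (r ^ 2) (r ^ 2) n *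
        qShifted (-(r ^ 2) / s ^ 2) (r ^ 2) n / qShifted (r ^ 2) (r ^ 2) (l + n) *
        bigQUltra (r ^ 2) (-(r ^ 2) / s ^ 2) n l u) *
      (qShifted (r ^ 2) (r ^ 2) (l - n) * qShifted (r ^ 2) (r ^ 2) n *
        qShifted (-(r ^ 2) / t ^ 2) (r ^ 2) n / qShifted (r ^ 2) (r ^ 2) (l + n) *
        bigQUltra (r ^ 2) (-(r ^ 2) / t ^ 2) n l v) = additionCoeff r s t n l u v := by
  have hr := h.hr
  have hs := h.hs
  have ht := h.ht
  obtain ⟨j, rfl⟩ := Nat.exists_eq_add_of_le hn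
  have h1 := h.base.qShifted_ne n
  have h2 := h.base.qShifted_ne j
  have h3 := h.base.qShifted_ne (n + j + n)
  have h4 := qShifted_ne_zero h.hw n
  have h5 := qShifted_ne_zero h.hx n
  rw [additionCoeff, additionScale, show n + j - n = j by omega, qShifted_neg_div_pow h.hx hr ht,
    qShifted_neg_div_pow h.hw hr hs, qShifted_pow_succ h.base, qShifted_pow_succ h.base,
    show j + n = n + j by ring, show n + (n + j) = n + j + n by ring,
    show (r⁻¹) ^ (j * (n + j + 3 * n + 2)) = (r⁻¹) ^ (j * (2 * n + j + 1)) *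
      (r⁻¹) ^ (j * (2 * n + j + 1)) * (r ^ j) ^ j by
      rw [inv_pow, inv_pow, ← pow_mul, ← mul_inv, ← pow_add, inv_mul_eq_div, eq_div_iff (by simp [hr]),
        inv_mul_eq_div, div_eq_iff (by simp [hr]), ← pow_add]
      congr 1
      ring, div_pow, mul_pow s t j]
  generalize (r⁻¹) ^ (j * (2 * n + j + 1)) = C
  generalize qShifted (-(r ^ 2) / s ^ 2) (r ^ 2) n = A at *
  generalize qShifted (-(r ^ 2) / t ^ 2) (r ^ 2) n = B at *
  generalize qShifted (-(r ^ 2) / s ^ 2) (r ^ 2) (n + j) = A' at *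
  generalize qShifted (-(r ^ 2) / t ^ 2) (r ^ 2) (n + j) = B' at *
  generalize bigQUltra (r ^ 2) (-(r ^ 2) / s ^ 2) n (n + j) u = f
  generalize bigQUltra (r ^ 2) (-(r ^ 2) / t ^ 2) n (n + j) v = g
  generalize (r ^ j) ^ j = D
  rw [pow_right_comm s 2 j, pow_right_comm t 2 j]
  have hs' : s ^ j ≠ 0 := pow_ne_zero _ hs
  have ht' : t ^ j ≠ 0 := pow_ne_zero _ ht
  generalize s ^ j = S at *
  generalize t ^ j = T at *
  field_simp

theorem laguerreSubProd_eq {r : ℂ} (s t : ℂ) (m p n : ℕ) :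
    qShiftedList [(r ^ 2) ^ m, (r ^ 2) ^ (m + p), -((r ^ 2) ^ (m + p) / t ^ 2),
      -((r ^ 2) ^ m / s ^ 2)] ((r ^ 2)⁻¹) n = laguerreSubProd r s t m p n := by
  simp only [qShiftedList, List.map_cons, List.map_nil, List.prod_cons, List.prod_nil, mul_one,
    qShifted, laguerreSubProd, ← Finset.prod_mul_distrib]
  refine Finset.prod_congr rfl fun i _ => ?_
  rw [laguerreSub, inv_pow]
  ring

/-! ### The polynomials and constants at real parameters -/

theorem ofReal_sqrt_sq {q : ℝ} (hq0 : 0 < q) : ((q ^ (1 / 2 : ℝ) : ℝ) : ℂ) ^ 2 = (q : ℂ) := by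
  rw [← Complex.ofReal_pow, ← Real.rpow_natCast, ← Real.rpow_mul hq0.le]
  norm_num

theorem one_sub_neg_ne_zero {a b : ℝ} (ha : 0 < a) (hb : 0 < b) : 1 - -(a : ℂ) * (b : ℂ) ≠ 0 := by
  have : (1 + a * b : ℝ) ≠ 0 := by positivity
  intro h
  apply this
  exact_mod_cast (by linear_combination h : (1 + a * b : ℂ) = 0)

theorem genericParams_ofReal {r s t : ℝ} (hr : 0 < r) (hr1 : r < 1) (hs : 0 < s) (ht : 0 < t) :
    GenericParams (r : ℂ) (s : ℂ) (t : ℂ) where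
  hr := by exact_mod_cast hr.ne'
  hs := by exact_mod_cast hs.ne'
  ht := by exact_mod_cast ht.ne'
  base := by
    refine ⟨by exact_mod_cast (pow_pos hr 2).ne', fun k => ?_⟩
    rw [← pow_mul]
    exact_mod_cast (pow_lt_one₀ hr.le hr1 (by positivity : 2 * (k + 1) ≠ 0)).ne
  hw := fun k => by
    have := one_sub_neg_ne_zero (a := r ^ 2 / s ^ 2) (b := (r ^ 2) ^ k) (by positivity)
      (by positivity)
    simpa only [neg_div, Complex.ofReal_div, Complex.ofReal_pow] using this
  hx := fun k => by
    have := one_sub_neg_ne_zero (a := r ^ 2 / t ^ 2) (b := (r ^ 2) ^ k) (by positivity)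
      (by positivity)
    simpa only [neg_div, Complex.ofReal_div, Complex.ofReal_pow] using this

theorem qJacobi_zero_zero_cos {q r s t : ℝ} (hr : r = q ^ (1 / 2 : ℝ)) (hq : (q : ℂ) = r ^ 2)
    (h : GenericParams (r : ℂ) (s : ℂ) (t : ℂ)) (l : ℕ) (θ : ℂ) :
    qJacobi l 0 0 (Complex.cos θ) s t q = legendrePoly r s t θ l := by
  have hr0 := h.hr
  have hs := h.hs
  have ht := h.ht
  rw [qJacobi, add_zero, ← hr, hq, legendrePoly]
  push_cast
  exact askeyWilson_legendre h.base (by field_simp) (by field_simp) (by field_simp)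
    (by field_simp) (by simp [hr0, hs, ht]) l θ

theorem qLaguerre_natCast_cos {q r s t : ℝ} (hq0 : 0 < q) (hr : r = q ^ (1 / 2 : ℝ))
    (hq : (q : ℂ) = r ^ 2) (h : GenericParams (r : ℂ) (s : ℂ) (t : ℂ)) (p m : ℕ) (θ : ℂ) :
    qLaguerre m p (Complex.cos θ) s t q = laguerrePoly r s t θ p m := by
  have hr0 := h.hr
  have hs := h.hs
  have ht := h.ht
  rw [qLaguerre, Real.rpow_add hq0, Real.rpow_natCast, ← hr, laguerrePoly]
  push_cast
  rw [hq]
  refine askeyWilson_laguerre h.base ?_ ?_ m θ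
  · field_simp; ring
  · field_simp; ring

theorem bigQJacobi_natCast {q : ℝ} {r s : ℂ} {c : ℝ} (hq : (q : ℂ) = r ^ 2)
    (hc : (c : ℂ) = s ^ 2) (hb : GenericBase (r ^ 2))
    (hw : ∀ k : ℕ, 1 - -(r ^ 2) / s ^ 2 * (r ^ 2) ^ k ≠ 0) {n l : ℕ} (hn : n ≤ l) (u : ℂ) :
    bigQJacobi (l - n) n n (-u) c 1 q =
      qShifted (r ^ 2) (r ^ 2) (l - n) * qShifted (r ^ 2) (r ^ 2) n *
        qShifted (-(r ^ 2) / s ^ 2) (r ^ 2) n / qShifted (r ^ 2) (r ^ 2) (l + n) *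
        bigQUltra (r ^ 2) (-(r ^ 2) / s ^ 2) n l u := by
  rw [← three_phi_two_eq_bigQUltra hb hw hn, bigQJacobi,
    show ((l - n : ℕ) : ℝ) + n + n + 1 = (l + n + 1 : ℕ) by rw [Nat.cast_sub hn]; push_cast; ring,
    show (1 : ℝ) + n = (n + 1 : ℕ) by push_cast; ring,
    show (n : ℝ) + 1 = (n + 1 : ℕ) by push_cast; ring, Real.rpow_natCast, Real.rpow_natCast]
  push_cast
  rw [hq, hc, mul_one, pow_succ (r ^ 2) n, show (r ^ 2) ^ n * r ^ 2 * -u / s ^ 2 =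
    -(r ^ 2) / s ^ 2 * u * (r ^ 2) ^ n by ring, show -((r ^ 2) ^ n * r ^ 2 / s ^ 2) =
    -(r ^ 2) / s ^ 2 * (r ^ 2) ^ n by ring]

theorem ofReal_rpow_two_mul {q : ℝ} (hq0 : 0 < q) (τ : ℝ) :
    ((q ^ (2 * τ) : ℝ) : ℂ) = ((q ^ τ : ℝ) : ℂ) ^ 2 := by
  rw [mul_comm, Real.rpow_mul hq0.le, Real.rpow_two, Complex.ofReal_pow]

theorem ofReal_rpow_two_mul_sub {q : ℝ} (hq0 : 0 < q) (τ : ℝ) (l : ℕ) :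
    ((q ^ (2 * τ - l) : ℝ) : ℂ) = ((q ^ τ : ℝ) : ℂ) ^ 2 / (q : ℂ) ^ l := by
  rw [Real.rpow_sub hq0, Real.rpow_natCast, Complex.ofReal_div, ofReal_rpow_two_mul hq0,
    Complex.ofReal_pow]

theorem ofReal_rpow_sub_two_mul {q : ℝ} (hq0 : 0 < q) (τ : ℝ) (m : ℕ) :
    ((q ^ ((m : ℝ) - 2 * τ) : ℝ) : ℂ) = (q : ℂ) ^ m / ((q ^ τ : ℝ) : ℂ) ^ 2 := by
  rw [Real.rpow_sub hq0, Real.rpow_natCast, Complex.ofReal_div, ofReal_rpow_two_mul hq0,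
    Complex.ofReal_pow]

theorem rpow_half_mul_sub {q : ℝ} (hq0 : 0 < q) (τ σ : ℝ) (j : ℕ) :
    q ^ (1 / 2 * (j : ℝ) * ((j : ℝ) - 2 * σ - 2 * τ)) =
      ((q ^ (1 / 2 : ℝ)) ^ j / (q ^ τ * q ^ σ)) ^ j := by
  rw [← Real.rpow_add hq0, ← Real.rpow_natCast (q ^ (1 / 2 : ℝ)), ← Real.rpow_mul hq0.le,
    ← Real.rpow_sub hq0, ← Real.rpow_natCast, ← Real.rpow_mul hq0.le]
  congr 1
  ring

theorem additionConst_mul_bigQJacobi {q : ℝ} (hq0 : 0 < q) {r : ℝ} (hr : r = q ^ (1 / 2 : ℝ))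
    (hq : (q : ℂ) = r ^ 2) {τ σ : ℝ}
    (h : GenericParams (r : ℂ) ((q ^ τ : ℝ) : ℂ) ((q ^ σ : ℝ) : ℂ)) {n l : ℕ} (hn : n ≤ l)
    (u v : ℂ) :
    additionConst n l τ σ q * bigQJacobi (l - n) n n (-u) (q ^ (2 * τ)) 1 q *
        bigQJacobi (l - n) n n (-v) (q ^ (2 * σ)) 1 q =
      additionCoeff r ((q ^ τ : ℝ) : ℂ) ((q ^ σ : ℝ) : ℂ) n l u v := by
  rw [bigQJacobi_natCast hq (ofReal_rpow_two_mul hq0 τ) h.base h.hw hn,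
    bigQJacobi_natCast hq (ofReal_rpow_two_mul hq0 σ) h.base h.hx hn, ← additionCoeff_eq h hn,
    additionConst, ← Nat.cast_sub hn, rpow_half_mul_sub hq0, ← hr, Complex.ofReal_neg,
    Complex.ofReal_neg, ofReal_rpow_two_mul_sub hq0, ofReal_rpow_two_mul_sub hq0, hq,
    Complex.ofReal_pow, Complex.ofReal_div, Complex.ofReal_mul, Complex.ofReal_pow]
  simp only [qShiftedList, List.map_cons, List.map_nil, List.prod_cons, List.prod_nil, mul_one]

theorem qShiftedList_eq_laguerreSubProd {q : ℝ} (hq0 : 0 < q) {r : ℂ} (hq : (q : ℂ) = r ^ 2)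
    (τ σ : ℝ) (m p n : ℕ) :
    qShiftedList [(q : ℂ) ^ m, (q : ℂ) ^ (m + p),
      ((-(q ^ ((m : ℝ) + p - 2 * σ)) : ℝ) : ℂ), ((-(q ^ ((m : ℝ) - 2 * τ)) : ℝ) : ℂ)]
      ((q : ℂ)⁻¹) n = laguerreSubProd r ((q ^ τ : ℝ) : ℂ) ((q ^ σ : ℝ) : ℂ) m p n := by
  rw [← laguerreSubProd_eq, ← Nat.cast_add, Complex.ofReal_neg, Complex.ofReal_neg,
    ofReal_rpow_sub_two_mul hq0, ofReal_rpow_sub_two_mul hq0, hq]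

end

/-- The addition formula. In the second sum the factor `(q^m; q^{-1})_n` vanishes for `n > m`, so the
truncated index `m - n` only matters for `n ≤ m`; the exponents `m - n`, `m + p -
  n` are integers. -/
theorem theorem4p1 (q : ℝ) (hq0 : 0 < q) (hq1 : q < 1) (l m p : ℕ) (σ τ : ℝ) (x : ℂ) :
    qJacobi l 0 0 x (q ^ τ) (q ^ σ) q * qLaguerre m p x (q ^ τ) (q ^ σ) q =
      (∑ n ∈ Finset.Icc 0 l,
        additionConst n l τ σ q *
          bigQJacobi (l - n) n n (-((q : ℂ) ^ m)) (q ^ (2 * τ)) 1 q *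
          bigQJacobi (l - n) n n (-((q : ℂ) ^ (m + p))) (q ^ (2 * σ)) 1 q *
          qLaguerre (m + n) p x (q ^ τ) (q ^ σ) q) +
      ∑ n ∈ Finset.Icc 1 l,
        additionConst n l τ σ q *
          qShiftedList [(q : ℂ) ^ m, (q : ℂ) ^ (m + p),
            ((-(q ^ ((m : ℝ) + p - 2 * σ)) : ℝ) : ℂ), ((-(q ^ ((m : ℝ) - 2 * τ)) : ℝ) : ℂ)]
            ((q : ℂ)⁻¹) n *
          bigQJacobi (l - n) n n (-((q : ℂ) ^ ((m : ℤ) - n))) (q ^ (2 * τ)) 1 q *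
          bigQJacobi (l - n) n n (-((q : ℂ) ^ ((m : ℤ) + p - n))) (q ^ (2 * σ)) 1 q *
          qLaguerre (m - n) p x (q ^ τ) (q ^ σ) q := by
  obtain ⟨θ, rfl⟩ := Complex.cos_surjective x
  -- With `r = √q` as base variable, half-integral powers of `q` become ordinary powers.
  obtain ⟨r, hr⟩ : ∃ r : ℝ, r = q ^ (1 / 2 : ℝ) := ⟨_, rfl⟩
  have hq : (q : ℂ) = (r : ℂ) ^ 2 := by rw [hr, ofReal_sqrt_sq hq0]
  have hs : 0 < q ^ τ := Real.rpow_pos_of_pos hq0 τ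
  have ht : 0 < q ^ σ := Real.rpow_pos_of_pos hq0 σ
  have hr0 : 0 < r := hr ▸ Real.rpow_pos_of_pos hq0 _
  have hr1 : r < 1 := hr ▸ Real.rpow_lt_one hq0.le hq1 (by norm_num)
  have h := genericParams_ofReal hr0 hr1 hs ht
  have hz : ∀ k : ℕ, 1 - -((r : ℂ) ^ 2 * ((q ^ τ : ℝ) : ℂ) ^ 2) * ((r : ℂ) ^ 2) ^ k ≠ 0 := by
    intro k
    have := one_sub_neg_ne_zero (a := r ^ 2 * (q ^ τ) ^ 2) (b := (r ^ 2) ^ k) (by positivity)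
      (by positivity)
    simpa only [Complex.ofReal_mul, Complex.ofReal_pow] using this
  have hqne : (q : ℂ) ≠ 0 := by exact_mod_cast hq0.ne'
  have hexp : ∀ a n : ℕ, (q : ℂ) ^ ((a : ℤ) - n) = ((r : ℂ) ^ 2) ^ a / ((r : ℂ) ^ 2) ^ n := by
    intro a n
    rw [zpow_sub₀ hqne, zpow_natCast, zpow_natCast, hq]
  have key := addition_formula_of_recurrences h p (legendrePoly_zero _ _ _ θ)
    (legendrePoly_one_recurrence h hz θ) (legendrePoly_recurrence h hz θ)
    (laguerrePoly_recurrence h θ p) m l l le_rfl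
  simp only [qJacobi_zero_zero_cos hr hq h, qLaguerre_natCast_cos hq0 hr hq h,
    qShiftedList_eq_laguerreSubProd hq0 hq]
  -- Splitting off `n = 0` and shifting both indices by one gives the shape of `key`, where the
  -- length is `l`.
  rw [key, ← Finset.Ico_add_one_right_eq_Icc, ← Finset.Ico_add_one_right_eq_Icc,
    Finset.sum_Ico_eq_sum_range, Finset.sum_Ico_eq_sum_range, Nat.sub_zero, Nat.add_sub_cancel,
    Finset.sum_range_succ', add_comm (additionCoeff _ _ _ 0 l _ _ * _)]
  refine congrArg₂ (· + ·) (congrArg₂ (· + ·) (Finset.sum_congr rfl fun n hn => ?_) ?_)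
    (Finset.sum_congr rfl fun n hn => ?_)
  · rw [zero_add, additionConst_mul_bigQJacobi hq0 hr hq h (Finset.mem_range.1 hn), hq]
  · rw [zero_add, add_zero, additionConst_mul_bigQJacobi hq0 hr hq h (Nat.zero_le l), hq]
  · rw [add_comm 1 n, ← Nat.cast_add m p, hexp, hexp, mul_right_comm (additionConst _ _ _ _ _),
      mul_right_comm (additionConst _ _ _ _ _ * _),
      additionConst_mul_bigQJacobi hq0 hr hq h (Finset.mem_range.1 hn),
      mul_comm (laguerreSubProd _ _ _ _ _ _)]
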